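/- Let $m$ be a positive integer. Consider the matrix Sturm--Liouville equation $$-Y''+Q(x)Y=\rho^2Y,\qquad -\infty<x<\infty, \tag{1}$$ where the potential $Q:\mathbb R\to\mathbb C^{m\times m}$ is measurable, self-adjoint ($Q(x)=Q^*(x)$ for almost all $x$) and satisfies $$\int_{-\infty}^{\infty}(1+|x|)\,|Q_{jk}(x)|\,dx<\infty,\qquad j,k=1,\dots,m. \tag{2}$$ Solutions are continuously differentiable with locally absolutely continuous derivative and satisfy (1) almost everywhere. For $\operatorname{Im}\rho\ge0$ let $F_\pm(x,\rho)$ be the Jost solutions, that is, the unique $m\times m$ matrix solutions of (1) with $\lim_{x\to\pm\infty}e^{\mp i\rho x}F_\pm(x,\rho)=I_m$. For real $\rho\ne0$ the $m\times m$ matrices $A(\rho),B(\rho),C(\rho),D(\rho)$ are defined by $$F_+(x,\rho)=F_-(x,-\rho)A(\rho)+F_-(x,\rho)B(\rho),\qquad F_-(x,\rho)=F_+(x,\rho)C(\rho)+F_+(x,-\rho)D(\rho),$$ and $S_-(\rho)=B(\rho)A(\rho)^{-1}$, $S_+(\rho)=C(\rho)D(\rho)^{-1}$ are the left and right scattering matrices.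 The functions $A$ and $D$ continue analytically to $\operatorname{Im}\rho>0$ by $$A(\rho)=-\frac1{2i\rho}\bigl(\bar F_-'(x,\rho)F_+(x,\rho)-\bar F_-(x,\rho)F_+'(x,\rho)\bigr),\qquad \bar F_-(x,\rho)=F_-^*(x,-\bar\rho),\qquad D(\rho)=A^*(-\bar\rho)$$ (the first expression does not depend on $x$). An eigenvalue is a number $\lambda=\rho^2$ for which (1) has a nonzero solution in $L_2(\mathbb R;\mathbb C^m)$; there are finitely many eigenvalues, $\rho_k^2$ with $\rho_k=i\tau_k$, $\tau_k>0$, $k=1,\dots,N$, all distinct. With $R_k^-=\operatorname{Res}_{\rho=\rho_k}A(\rho)^{-1}$ and $R_k^+=\operatorname{Res}_{\rho=\rho_k}D(\rho)^{-1}$ (the poles are simple), the left and right weight matrices $N_k^-$, $N_k^+$ are determined by $$F_+(x,\rho_k)R_k^-=iF_-(x,\rho_k)N_k^-,\qquad F_-(x,\rho_k)R_k^+=iF_+(x,\rho_k)N_k^+.$$ The collections $$J_\pm=\bigl\{\{S_\pm(\rho)\}_{\rho\in\mathbb R\setminus\{0\}},\ \{(\rho_k^2,N_k^\pm)\}_{k=1}^N\bigr\}$$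 are the right ($J_+$) and left ($J_-$) scattering data of $Q$. **Uniqueness theorem.** The potential $Q$ is uniquely determined by $J_+$, and it is also uniquely determined by $J_-$: if $Q_1$ and $Q_2$ are two self-adjoint potentials satisfying (2) that have the same right scattering data, or the same left scattering data, then $Q_1(x)=Q_2(x)$ for almost all $x\in\mathbb R$. -/

import Mathlib

open MeasureTheory Filter Topology

noncomputable section

namespace MatrixScattering

/-- Complex `m × m` matrices. -/
abbrev Mat (m : ℕ) : Type := Matrix (Fin m) (Fin m) ℂ

/-- The class of potentials: (measurable) self-adjoint matrix functions `Q` on the real line with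
`∫ (1 + |x|) |Q_jk(x)| dx < ∞` for all entries.  As always for potentials, the condition
`Q(x) = Q(x)^*` is understood almost everywhere. -/
structure IsPotential {m : ℕ} (Q : ℝ → Mat m) : Prop where
  measurable : ∀ j k, AEStronglyMeasurable (fun x => Q x j k) volume
  selfAdjoint : ∀ᵐ x : ℝ, (Q x).IsHermitian
  integrable : ∀ j k, Integrable (fun x : ℝ => (1 + |x|) * ‖Q x j k‖) volume

/-- `y` is a (vector) solution of `-y'' + Q(x) y = lam y` on the real line, in the usual sense for
an integrable potential: `y` is continuously differentiable, `y'` is locally absolutely continuous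
and the equation holds almost everywhere.  As `Q` is locally integrable, this means that `y` has
a derivative `y'` which is a primitive of `(Q - lam) y`. -/
def IsSolution {m : ℕ} (Q : ℝ → Mat m) (lam : ℂ) (y : ℝ → Fin m → ℂ) : Prop :=
  ∃ y' : ℝ → Fin m → ℂ, (∀ x, HasDerivAt y (y' x) x) ∧
    ∀ a b : ℝ, y' b - y' a = ∫ x in a..b, ((Q x).mulVec (y x) - lam • y x)

/-- `F` is a matrix solution: each column is a solution. -/
def IsMatrixSolution {m : ℕ} (Q : ℝ → Mat m) (lam : ℂ) (F : ℝ → Mat m) : Prop :=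
  ∀ k : Fin m, IsSolution Q lam (fun x j => F x j k)

/-- The defining property of the Jost solution `F_+(·, ρ)`, `Im ρ ≥ 0`. -/
def IsJostPlus {m : ℕ} (Q : ℝ → Mat m) (ρ : ℂ) (F : ℝ → Mat m) : Prop :=
  IsMatrixSolution Q (ρ ^ 2) F ∧
    Tendsto (fun x : ℝ => Complex.exp (-(Complex.I * ρ * (x : ℂ))) • F x) atTop (𝓝 1)

/-- The defining property of the Jost solution `F_-(·, ρ)`, `Im ρ ≥ 0`. -/
def IsJostMinus {m : ℕ} (Q : ℝ → Mat m) (ρ : ℂ) (F : ℝ → Mat m) : Prop :=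
  IsMatrixSolution Q (ρ ^ 2) F ∧
    Tendsto (fun x : ℝ => Complex.exp (Complex.I * ρ * (x : ℂ)) • F x) atBot (𝓝 1)

/-- The Jost solution `x ↦ F_+(x, ρ)`, `Im ρ ≥ 0`. -/
def jostPlus {m : ℕ} (Q : ℝ → Mat m) (ρ : ℂ) : ℝ → Mat m :=
  Classical.epsilon (IsJostPlus Q ρ)

/-- The Jost solution `x ↦ F_-(x, ρ)`, `Im ρ ≥ 0`. -/
def jostMinus {m : ℕ} (Q : ℝ → Mat m) (ρ : ℂ) : ℝ → Mat m :=
  Classical.epsilon (IsJostMinus Q ρ)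

/-- The pair `(A(ρ), B(ρ))`, for real `ρ ≠ 0`, of coefficients in
`F_+(x, ρ) = F_-(x, -ρ) A(ρ) + F_-(x, ρ) B(ρ)`. -/
def coeffAB {m : ℕ} (Q : ℝ → Mat m) (ρ : ℝ) : Mat m × Mat m :=
  Classical.epsilon fun AB : Mat m × Mat m => ∀ x : ℝ,
    jostPlus Q (ρ : ℂ) x = jostMinus Q (-(ρ : ℂ)) x * AB.1 + jostMinus Q (ρ : ℂ) x * AB.2

/-- The pair `(C(ρ), D(ρ))`, for real `ρ ≠ 0`, of coefficients in
`F_-(x, ρ) = F_+(x, ρ) C(ρ) + F_+(x, -ρ) D(ρ)`. -/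
def coeffCD {m : ℕ} (Q : ℝ → Mat m) (ρ : ℝ) : Mat m × Mat m :=
  Classical.epsilon fun CD : Mat m × Mat m => ∀ x : ℝ,
    jostMinus Q (ρ : ℂ) x = jostPlus Q (ρ : ℂ) x * CD.1 + jostPlus Q (-(ρ : ℂ)) x * CD.2

/-- The left scattering matrix `S_-(ρ) = B(ρ) A(ρ)⁻¹`, for real `ρ ≠ 0`. -/
def scatMinus {m : ℕ} (Q : ℝ → Mat m) (ρ : ℝ) : Mat m :=
  (coeffAB Q ρ).2 * (coeffAB Q ρ).1⁻¹

/-- The right scattering matrix `S_+(ρ) = C(ρ) D(ρ)⁻¹`, for real `ρ ≠ 0`. -/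
def scatPlus {m : ℕ} (Q : ℝ → Mat m) (ρ : ℝ) : Mat m :=
  (coeffCD Q ρ).1 * (coeffCD Q ρ).2⁻¹

/-- The derivative of a matrix function, entry by entry. -/
def matDeriv {m : ℕ} (F : ℝ → Mat m) (x : ℝ) : Mat m :=
  Matrix.of fun j k => deriv (fun t => F t j k) x

/-- The matrix Wronskian `⟨Z, Y⟩ = Z' Y - Z Y'` at the point `x`. -/
def wronskian {m : ℕ} (Z Y : ℝ → Mat m) (x : ℝ) : Mat m :=
  matDeriv Z x * Y x - Z x * matDeriv Y x

/-- `F_-(x, -conj ρ)^*`, which (as `Q` is self-adjoint) is the Jost solution of the adjoint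
equation `-Z'' + Z Q(x) = ρ² Z` with `exp (i ρ x) Z(x) → I` as `x → -∞`. -/
def jostMinusBar {m : ℕ} (Q : ℝ → Mat m) (ρ : ℂ) (x : ℝ) : Mat m :=
  (jostMinus Q (-(starRingEnd ℂ ρ)) x).conjTranspose

/-- The analytic continuation of `A` to `Im ρ > 0`: `A(ρ) = -(2iρ)⁻¹ ⟨F̄_-(x, ρ), F_+(x, ρ)⟩`.
The Wronskian does not depend on `x`; it is evaluated at `x = 0`. -/
def upperA {m : ℕ} (Q : ℝ → Mat m) (ρ : ℂ) : Mat m :=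
  (-(2 * Complex.I * ρ)⁻¹) • wronskian (jostMinusBar Q ρ) (jostPlus Q ρ) 0

/-- The analytic continuation of `D` to `Im ρ > 0`: `D(ρ) = A(-conj ρ)^*`. -/
def upperD {m : ℕ} (Q : ℝ → Mat m) (ρ : ℂ) : Mat m :=
  (upperA Q (-(starRingEnd ℂ ρ))).conjTranspose

/-- `lam` is an eigenvalue: the equation `-y'' + Q(x) y = lam y` has a nonzero solution in
`L₂(ℝ; ℂ^m)`. -/
def IsEigenvalue {m : ℕ} (Q : ℝ → Mat m) (lam : ℂ) : Prop :=
  ∃ y : ℝ → Fin m → ℂ, IsSolution Q lam y ∧ y ≠ 0 ∧ ∀ j, MemLp (fun x => y x j) 2 volume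

/-- `R^-`, the residue of `A(ρ)⁻¹` at the (simple) pole `ρk`. -/
def resMinus {m : ℕ} (Q : ℝ → Mat m) (ρk : ℂ) : Mat m :=
  limUnder (𝓝[≠] ρk) (fun ρ : ℂ => (ρ - ρk) • (upperA Q ρ)⁻¹)

/-- `R^+`, the residue of `D(ρ)⁻¹` at the (simple) pole `ρk`. -/
def resPlus {m : ℕ} (Q : ℝ → Mat m) (ρk : ℂ) : Mat m :=
  limUnder (𝓝[≠] ρk) (fun ρ : ℂ => (ρ - ρk) • (upperD Q ρ)⁻¹)

/-- The left weight matrix `N^-`, determined by `F_+(x, ρk) R^- = i F_-(x, ρk) N^-`. -/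
def weightMinus {m : ℕ} (Q : ℝ → Mat m) (ρk : ℂ) : Mat m :=
  Classical.epsilon fun N : Mat m => ∀ x : ℝ,
    jostPlus Q ρk x * resMinus Q ρk = Complex.I • (jostMinus Q ρk x * N)

/-- The right weight matrix `N^+`, determined by `F_-(x, ρk) R^+ = i F_+(x, ρk) N^+`. -/
def weightPlus {m : ℕ} (Q : ℝ → Mat m) (ρk : ℂ) : Mat m :=
  Classical.epsilon fun N : Mat m => ∀ x : ℝ,
    jostMinus Q ρk x * resPlus Q ρk = Complex.I • (jostPlus Q ρk x * N)

/-- Scattering data: a matrix function of real `ρ ≠ 0`, and a collection of pairs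
`(ρk², N_k)` of eigenvalues and weight matrices. -/
structure ScatteringData (m : ℕ) where
  scat : {ρ : ℝ // ρ ≠ 0} → Mat m
  discrete : Set (ℂ × Mat m)

/-- The right scattering data `J_+` of the potential `Q`. -/
def rightData {m : ℕ} (Q : ℝ → Mat m) : ScatteringData m where
  scat := fun ρ => scatPlus Q ρ
  discrete := {p | ∃ ρk : ℂ, 0 < ρk.im ∧ IsEigenvalue Q (ρk ^ 2) ∧
    p = (ρk ^ 2, weightPlus Q ρk)}

/-- The left scattering data `J_-` of the potential `Q`. -/
def leftData {m : ℕ} (Q : ℝ → Mat m) : ScatteringData m where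
  scat := fun ρ => scatMinus Q ρ
  discrete := {p | ∃ ρk : ℂ, 0 < ρk.im ∧ IsEigenvalue Q (ρk ^ 2) ∧
    p = (ρk ^ 2, weightMinus Q ρk)}

end MatrixScattering

end

/-! Fix `x` and a vector `v`. For two potentials with equal right data let g(ρ) be the difference of
the reduced Jost solutions e^{-iρx}F_+(x,ρ), and h(ρ) the difference of the reduced Weyl solutions
e^{iρx}F_-(x,ρ)D(ρ)⁻¹ (`dG`, `dH`). For real s ≠ 0 the relation between F_- and F_+ gives h(s) =
e^{2isx} g(s) S(s) + g(-s) with the common matrix S = S_+ (`jH_real`). As D*D = 1 + C*C, S is a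
contraction, so |h(s)*v - g(-s)*v| ≤ |g(s)*v|. With p(ρ) = v* h(ρ) g(-ρ̄)* v (`pairing`), squaring
gives |h(s)*v|² ≤ 2 Re p(s) + |g(s)*v|² - |g(-s)*v|², and the last two terms cancel after
integration over the line.

The function p is meromorphic in the upper half plane, is O(|ρ|⁻²) at infinity, and has poles only
on the imaginary axis. At iτ its residue is i e^{-2τx} v* g N g* v, where N is the common weight
matrix. Since N ≥ 0, 2πi times the residue is at most 0, hence Re ∫ p ≤ 0 (`pairing_real`), so ∫
|h*v|² ≤ 0 and h = 0 (`dH_eq_zero`). The Weyl solutions of both equations then agree for every real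
s ≠ 0. Comparing their second derivatives gives (Q₁ - Q₂)Φ = 0 almost everywhere, and Φ is
invertible for large s (`ae_eq_of_scattering`).

What has to be known about D follows largely from one energy estimate, `jump_inequality`: F_- to the
left of a point is continued to the right by a multiple of F_+. The derivative then jumps by a
multiple of D, and self-adjointness controls the L² mass by that jump. This yields |D⁻¹| ≤ C|ρ|/|Re
ρ| in strips (`exists_norm_jD_inv_le`), hence singularities on the imaginary axis only, simple poles
(`exists_residue`), and N ≥ 0 (`weight_nonneg`).

The behaviour of D⁻¹ at the origin and the accumulation of poles there are never analysed. The
contour is the line Im ρ = ε, and p is multiplied by 1 + ε²/ρ² (`damp`). On the line this factor is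
at most 2|Re ρ|/|ρ|, which cancels the bound for D⁻¹. At iτ with τ ≥ ε it is 1 - ε²/τ² ≥ 0, so the
residues keep their sign. Then ε tends to 0 by dominated convergence.

The left data are the right data of the reflected potential Q(-x). -/

noncomputable section
namespace MatrixScattering

open Set

/-! ### Calculus of locally absolutely continuous functions -/

section Primitive

variable {E F G : Type*} [NormedAddCommGroup E] [NormedSpace ℝ E] [NormedAddCommGroup F]
  [NormedSpace ℝ F] [NormedAddCommGroup G] [NormedSpace ℝ G]

/-- `f` is a primitive of the locally integrable function `f'`. -/
structure IsPrimitive (f f' : ℝ → E) : Prop where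
  int : ∀ a b, IntervalIntegrable f' volume a b
  eq : ∀ a b, f b - f a = ∫ x in a..b, f' x

theorem absolutelyContinuousOnInterval_of_dist_le {X : Type*} [PseudoMetricSpace X]
    {f : ℝ → X} {g : ℝ → ℝ} {a b : ℝ}
    (hg : AbsolutelyContinuousOnInterval g a b)
    (h : ∀ x ∈ uIcc a b, ∀ y ∈ uIcc a b, dist (f x) (f y) ≤ dist (g x) (g y)) :
    AbsolutelyContinuousOnInterval f a b := by
  rw [absolutelyContinuousOnInterval_iff] at hg ⊢
  intro ε hε
  obtain ⟨δ, hδ, H⟩ := hg ε hε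
  refine ⟨δ, hδ, fun I hI hlt => lt_of_le_of_lt ?_ (H I hI hlt)⟩
  refine Finset.sum_le_sum fun i hi => ?_
  have := hI.1 i hi
  exact h _ this.1 _ this.2

theorem IsPrimitive.continuous [CompleteSpace E] {f f' : ℝ → E} (hf : IsPrimitive f f') : Continuous f := by
  have : f = fun x => f 0 + ∫ t in (0 : ℝ)..x, f' t := by
    ext x; rw [← hf.eq]; abel
  rw [this]
  exact continuous_const.add (intervalIntegral.continuous_primitive hf.int 0)

theorem IsPrimitive.ae_hasDerivAt [CompleteSpace E] {f f' : ℝ → E} (hf : IsPrimitive f f') :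
    ∀ᵐ x, HasDerivAt f (f' x) x := by
  have hloc : LocallyIntegrable f' volume := by
    rw [MeasureTheory.locallyIntegrable_iff]
    intro k hk
    obtain ⟨r, hr⟩ := hk.isBounded.subset_closedBall 0
    rw [Real.closedBall_eq_Icc] at hr
    have h : -|r| ≤ |r| := by linarith [abs_nonneg r]
    exact (((intervalIntegrable_iff_integrableOn_Icc_of_le h).1 (hf.int _ _))).mono_set
      (hr.trans (Icc_subset_Icc (by linarith [le_abs_self r]) (by linarith [le_abs_self r])))
  filter_upwards [LocallyIntegrable.ae_hasDerivAt_integral hloc] with x hx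
  have h := (hx 0).const_add (f 0)
  refine h.congr_of_eventuallyEq (Eventually.of_forall fun y => ?_)
  change f y = f 0 + _
  rw [← hf.eq]; abel

/-- Product rule when the derivatives are only integrable. The product minus the integral of the
expected derivative is absolutely continuous with derivative zero almost everywhere, hence constant.
-/
theorem IsPrimitive.bilin [CompleteSpace E] [CompleteSpace F] [CompleteSpace G]
    (B : E →L[ℝ] F →L[ℝ] G) {f f' : ℝ → E} {g g' : ℝ → F}
    (hf : IsPrimitive f f') (hg : IsPrimitive g g') :
    IsPrimitive (fun x => B (f x) (g x)) (fun x => B (f x) (g' x) + B (f' x) (g x)) := by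
  have hint : ∀ a b, IntervalIntegrable (fun x => B (f x) (g' x) + B (f' x) (g x)) volume a b := by
    intro a b
    refine IntervalIntegrable.add ?_ ?_
    · have h1 := (hg.int a b)
      rw [intervalIntegrable_iff] at h1 ⊢
      obtain ⟨C, hC⟩ := isCompact_uIcc.exists_bound_of_continuousOn (s := uIcc a b)
        hf.continuous.continuousOn
      refine Integrable.mono' (h1.norm.const_mul (‖B‖ * C))
        (B.aestronglyMeasurable_comp₂ hf.continuous.aestronglyMeasurable
          h1.aestronglyMeasurable) ?_
      filter_upwards [ae_restrict_mem measurableSet_uIoc] with x hx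
      refine (B.le_opNorm₂ _ _).trans ?_
      gcongr
      exact hC x (uIoc_subset_uIcc hx)
    · have h1 := (hf.int a b)
      rw [intervalIntegrable_iff] at h1 ⊢
      obtain ⟨C, hC⟩ := isCompact_uIcc.exists_bound_of_continuousOn (s := uIcc a b)
        hg.continuous.continuousOn
      refine Integrable.mono' (h1.norm.const_mul (‖B‖ * C))
        (B.aestronglyMeasurable_comp₂ h1.aestronglyMeasurable
          hg.continuous.aestronglyMeasurable) ?_
      filter_upwards [ae_restrict_mem measurableSet_uIoc] with x hx
      refine (B.le_opNorm₂ _ _).trans ?_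
      rw [mul_assoc, mul_assoc, mul_comm ‖f' x‖]
      gcongr
      exact hC x (uIoc_subset_uIcc hx)
  refine ⟨hint, fun a b => ?_⟩
  set p : ℝ → G := fun x => B (f x) (g x)
  set p' : ℝ → G := fun x => B (f x) (g' x) + B (f' x) (g x)
  obtain ⟨C, hC⟩ := isCompact_uIcc.exists_bound_of_continuousOn (s := uIcc a b)
    hf.continuous.continuousOn
  obtain ⟨D, hD⟩ := isCompact_uIcc.exists_bound_of_continuousOn (s := uIcc a b)
    hg.continuous.continuousOn
  have hC0 : 0 ≤ C := (norm_nonneg _).trans (hC a left_mem_uIcc)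
  have hD0 : 0 ≤ D := (norm_nonneg _).trans (hD a left_mem_uIcc)
  -- An increment of `p` minus the integral of `p'` splits as B(f y, Δg) + B(Δf, g x) - ∫ p'. The
  -- three summands of `w` dominate these three terms, so absolute continuity is inherited from the
  -- primitive of `w`.
  set w : ℝ → ℝ := fun t => ‖B‖ * C * ‖g' t‖ + ‖B‖ * D * ‖f' t‖ + ‖p' t‖
  have hwint : ∀ a b, IntervalIntegrable w volume a b := fun a b =>
    (((hg.int a b).norm.const_mul _).add ((hf.int a b).norm.const_mul _)).add (hint a b).norm
  have hw0 : ∀ t, 0 ≤ w t := fun t => by positivity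
  have hH := (hwint a b).absolutelyContinuousOnInterval_intervalIntegral (c := a) left_mem_uIcc
  have hAC : AbsolutelyContinuousOnInterval (fun x => p x - ∫ t in a..x, p' t) a b := by
    refine absolutelyContinuousOnInterval_of_dist_le hH ?_
    have key : ∀ x ∈ uIcc a b, ∀ y ∈ uIcc a b, x ≤ y →
        ‖(p y - ∫ t in a..y, p' t) - (p x - ∫ t in a..x, p' t)‖ ≤ ∫ t in x..y, w t := by
      intro x hx y hy hxy
      have e1 : (p y - ∫ t in a..y, p' t) - (p x - ∫ t in a..x, p' t)
          = B (f y) (g y - g x) + B (f y - f x) (g x) - ∫ t in x..y, p' t := by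
        rw [← intervalIntegral.integral_interval_sub_left (hint a y) (hint a x)]
        simp only [p, map_sub, sub_apply]
        abel
      rw [e1]
      have e2 : ∫ t in x..y, w t = ‖B‖ * C * (∫ t in x..y, ‖g' t‖)
          + ‖B‖ * D * (∫ t in x..y, ‖f' t‖) + ∫ t in x..y, ‖p' t‖ := by
        simp only [w]
        rw [intervalIntegral.integral_add (((hg.int x y).norm.const_mul _).add
          ((hf.int x y).norm.const_mul _)) (hint x y).norm,
          intervalIntegral.integral_add ((hg.int x y).norm.const_mul _)
          ((hf.int x y).norm.const_mul _), intervalIntegral.integral_const_mul,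
          intervalIntegral.integral_const_mul]
      have hg1 : ‖g y - g x‖ ≤ ∫ t in x..y, ‖g' t‖ := by
        rw [hg.eq]; exact intervalIntegral.norm_integral_le_integral_norm hxy
      have hf1 : ‖f y - f x‖ ≤ ∫ t in x..y, ‖f' t‖ := by
        rw [hf.eq]; exact intervalIntegral.norm_integral_le_integral_norm hxy
      have hp1 : ‖∫ t in x..y, p' t‖ ≤ ∫ t in x..y, ‖p' t‖ :=
        intervalIntegral.norm_integral_le_integral_norm hxy
      rw [e2]
      refine (_root_.norm_sub_le _ _).trans (add_le_add ((norm_add_le _ _).trans (add_le_add ?_ ?_)) hp1)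
      · refine (B.le_opNorm₂ _ _).trans ?_
        gcongr
        exact hC y hy
      · refine (B.le_opNorm₂ _ _).trans ?_
        rw [mul_assoc, mul_comm _ ‖g x‖, ← mul_assoc]
        gcongr
        exact hD x hx
    intro x hx y hy
    rw [dist_eq_norm, Real.dist_eq, intervalIntegral.integral_interval_sub_left (hwint a x)
      (hwint a y)]
    rcases le_total x y with h | h
    · rw [norm_sub_rev, intervalIntegral.integral_symm x y, abs_neg]
      exact (key x hx y hy h).trans (le_abs_self _)
    · exact (key y hy x hx h).trans (le_abs_self _)
  have hP : IsPrimitive (fun x => ∫ t in a..x, p' t) p' := ⟨hint, fun c d => by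
    rw [intervalIntegral.integral_interval_sub_left (hint a d) (hint a c)]⟩
  obtain ⟨K, hK⟩ := hAC.const_of_ae_hasDerivAt_zero (by
    filter_upwards [hf.ae_hasDerivAt, hg.ae_hasDerivAt, hP.ae_hasDerivAt] with x h1 h2 h3 _
    have h4 := (B.hasFDerivAt_of_bilinear h1.hasFDerivAt h2.hasFDerivAt).hasDerivAt.sub h3
    refine HasDerivAt.congr_deriv (h4 : HasDerivAt (fun x => p x - ∫ t in a..x, p' t) _ x) ?_
    simp [p'])
  have e1 := hK a left_mem_uIcc
  have e2 := hK b right_mem_uIcc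
  simp only [intervalIntegral.integral_same, sub_zero] at e1
  change p b - p a = _
  rw [sub_eq_iff_eq_add.1 e2, e1]
  abel

theorem IsPrimitive.add {f f' g g' : ℝ → E}
    (hf : IsPrimitive f f') (hg : IsPrimitive g g') :
    IsPrimitive (fun x => f x + g x) (fun x => f' x + g' x) :=
  ⟨fun a b => (hf.int a b).add (hg.int a b), fun a b => by
    rw [intervalIntegral.integral_add (hf.int a b) (hg.int a b), ← hf.eq, ← hg.eq]; abel⟩

theorem IsPrimitive.sub {f f' g g' : ℝ → E}
    (hf : IsPrimitive f f') (hg : IsPrimitive g g') :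
    IsPrimitive (fun x => f x - g x) (fun x => f' x - g' x) :=
  ⟨fun a b => (hf.int a b).sub (hg.int a b), fun a b => by
    rw [intervalIntegral.integral_sub (hf.int a b) (hg.int a b), ← hf.eq, ← hg.eq]; abel⟩

theorem IsPrimitive.map [CompleteSpace E] [CompleteSpace F] (L : E →L[ℝ] F) {f f' : ℝ → E} (hf : IsPrimitive f f') :
    IsPrimitive (fun x => L (f x)) (fun x => L (f' x)) :=
  ⟨fun a b => ⟨L.integrable_comp (hf.int a b).1, L.integrable_comp (hf.int a b).2⟩, fun a b => by
    rw [L.intervalIntegral_comp_comm (hf.int a b), ← hf.eq, map_sub]⟩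

theorem IsPrimitive.of_hasDerivAt [CompleteSpace E] {f f' : ℝ → E}
    (h : ∀ x, HasDerivAt f (f' x) x) (hc : Continuous f') : IsPrimitive f f' :=
  ⟨fun a b => hc.intervalIntegrable a b, fun a b =>
    (intervalIntegral.integral_eq_sub_of_hasDerivAt (fun x _ => h x)
      (hc.intervalIntegrable a b)).symm⟩

theorem IsPrimitive.congr {f f' g g' : ℝ → E} (hf : IsPrimitive f f') (h : ∀ x, f x = g x)
    (h' : ∀ x, f' x = g' x) : IsPrimitive g g' := by
  obtain rfl : f = g := funext h
  obtain rfl : f' = g' := funext h'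
  exact hf

theorem IsPrimitive.hasDerivAt [CompleteSpace E] {f f' : ℝ → E} (hf : IsPrimitive f f')
    (hc : Continuous f') (x : ℝ) : HasDerivAt f (f' x) x := by
  have h := (intervalIntegral.integral_hasDerivAt_right (hf.int 0 x)
    hc.stronglyMeasurable.stronglyMeasurableAtFilter hc.continuousAt).const_add (f 0)
  refine h.congr_of_eventuallyEq (Eventually.of_forall fun y => ?_)
  change f y = f 0 + _
  rw [← hf.eq]; abel

theorem IsPrimitive.neg {f f' : ℝ → E} (hf : IsPrimitive f f') :
    IsPrimitive (fun x => -f x) (fun x => -f' x) :=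
  ⟨fun a b => (hf.int a b).neg, fun a b => by
    rw [intervalIntegral.integral_neg, ← hf.eq]; abel⟩

theorem IsPrimitive.comp_neg {f f' : ℝ → E} (hf : IsPrimitive f f') :
    IsPrimitive (fun x => f (-x)) (fun x => -f' (-x)) :=
  ⟨fun a b => by
    have := (hf.int (-a) (-b)).comp_sub_left 0
    simp only [zero_sub, neg_neg] at this
    exact this.neg, fun a b => by
    rw [intervalIntegral.integral_neg, intervalIntegral.integral_comp_neg (fun x => f' x),
      intervalIntegral.integral_symm, neg_neg, ← hf.eq]⟩

theorem IsPrimitive.integral_Ioi {f : ℝ → E} (hf : ∀ a, IntegrableOn f (Ioi a)) :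
    IsPrimitive (fun x => ∫ t in Ioi x, f t) (fun x => -f x) := by
  have hi : ∀ a b, IntervalIntegrable f volume a b := fun a b => by
    rw [intervalIntegrable_iff]
    exact (hf (min a b)).mono_set Ioc_subset_Ioi_self
  refine ⟨fun a b => (hi a b).neg, fun a b => ?_⟩
  rw [intervalIntegral.integral_neg]
  have := intervalIntegral.integral_Ioi_sub_Ioi' (hf a) (hf b)
  rw [← this]; abel

end Primitive

section Algebra

variable {𝔸 : Type*} [NormedRing 𝔸] [NormedAlgebra ℂ 𝔸] [CompleteSpace 𝔸]

theorem IsPrimitive.mul {f f' g g' : ℝ → 𝔸} (hf : IsPrimitive f f') (hg : IsPrimitive g g') :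
    IsPrimitive (fun x => f x * g x) (fun x => f x * g' x + f' x * g x) :=
  IsPrimitive.bilin (ContinuousLinearMap.mul ℝ 𝔸) hf hg

theorem IsPrimitive.smul {f f' : ℝ → ℂ} {g g' : ℝ → 𝔸} (hf : IsPrimitive f f')
    (hg : IsPrimitive g g') :
    IsPrimitive (fun x => f x • g x) (fun x => f x • g' x + f' x • g x) :=
  IsPrimitive.bilin (ContinuousLinearMap.lsmul ℝ ℂ) hf hg

theorem IsPrimitive.mul_const {f f' : ℝ → 𝔸} (hf : IsPrimitive f f') (c : 𝔸) :
    IsPrimitive (fun x => f x * c) (fun x => f' x * c) :=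
  hf.map ((ContinuousLinearMap.mul ℝ 𝔸).flip c)

theorem IsPrimitive.const_smul {f f' : ℝ → 𝔸} (hf : IsPrimitive f f') (c : ℂ) :
    IsPrimitive (fun x => c • f x) (fun x => c • f' x) :=
  hf.map (ContinuousLinearMap.lsmul ℝ ℂ c)

end Algebra

/-! ### Tail integrals and their powers -/

theorem tail_nonneg {p : ℝ → ℝ} (h0 : ∀ x, 0 ≤ p x) (x : ℝ) : 0 ≤ ∫ s in Ioi x, p s :=
  setIntegral_nonneg measurableSet_Ioi fun _ _ => h0 _

theorem tail_antitone {p : ℝ → ℝ} (hp : Integrable p) (h0 : ∀ x, 0 ≤ p x) :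
    Antitone fun x => ∫ s in Ioi x, p s := fun _ _ hxy =>
  setIntegral_mono_set hp.integrableOn (Eventually.of_forall h0)
    (Ioi_subset_Ioi hxy).eventuallyLE

/-- The tail integral is only absolutely continuous, so the power rule is obtained by iterating the
product rule. -/
theorem tail_isPrimitive {p : ℝ → ℝ} (hp : Integrable p) (n : ℕ) :
    IsPrimitive (fun x => (∫ s in Ioi x, p s) ^ (n + 1))
      (fun x => -((n + 1) * (p x * (∫ s in Ioi x, p s) ^ n))) := by
  have h1 : IsPrimitive (fun x => ∫ s in Ioi x, p s) (fun x => -p x) :=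
    IsPrimitive.integral_Ioi fun _ => hp.integrableOn
  induction n with
  | zero => exact h1.congr (by simp) (by simp)
  | succ n ih =>
    refine (IsPrimitive.bilin (ContinuousLinearMap.mul ℝ ℝ) ih h1).congr (fun x => ?_) fun x => ?_
    · simp [pow_succ]
    · simp only [ContinuousLinearMap.mul_apply']
      push_cast
      ring

theorem tail_pow_integrable {p : ℝ → ℝ} (hp : Integrable p)
    (h0 : ∀ x, 0 ≤ p x) (n : ℕ) (a : ℝ) :
    IntegrableOn (fun t => p t * (∫ s in Ioi t, p s) ^ n) (Ioi a) := by
  refine Integrable.mono' ((hp.integrableOn (s := Ioi a)).mul_const ((∫ s in Ioi a, p s) ^ n))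
    ?_ ?_
  · exact hp.aestronglyMeasurable.restrict.mul
      (((tail_antitone hp h0).measurable.pow_const n).aestronglyMeasurable)
  · filter_upwards [ae_restrict_mem measurableSet_Ioi] with t ht
    rw [Real.norm_of_nonneg (mul_nonneg (h0 t) (pow_nonneg (tail_nonneg h0 t) n))]
    have := tail_antitone hp h0 (le_of_lt ht)
    have := tail_nonneg h0 t
    have := h0 t
    gcongr

/-- Powers of the tail `P(x) = ∫_x^∞ p` satisfy `∫_x^∞ p P^n = P(x)^(n+1)/(n+1)`. -/
theorem integral_Ioi_tail_pow {p : ℝ → ℝ} (hp : Integrable p)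
    (h0 : ∀ x, 0 ≤ p x) (n : ℕ) (a : ℝ) :
    ∫ t in Ioi a, p t * (∫ s in Ioi t, p s) ^ n = (∫ s in Ioi a, p s) ^ (n + 1) / (n + 1) := by
  have h1 := tail_isPrimitive hp n
  have h2 : Tendsto (fun b => ∫ s in Ioi b, p s) atTop (𝓝 0) :=
    tendsto_integral_Ioi_zero tendsto_id
  have h3 := intervalIntegral_tendsto_integral_Ioi a
    (((tail_pow_integrable hp h0 n a).const_mul (n + 1 : ℝ)).neg) tendsto_id
  have h4 := ((h2.pow (n + 1)).sub_const ((∫ s in Ioi a, p s) ^ (n + 1)))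
  have h5 := tendsto_nhds_unique h3 (h4.congr fun b => h1.eq a b)
  simp only [Pi.neg_apply] at h5
  rw [MeasureTheory.integral_neg, MeasureTheory.integral_const_mul] at h5
  simp only [ne_eq, Nat.add_eq_zero_iff, one_ne_zero, and_false, not_false_eq_true, zero_pow,
    zero_sub, neg_inj] at h5
  rw [← h5]
  field_simp



end MatrixScattering
end

/-! ### Holomorphic parameter integrals and the Volterra kernel -/

noncomputable section
set_option linter.unusedSectionVars false

namespace MatrixScattering

open Set

/-- A majorant of the integrand alone suffices: Cauchy's estimate on discs of radius r/4 turns it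
into a majorant of the derivative in the parameter. -/
theorem differentiableOn_integral_of_dominated {E : Type*} [NormedAddCommGroup E]
    [NormedSpace ℂ E] {μ : Measure ℝ} {f : ℂ → ℝ → E} {U : Set ℂ}
    (hU : IsOpen U) {B : ℝ → ℝ} (hB : Integrable B μ)
    (hm : ∀ ρ ∈ U, AEStronglyMeasurable (f ρ) μ)
    (hb : ∀ᵐ t ∂μ, ∀ ρ ∈ U, ‖f ρ t‖ ≤ B t)
    (hd : ∀ᵐ t ∂μ, DifferentiableOn ℂ (fun ρ => f ρ t) U) :
    DifferentiableOn ℂ (fun ρ => ∫ t, f ρ t ∂μ) U := by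
  intro z hz
  obtain ⟨r, hr, hball⟩ := Metric.isOpen_iff.1 hU z hz
  have hmem : ∀ x ∈ Metric.ball z (r / 2), Metric.closedBall x (r / 4) ⊆ U := by
    intro x hx y hy
    refine hball ?_
    rw [Metric.mem_ball] at hx ⊢
    rw [Metric.mem_closedBall] at hy
    linarith [dist_triangle y x z]
  have hball' : Metric.ball z (r / 2) ⊆ U := fun x hx =>
    hmem x hx (Metric.mem_closedBall_self (by positivity))
  have hderiv : ∀ᵐ t ∂μ, ∀ x ∈ Metric.ball z (r / 2),
      HasDerivAt (fun ρ => f ρ t) (deriv (fun ρ => f ρ t) x) x := by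
    filter_upwards [hd] with t ht x hx
    exact (ht.differentiableAt (hU.mem_nhds (hball' hx))).hasDerivAt
  -- The derivative is measurable in `t` as the limit of difference quotients along a sequence of
  -- increments tending to 0; the increments are at most r/4, so the shifted points stay in the
  -- small ball.
  have hmz : AEStronglyMeasurable (fun t => deriv (fun ρ => f ρ t) z) μ := by
    let u : ℕ → ℂ := fun n => ((r / 2 / 2 * (1 / ((n : ℝ) + 1)) : ℝ) : ℂ)
    have hu0 : Tendsto u atTop (𝓝[≠] 0) := by
      rw [tendsto_nhdsWithin_iff]
      constructor
      · have := (tendsto_one_div_add_atTop_nhds_zero_nat (𝕜 := ℝ)).const_mul (r / 2 / 2)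
        rw [mul_zero] at this
        exact (Complex.continuous_ofReal.tendsto' 0 0 (by simp)).comp this
      · refine Eventually.of_forall fun n => ?_
        simp only [mem_compl_iff, mem_singleton_iff, u, Complex.ofReal_eq_zero]
        positivity
    have humem : ∀ n, z + u n ∈ U := by
      intro n
      refine hball' ?_
      rw [Metric.mem_ball, dist_self_add_left, Complex.norm_real, Real.norm_of_nonneg (by positivity)]
      have : 1 / ((n : ℝ) + 1) ≤ 1 := by
        rw [div_le_one (by positivity)]; linarith [Nat.cast_nonneg (α := ℝ) n]
      nlinarith
    refine aestronglyMeasurable_of_tendsto_ae atTop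
      (f := fun n t => (u n)⁻¹ • (f (z + u n) t - f z t)) (fun n => ?_) ?_
    · exact ((hm _ (humem n)).sub (hm _ hz)).const_smul _
    · filter_upwards [hderiv] with t ht
      exact (ht z (Metric.mem_ball_self (by positivity))).tendsto_slope_zero.comp hu0
  have key := hasDerivAt_integral_of_dominated_loc_of_deriv_le (μ := μ) (F := f)
    (F' := fun ρ t => deriv (fun ρ => f ρ t) ρ)
    (bound := fun t => B t / (r / 4)) (Metric.ball_mem_nhds z (half_pos hr))
    (by
      filter_upwards [hU.mem_nhds hz] with ρ hρ using hm ρ hρ)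
    (hB.mono' (hm z hz) (by filter_upwards [hb] with t ht using ht z hz)) hmz
    (by
      filter_upwards [hb, hd] with t ht htd x hx
      refine Complex.norm_deriv_le_of_forall_mem_sphere_norm_le (by positivity) ?_ fun y hy =>
        ht y (hmem x hx (Metric.sphere_subset_closedBall hy))
      exact (htd.mono (hmem x hx)).diffContOnCl_ball Subset.rfl)
    (hB.div_const _) hderiv
  exact key.2.differentiableAt.differentiableWithinAt

/-- Mean value inequality on the convex left half plane, where |exp| ≤ 1. -/
theorem norm_exp_sub_one_le_of_re_nonpos {z : ℂ} (hz : z.re ≤ 0) :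
    ‖Complex.exp z - 1‖ ≤ ‖z‖ := by
  have h := (convex_halfSpace_re_le 0).norm_image_sub_le_of_norm_hasDerivWithin_le
    (f := Complex.exp) (f' := Complex.exp) (C := 1) (x := 0) (y := z)
    (fun x _ => (Complex.hasDerivAt_exp x).hasDerivWithinAt)
    (fun x hx => by
      rw [Complex.norm_exp]; exact Real.exp_le_one_iff.2 hx) (by simp) hz
  simpa using h

/-- The kernel `(e^{2iρs} - 1)/(2iρ)` of the Volterra equation for `e^{-iρx} F_+(x, ρ)`. -/
def jostKernel (ρ : ℂ) (s : ℝ) : ℂ := (Complex.exp (2 * Complex.I * ρ * s) - 1) / (2 * Complex.I * ρ)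

/-- The closed upper half plane without the origin. -/
def upperSet : Set ℂ := {ρ | 0 ≤ ρ.im ∧ ρ ≠ 0}

theorem mem_upperSet_of_pos {ρ : ℂ} (h : 0 < ρ.im) : ρ ∈ upperSet :=
  ⟨h.le, fun h0 => by simp [h0] at h⟩

theorem isOpen_im_pos : IsOpen {ρ : ℂ | 0 < ρ.im} :=
  isOpen_lt continuous_const Complex.continuous_im

theorem norm_exp_le_one {ρ : ℂ} (hρ : 0 ≤ ρ.im) {s : ℝ} (hs : 0 ≤ s) :
    ‖Complex.exp (2 * Complex.I * ρ * s)‖ ≤ 1 := by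
  rw [Complex.norm_exp]
  refine Real.exp_le_one_iff.2 ?_
  have : (2 * Complex.I * ρ * s).re = -(2 * (ρ.im * s)) := by simp; ring
  rw [this]
  have := mul_nonneg hρ hs
  linarith

theorem two_I_mul_ne {ρ : ℂ} (hρ : ρ ≠ 0) : 2 * Complex.I * ρ ≠ 0 := by
  simp [hρ]

theorem norm_two_I_mul (ρ : ℂ) : ‖2 * Complex.I * ρ‖ = 2 * ‖ρ‖ := by
  simp

/-- The two kernel bounds serve different ends. This one is independent of `s` and yields bounds on
the whole line and the asymptotics for large ρ. The bound by `s` is uniform down to ρ = 0 and is the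
source of the first moment condition. -/
theorem norm_jostKernel_le_inv {ρ : ℂ} (hρ : ρ ∈ upperSet) {s : ℝ} (hs : 0 ≤ s) :
    ‖jostKernel ρ s‖ ≤ 1 / ‖ρ‖ := by
  have h0 : 0 < ‖ρ‖ := norm_pos_iff.2 hρ.2
  rw [jostKernel, norm_div, norm_two_I_mul, div_le_div_iff₀ (by positivity) h0]
  have := norm_exp_le_one hρ.1 hs
  have h1 := norm_sub_le (Complex.exp (2 * Complex.I * ρ * s)) 1
  rw [norm_one] at h1
  nlinarith

theorem norm_jostKernel_le {ρ : ℂ} (hρ : ρ ∈ upperSet) {s : ℝ} (hs : 0 ≤ s) :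
    ‖jostKernel ρ s‖ ≤ s := by
  have h0 : 0 < ‖ρ‖ := norm_pos_iff.2 hρ.2
  rw [jostKernel, norm_div, norm_two_I_mul, div_le_iff₀ (by positivity)]
  have hre : (2 * Complex.I * ρ * s).re ≤ 0 := by
    have : (2 * Complex.I * ρ * s).re = -(2 * (ρ.im * s)) := by simp; ring
    rw [this]
    have := mul_nonneg hρ.1 hs
    linarith
  refine (norm_exp_sub_one_le_of_re_nonpos hre).trans ?_
  rw [norm_mul, norm_two_I_mul, Complex.norm_real, Real.norm_of_nonneg hs]
  linarith

theorem continuous_jostKernel (ρ : ℂ) : Continuous (jostKernel ρ) := by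
  unfold jostKernel; fun_prop

theorem differentiableOn_jostKernel (s : ℝ) :
    DifferentiableOn ℂ (fun ρ => jostKernel ρ s) {ρ | ρ ≠ 0} := by
  intro ρ hρ
  have := two_I_mul_ne hρ
  unfold jostKernel
  refine DifferentiableAt.differentiableWithinAt ?_
  refine DifferentiableAt.div (by fun_prop) (by fun_prop) this

variable {𝔸 : Type*} [NormedRing 𝔸] [NormedAlgebra ℂ 𝔸] [CompleteSpace 𝔸] {q : ℝ → 𝔸}

/-- Integrable with a finite first moment. -/
structure FirstMoment (q : ℝ → 𝔸) : Prop where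
  int : Integrable q
  moment : Integrable fun t => |t| * ‖q t‖

/-- The Volterra integral `∫_x^∞ (e^{2iρ(t-x)} - 1)/(2iρ) w(t) dt`. -/
def volterra (ρ : ℂ) (w : ℝ → 𝔸) (x : ℝ) : 𝔸 := ∫ t in Ioi x, jostKernel ρ (t - x) • w t

/-- The derivative of the Volterra integral. -/
def volterraDeriv (ρ : ℂ) (w : ℝ → 𝔸) (x : ℝ) : 𝔸 :=
  -∫ t in Ioi x, Complex.exp (2 * Complex.I * ρ * ((t - x : ℝ) : ℂ)) • w t

theorem integrableOn_exp_smul {ρ : ℂ} (hρ : ρ ∈ upperSet) {w : ℝ → 𝔸} (hw : Integrable w) (x a : ℝ) :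
    IntegrableOn (fun t : ℝ => Complex.exp (2 * Complex.I * ρ * ((t - x : ℝ) : ℂ)) • w t) (Ioi a) := by
  refine Integrable.mono'
    ((hw.norm.integrableOn (s := Ioi a)).const_mul
      ‖Complex.exp (2 * Complex.I * ρ * ((a - x : ℝ) : ℂ))‖) ?_ ?_
  · exact (Continuous.aestronglyMeasurable (by fun_prop)).smul hw.aestronglyMeasurable.restrict
  · filter_upwards [ae_restrict_mem measurableSet_Ioi] with t ht
    rw [norm_smul]
    gcongr
    have h1 := norm_exp_le_one hρ.1 (s := t - a) (sub_nonneg.2 (le_of_lt ht))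
    have : Complex.exp (2 * Complex.I * ρ * ((t - x : ℝ) : ℂ))
        = Complex.exp (2 * Complex.I * ρ * ((t - a : ℝ) : ℂ)) *
          Complex.exp (2 * Complex.I * ρ * ((a - x : ℝ) : ℂ)) := by
      rw [← Complex.exp_add]; congr 1; push_cast; ring
    rw [this, norm_mul]
    exact mul_le_of_le_one_left (norm_nonneg _) h1

/-- Here and in `volterra_eq` the variable `x` is moved out of the integrand, so that only products
of exponentials and tail integrals have to be differentiated. -/
theorem volterraDeriv_eq (ρ : ℂ) (w : ℝ → 𝔸) (x : ℝ) :
    volterraDeriv ρ w x = -(Complex.exp (-(2 * Complex.I * ρ * x)) •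
      ∫ t in Ioi x, Complex.exp (2 * Complex.I * ρ * (t : ℂ)) • w t) := by
  rw [volterraDeriv, ← integral_smul]
  congr 2
  ext t
  rw [smul_smul, ← Complex.exp_add]
  congr 2; push_cast; ring

theorem integrableOn_exp_smul' {ρ : ℂ} (hρ : ρ ∈ upperSet) {w : ℝ → 𝔸} (hw : Integrable w) (a : ℝ) :
    IntegrableOn (fun t : ℝ => Complex.exp (2 * Complex.I * ρ * (t : ℂ)) • w t) (Ioi a) := by
  simpa using integrableOn_exp_smul hρ hw 0 a

theorem volterra_eq {ρ : ℂ} (hρ : ρ ∈ upperSet) {w : ℝ → 𝔸} (hw : Integrable w) (x : ℝ) :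
    volterra ρ w x = (2 * Complex.I * ρ)⁻¹ • (Complex.exp (-(2 * Complex.I * ρ * x)) •
      (∫ t in Ioi x, Complex.exp (2 * Complex.I * ρ * (t : ℂ)) • w t) - ∫ t in Ioi x, w t) := by
  rw [volterra, ← integral_smul, ← integral_sub _ hw.integrableOn, ← integral_smul]
  · congr 1
    ext t
    rw [smul_smul, ← Complex.exp_add, jostKernel, div_eq_inv_mul, mul_smul, sub_smul, one_smul]
    congr 4; push_cast; ring
  · exact (integrableOn_exp_smul' hρ hw x).smul _

theorem isPrimitive_exp (c : ℂ) :
    IsPrimitive (fun x : ℝ => Complex.exp (c * x)) (fun x => c * Complex.exp (c * x)) := by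
  refine IsPrimitive.of_hasDerivAt (fun x => ?_) (by fun_prop)
  have h := ((Complex.ofRealCLM.hasDerivAt (x := x)).const_mul c).cexp
  simpa [mul_comm] using h

/-- The boundary terms w(x) coming from the two tail integrals cancel, because the kernel vanishes
at 0. -/
theorem isPrimitive_volterra {ρ : ℂ} (hρ : ρ ∈ upperSet) {w : ℝ → 𝔸} (hw : Integrable w) :
    IsPrimitive (volterra ρ w) (volterraDeriv ρ w) := by
  have h1 := (isPrimitive_exp (-(2 * Complex.I * ρ))).smul
    (IsPrimitive.integral_Ioi (integrableOn_exp_smul' hρ hw))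
  have h2 := (h1.sub (IsPrimitive.integral_Ioi fun a => hw.integrableOn)).const_smul
    (2 * Complex.I * ρ)⁻¹
  refine h2.congr (fun x => ?_) fun x => ?_
  · rw [volterra_eq hρ hw]; simp
  · have h3 := two_I_mul_ne hρ.2
    rw [volterraDeriv_eq]
    simp only [smul_neg, smul_smul, smul_add, sub_neg_eq_add, neg_mul]
    rw [← Complex.exp_add]
    simp only [neg_add_cancel, Complex.exp_zero, mul_one, mul_neg, neg_smul]
    rw [← mul_assoc, inv_mul_cancel₀ h3, one_mul]
    abel

theorem continuous_volterra {ρ : ℂ} (hρ : ρ ∈ upperSet) {w : ℝ → 𝔸} (hw : Integrable w) :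
    Continuous (volterra ρ w) := (isPrimitive_volterra hρ hw).continuous

end MatrixScattering
end

/-! ### The Neumann series of the Jost solution -/

noncomputable section
set_option linter.unusedSectionVars false

namespace MatrixScattering

open Set

variable {𝔸 : Type*} [NormedRing 𝔸] [NormedAlgebra ℂ 𝔸] [CompleteSpace 𝔸] {q : ℝ → 𝔸}

/-- The terms of the Neumann series for `e^{-iρx} F_+(x, ρ)`. -/
def jostTerm (q : ℝ → 𝔸) (ρ : ℂ) : ℕ → ℝ → 𝔸
  | 0 => fun _ => 1
  | n + 1 => volterra ρ fun t => q t * jostTerm q ρ n t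

/-- `M(x, ρ) = e^{-iρx} F_+(x, ρ)`. -/
def jostM (q : ℝ → 𝔸) (ρ : ℂ) (x : ℝ) : 𝔸 := ∑' n, jostTerm q ρ n x

/-- The derivative of `M(x, ρ)` in `x`. -/
def jostM' (q : ℝ → 𝔸) (ρ : ℂ) : ℝ → 𝔸 := volterraDeriv ρ fun t => q t * jostM q ρ t

/-- A dominating function for the Volterra kernel on `[a, ∞)`. -/
structure KernelBound (q : ℝ → 𝔸) (ρ : ℂ) (a : ℝ) (p : ℝ → ℝ) : Prop where
  int : Integrable p
  nonneg : ∀ t, 0 ≤ p t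
  le : ∀ x t, a ≤ x → x < t → ‖jostKernel ρ (t - x)‖ * ‖q t‖ ≤ p t

theorem kernelBound_inv (hq : FirstMoment q) {ρ : ℂ} (hρ : ρ ∈ upperSet) (a : ℝ) :
    KernelBound q ρ a (fun t => 1 / ‖ρ‖ * ‖q t‖) where
  int := hq.int.norm.const_mul _
  nonneg t := by positivity
  le x t _ hxt := by
    gcongr
    exact norm_jostKernel_le_inv hρ (by linarith)

theorem FirstMoment.int_abs_sub (hq : FirstMoment q) (a : ℝ) :
    Integrable fun t => |t - a| * ‖q t‖ := by
  refine (hq.moment.add (hq.int.norm.const_mul |a|)).mono'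
    ((by fun_prop : Continuous fun t : ℝ => |t - a|).aestronglyMeasurable.mul
      hq.int.norm.aestronglyMeasurable) (Eventually.of_forall fun t => ?_)
  rw [Real.norm_of_nonneg (by positivity), Pi.add_apply, ← add_mul]
  gcongr
  exact abs_sub t a

theorem kernelBound_abs (hq : FirstMoment q) {ρ : ℂ} (hρ : ρ ∈ upperSet) (a : ℝ) :
    KernelBound q ρ a (fun t => |t - a| * ‖q t‖) where
  int := hq.int_abs_sub a
  nonneg t := by positivity
  le x t hax hxt := by
    gcongr
    refine (norm_jostKernel_le hρ (by linarith)).trans ?_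
    exact (by linarith : t - x ≤ t - a).trans (le_abs_self _)

/-- Each Volterra integration turns P^n into P^(n+1)/(n+1) by `integral_Ioi_tail_pow`, which builds
up the factorial. The factor `‖1‖` is kept because the unit need not have norm 1: for m = 0 it has
norm 0. -/
theorem jostTerm_bound {ρ : ℂ} {a : ℝ} {p : ℝ → ℝ} (hp : KernelBound q ρ a p) (n : ℕ)
    {x : ℝ} (hx : a ≤ x) :
    ‖jostTerm q ρ n x‖ ≤ ‖(1 : 𝔸)‖ * ((∫ s in Ioi x, p s) ^ n / n.factorial) := by
  induction n generalizing x with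
  | zero => simp [jostTerm]
  | succ n ih =>
    have h1 := (tail_pow_integrable hp.int hp.nonneg n x).const_mul (‖(1 : 𝔸)‖ / n.factorial)
    have h2 := norm_integral_le_of_norm_le (μ := volume.restrict (Ioi x))
      (f := fun t => jostKernel ρ (t - x) • (q t * jostTerm q ρ n t)) h1 (by
      filter_upwards [ae_restrict_mem measurableSet_Ioi] with t ht
      rw [norm_smul]
      have h3 := hp.le x t hx ht
      have h4 := ih (hx.trans (le_of_lt ht))
      calc ‖jostKernel ρ (t - x)‖ * ‖q t * jostTerm q ρ n t‖
          ≤ ‖jostKernel ρ (t - x)‖ * (‖q t‖ * ‖jostTerm q ρ n t‖) := by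
            gcongr; exact norm_mul_le _ _
        _ = (‖jostKernel ρ (t - x)‖ * ‖q t‖) * ‖jostTerm q ρ n t‖ := by ring
        _ ≤ p t * (‖(1 : 𝔸)‖ * ((∫ s in Ioi t, p s) ^ n / n.factorial)) := by
            gcongr
            exact hp.nonneg t
        _ = _ := by ring)
    rw [integral_const_mul, integral_Ioi_tail_pow hp.int hp.nonneg] at h2
    refine h2.trans (le_of_eq ?_)
    rw [Nat.factorial_succ]
    push_cast
    field_simp

theorem hasSum_exp_real (x : ℝ) : HasSum (fun n : ℕ => x ^ n / n.factorial) (Real.exp x) := by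
  rw [Real.exp_eq_exp_ℝ]
  exact NormedSpace.expSeries_div_hasSum_exp x

theorem jostTerm_bound' {ρ : ℂ} {a : ℝ} {p : ℝ → ℝ} (hp : KernelBound q ρ a p) (n : ℕ)
    {x : ℝ} (hx : a ≤ x) :
    ‖jostTerm q ρ n x‖ ≤ ‖(1 : 𝔸)‖ * ((∫ s in Ioi a, p s) ^ n / n.factorial) := by
  refine (jostTerm_bound hp n hx).trans ?_
  have := tail_antitone hp.int hp.nonneg hx
  have := tail_nonneg hp.nonneg x
  gcongr

theorem summable_bound (c P : ℝ) : Summable fun n : ℕ => c * (P ^ n / n.factorial) :=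
  (Real.summable_pow_div_factorial P).mul_left c

/-- For fixed ρ the bound 1/|ρ| of the kernel does not depend on the base point, so the estimate
holds on the whole line. This makes `q * jostM` integrable. -/
theorem jostTerm_global_bound (hq : FirstMoment q) {ρ : ℂ} (hρ : ρ ∈ upperSet) (n : ℕ) (x : ℝ) :
    ‖jostTerm q ρ n x‖ ≤ ‖(1 : 𝔸)‖ * ((∫ s, 1 / ‖ρ‖ * ‖q s‖) ^ n / n.factorial) := by
  have hp := kernelBound_inv hq hρ x
  refine (jostTerm_bound hp n le_rfl).trans ?_
  have h1 := setIntegral_le_integral (s := Ioi x) hp.int (Eventually.of_forall hp.nonneg)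
  have := tail_nonneg hp.nonneg x
  gcongr

theorem summable_jostTerm (hq : FirstMoment q) {ρ : ℂ} (hρ : ρ ∈ upperSet) (x : ℝ) :
    Summable fun n => jostTerm q ρ n x :=
  Summable.of_norm_bounded (summable_bound _ _) fun n => jostTerm_global_bound hq hρ n x

theorem integrable_mul_of_bound (hq : FirstMoment q) {f : ℝ → 𝔸} (hf : Continuous f) {C : ℝ}
    (hC : ∀ x, ‖f x‖ ≤ C) : Integrable fun t => q t * f t := by
  refine (hq.int.norm.mul_const C).mono'
    (hq.int.aestronglyMeasurable.mul hf.aestronglyMeasurable) (Eventually.of_forall fun t => ?_)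
  refine (norm_mul_le _ _).trans ?_
  gcongr
  exact hC t

theorem continuous_jostTerm (hq : FirstMoment q) {ρ : ℂ} (hρ : ρ ∈ upperSet) (n : ℕ) :
    Continuous (jostTerm q ρ n) := by
  induction n with
  | zero => exact continuous_const
  | succ n ih =>
    exact continuous_volterra hρ (integrable_mul_of_bound hq ih (jostTerm_global_bound hq hρ n))

theorem continuous_jostM (hq : FirstMoment q) {ρ : ℂ} (hρ : ρ ∈ upperSet) :
    Continuous (jostM q ρ) :=
  continuous_tsum (continuous_jostTerm hq hρ) (summable_bound _ _)
    fun n x => jostTerm_global_bound hq hρ n x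

theorem norm_jostM_le {ρ : ℂ} {a : ℝ} {p : ℝ → ℝ} (hp : KernelBound q ρ a p) {x : ℝ} (hx : a ≤ x) :
    ‖jostM q ρ x‖ ≤ ‖(1 : 𝔸)‖ * Real.exp (∫ s in Ioi x, p s) :=
  tsum_of_norm_bounded ((hasSum_exp_real _).mul_left _) fun n => jostTerm_bound hp n hx

theorem norm_jostM_sub_one_le (hq : FirstMoment q) {ρ : ℂ} (hρ : ρ ∈ upperSet) {a : ℝ} {p : ℝ → ℝ}
    (hp : KernelBound q ρ a p) {x : ℝ} (hx : a ≤ x) :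
    ‖jostM q ρ x - 1‖ ≤ ‖(1 : 𝔸)‖ * (Real.exp (∫ s in Ioi x, p s) - 1) := by
  have h1 := (summable_jostTerm hq hρ x).hasSum
  rw [← hasSum_nat_add_iff' 1] at h1
  simp only [Finset.range_one, Finset.sum_singleton] at h1
  have h2 := hasSum_exp_real (∫ s in Ioi x, p s)
  rw [← hasSum_nat_add_iff' 1] at h2
  simp only [Finset.range_one, Finset.sum_singleton, pow_zero, Nat.factorial_zero, Nat.cast_one,
    div_one] at h2
  have h3 := tsum_of_norm_bounded (f := fun n => jostTerm q ρ (n + 1) x)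
    (h2.mul_left ‖(1 : 𝔸)‖) fun n => jostTerm_bound hp (n + 1) hx
  rw [h1.tsum_eq] at h3
  exact h3

theorem norm_jostM_global (hq : FirstMoment q) {ρ : ℂ} (hρ : ρ ∈ upperSet) (x : ℝ) :
    ‖jostM q ρ x‖ ≤ ‖(1 : 𝔸)‖ * Real.exp (∫ s, 1 / ‖ρ‖ * ‖q s‖) :=
  tsum_of_norm_bounded ((hasSum_exp_real _).mul_left _) fun n => jostTerm_global_bound hq hρ n x

theorem integrable_mul_jostM (hq : FirstMoment q) {ρ : ℂ} (hρ : ρ ∈ upperSet) :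
    Integrable fun t => q t * jostM q ρ t :=
  integrable_mul_of_bound hq (continuous_jostM hq hρ) (norm_jostM_global hq hρ)

theorem jostM_eq (hq : FirstMoment q) {ρ : ℂ} (hρ : ρ ∈ upperSet) (x : ℝ) :
    jostM q ρ x = 1 + volterra ρ (fun t => q t * jostM q ρ t) x := by
  have h0 := kernelBound_inv hq hρ x
  have h1 : HasSum (fun n => volterra ρ (fun t => q t * jostTerm q ρ n t) x)
      (volterra ρ (fun t => q t * jostM q ρ t) x) := by
    refine hasSum_integral_of_dominated_convergence (fun n t => 1 / ‖ρ‖ * ‖q t‖ *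
      (‖(1 : 𝔸)‖ * ((∫ s, 1 / ‖ρ‖ * ‖q s‖) ^ n / n.factorial))) (fun n => ?_) (fun n => ?_)
      ?_ ?_ ?_
    · exact (((continuous_jostKernel ρ).comp (by fun_prop)).aestronglyMeasurable).smul
        (hq.int.aestronglyMeasurable.restrict.mul (continuous_jostTerm hq hρ n).aestronglyMeasurable)
    · filter_upwards [ae_restrict_mem measurableSet_Ioi] with t ht
      rw [norm_smul]
      calc ‖jostKernel ρ (t - x)‖ * ‖q t * jostTerm q ρ n t‖
          ≤ ‖jostKernel ρ (t - x)‖ * (‖q t‖ * ‖jostTerm q ρ n t‖) := by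
            gcongr; exact norm_mul_le _ _
        _ = (‖jostKernel ρ (t - x)‖ * ‖q t‖) * ‖jostTerm q ρ n t‖ := by ring
        _ ≤ _ := by
            exact mul_le_mul (h0.le x t le_rfl ht) (jostTerm_global_bound hq hρ n t)
              (norm_nonneg _) (h0.nonneg t)
    · exact Eventually.of_forall fun t => (summable_bound _ _).mul_left _
    · simp_rw [tsum_mul_left]
      exact h0.int.integrableOn.mul_const _
    · refine Eventually.of_forall fun t => ?_
      exact ((summable_jostTerm hq hρ t).hasSum.mul_left (q t)).const_smul _
  have h2 := (summable_jostTerm hq hρ x).hasSum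
  rw [← hasSum_nat_add_iff' 1] at h2
  simp only [Finset.range_one, Finset.sum_singleton] at h2
  have h3 := h2.unique h1
  change jostM q ρ x - 1 = _ at h3
  rw [← h3]; abel

theorem isPrimitive_jostM (hq : FirstMoment q) {ρ : ℂ} (hρ : ρ ∈ upperSet) :
    IsPrimitive (jostM q ρ) (jostM' q ρ) := by
  have h := isPrimitive_volterra hρ (integrable_mul_jostM hq hρ)
  refine ⟨h.int, fun a b => ?_⟩
  rw [jostM_eq hq hρ, jostM_eq hq hρ a, jostM', ← h.eq]; abel

theorem norm_jostM'_le (hq : FirstMoment q) {ρ : ℂ} (hρ : ρ ∈ upperSet) {a : ℝ} {p : ℝ → ℝ}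
    (hp : KernelBound q ρ a p) {x : ℝ} (hx : a ≤ x) :
    ‖jostM' q ρ x‖ ≤ (∫ t in Ioi x, ‖q t‖) * (‖(1 : 𝔸)‖ * Real.exp (∫ s in Ioi a, p s)) := by
  rw [jostM', volterraDeriv, norm_neg, ← integral_mul_const]
  refine norm_integral_le_of_norm_le (hq.int.norm.integrableOn.mul_const _) ?_
  filter_upwards [ae_restrict_mem measurableSet_Ioi] with t ht
  rw [norm_smul]
  have h1 := norm_exp_le_one hρ.1 (s := t - x) (sub_nonneg.2 (le_of_lt ht))
  refine (mul_le_of_le_one_left (norm_nonneg _) h1).trans ((norm_mul_le _ _).trans ?_)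
  gcongr
  refine (norm_jostM_le hp (hx.trans (le_of_lt ht))).trans ?_
  exact mul_le_mul_of_nonneg_left (Real.exp_le_exp.2
    (tail_antitone hp.int hp.nonneg (hx.trans (le_of_lt ht)))) (norm_nonneg _)

theorem tendsto_jostM (hq : FirstMoment q) {ρ : ℂ} (hρ : ρ ∈ upperSet) :
    Tendsto (jostM q ρ) atTop (𝓝 1) := by
  rw [tendsto_iff_norm_sub_tendsto_zero]
  have h1 : Tendsto (fun x => ‖(1 : 𝔸)‖ * (Real.exp (∫ s in Ioi x, 1 / ‖ρ‖ * ‖q s‖) - 1)) atTop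
      (𝓝 0) := by
    have := (Real.continuous_exp.tendsto 0).comp
      (tendsto_integral_Ioi_zero (f := fun s => 1 / ‖ρ‖ * ‖q s‖) (μ := volume) tendsto_id)
    simpa using (this.sub_const 1).const_mul ‖(1 : 𝔸)‖
  exact squeeze_zero (fun _ => norm_nonneg _)
    (fun x => norm_jostM_sub_one_le hq hρ (kernelBound_inv hq hρ x) le_rfl) h1

theorem tendsto_jostM' (hq : FirstMoment q) {ρ : ℂ} (hρ : ρ ∈ upperSet) :
    Tendsto (jostM' q ρ) atTop (𝓝 0) := by
  rw [tendsto_zero_iff_norm_tendsto_zero]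
  have h1 := (tendsto_integral_Ioi_zero (f := fun s => ‖q s‖) (μ := volume)
    tendsto_id).mul_const (‖(1 : 𝔸)‖ * Real.exp (∫ s in Ioi (0:ℝ), 1 / ‖ρ‖ * ‖q s‖))
  rw [zero_mul] at h1
  refine squeeze_zero' (Eventually.of_forall fun _ => norm_nonneg _) ?_ h1
  filter_upwards [eventually_ge_atTop 0] with x hx
  exact norm_jostM'_le hq hρ (kernelBound_inv hq hρ 0) hx

/-! ### Dependence on the spectral parameter -/

section Spectral

theorem im_pos_subset : {ρ : ℂ | 0 < ρ.im} ⊆ upperSet := fun _ h => mem_upperSet_of_pos h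

theorem integrand_bound (hq : FirstMoment q) {ρ : ℂ} (hρ : ρ ∈ upperSet) (x : ℝ) {f : ℝ → 𝔸} {C : ℝ}
    (hf : ∀ t, x ≤ t → ‖f t‖ ≤ C) {t : ℝ} (ht : x < t) :
    ‖jostKernel ρ (t - x) • (q t * f t)‖ ≤ |t - x| * ‖q t‖ * C := by
  rw [norm_smul]
  calc ‖jostKernel ρ (t - x)‖ * ‖q t * f t‖
      ≤ ‖jostKernel ρ (t - x)‖ * (‖q t‖ * ‖f t‖) := by gcongr; exact norm_mul_le _ _
    _ = (‖jostKernel ρ (t - x)‖ * ‖q t‖) * ‖f t‖ := by ring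
    _ ≤ _ := by
        exact mul_le_mul ((kernelBound_abs hq hρ x).le x t le_rfl ht) (hf t ht.le)
          (norm_nonneg _) (by positivity)

/-- Dominated convergence needs a majorant independent of ρ, so the first moment bound of the kernel
is used here. It holds up to the real axis and gives continuity there together with holomorphy
above. -/
theorem spectral_jostTerm (hq : FirstMoment q) (n : ℕ) (x : ℝ) :
    ContinuousOn (fun ρ => jostTerm q ρ n x) upperSet ∧
    DifferentiableOn ℂ (fun ρ => jostTerm q ρ n x) {ρ | 0 < ρ.im} := by
  induction n generalizing x with
  | zero => exact ⟨continuousOn_const, differentiableOn_const _⟩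
  | succ n ih =>
    have hm : ∀ ρ ∈ upperSet, AEStronglyMeasurable
        (fun t => jostKernel ρ (t - x) • (q t * jostTerm q ρ n t)) (volume.restrict (Ioi x)) :=
      fun ρ hρ => (((continuous_jostKernel ρ).comp (by fun_prop)).aestronglyMeasurable).smul
        (hq.int.aestronglyMeasurable.restrict.mul (continuous_jostTerm hq hρ n).aestronglyMeasurable)
    have hB := ((hq.int_abs_sub x).integrableOn (s := Ioi x)).mul_const
      (‖(1 : 𝔸)‖ * ((∫ s in Ioi x, |s - x| * ‖q s‖) ^ n / n.factorial))
    have hb : ∀ᵐ t ∂(volume.restrict (Ioi x)), ∀ ρ ∈ upperSet,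
        ‖jostKernel ρ (t - x) • (q t * jostTerm q ρ n t)‖ ≤ |t - x| * ‖q t‖ *
          (‖(1 : 𝔸)‖ * ((∫ s in Ioi x, |s - x| * ‖q s‖) ^ n / n.factorial)) := by
      filter_upwards [ae_restrict_mem measurableSet_Ioi] with t ht ρ hρ
      exact integrand_bound hq hρ x (fun s hs => jostTerm_bound' (kernelBound_abs hq hρ x) n hs) ht
    constructor
    · refine continuousOn_of_dominated hm (fun ρ hρ => hb.mono fun t ht => ht ρ hρ) hB
        (Eventually.of_forall fun t => ?_)
      refine ContinuousOn.smul ?_ (continuousOn_const.mul (ih t).1)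
      exact (differentiableOn_jostKernel _).continuousOn.mono fun ρ hρ => hρ.2
    · refine differentiableOn_integral_of_dominated isOpen_im_pos hB
        (fun ρ hρ => hm ρ (im_pos_subset hρ)) (hb.mono fun t ht ρ hρ => ht ρ (im_pos_subset hρ))
        (Eventually.of_forall fun t => ?_)
      exact DifferentiableOn.smul (c := fun ρ => jostKernel ρ (t - x))
        ((differentiableOn_jostKernel _).mono fun ρ hρ => (im_pos_subset hρ).2)
        ((differentiableOn_const _).mul (ih t).2)

theorem continuousOn_jostM (hq : FirstMoment q) (x : ℝ) :
    ContinuousOn (fun ρ => jostM q ρ x) upperSet :=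
  continuousOn_tsum (fun n => (spectral_jostTerm hq n x).1) (summable_bound _ _)
    fun n _ hρ => jostTerm_bound' (kernelBound_abs hq hρ x) n le_rfl

theorem differentiableOn_jostM (hq : FirstMoment q) (x : ℝ) :
    DifferentiableOn ℂ (fun ρ => jostM q ρ x) {ρ | 0 < ρ.im} :=
  Complex.differentiableOn_tsum_of_summable_norm (summable_bound _ _)
    (fun n => (spectral_jostTerm hq n x).2) isOpen_im_pos
    fun n _ hρ => jostTerm_bound' (kernelBound_abs hq (im_pos_subset hρ) x) n le_rfl

theorem spectral_jostM' (hq : FirstMoment q) (x : ℝ) :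
    ContinuousOn (fun ρ => jostM' q ρ x) upperSet ∧
    DifferentiableOn ℂ (fun ρ => jostM' q ρ x) {ρ | 0 < ρ.im} := by
  have hm : ∀ ρ ∈ upperSet, AEStronglyMeasurable
      (fun t => Complex.exp (2 * Complex.I * ρ * ((t - x : ℝ) : ℂ)) • (q t * jostM q ρ t))
      (volume.restrict (Ioi x)) := fun ρ hρ =>
    (Continuous.aestronglyMeasurable (by fun_prop)).smul
      (hq.int.aestronglyMeasurable.restrict.mul (continuous_jostM hq hρ).aestronglyMeasurable)
  have hB := (hq.int.norm.integrableOn (s := Ioi x)).mul_const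
    (‖(1 : 𝔸)‖ * Real.exp (∫ s in Ioi x, |s - x| * ‖q s‖))
  have hb : ∀ᵐ t ∂(volume.restrict (Ioi x)), ∀ ρ ∈ upperSet,
      ‖Complex.exp (2 * Complex.I * ρ * ((t - x : ℝ) : ℂ)) • (q t * jostM q ρ t)‖ ≤
        ‖q t‖ * (‖(1 : 𝔸)‖ * Real.exp (∫ s in Ioi x, |s - x| * ‖q s‖)) := by
    filter_upwards [ae_restrict_mem measurableSet_Ioi] with t ht ρ hρ
    rw [norm_smul]
    have h1 := norm_exp_le_one hρ.1 (s := t - x) (sub_nonneg.2 (le_of_lt ht))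
    refine (mul_le_of_le_one_left (norm_nonneg _) h1).trans ((norm_mul_le _ _).trans ?_)
    have hp := kernelBound_abs hq hρ x
    gcongr
    refine (norm_jostM_le hp (le_of_lt ht)).trans ?_
    exact mul_le_mul_of_nonneg_left (Real.exp_le_exp.2
      (tail_antitone hp.int hp.nonneg (le_of_lt ht))) (norm_nonneg _)
  constructor
  · refine ContinuousOn.neg (continuousOn_of_dominated hm
      (fun ρ hρ => hb.mono fun t ht => ht ρ hρ) hB (Eventually.of_forall fun t => ?_))
    exact ContinuousOn.smul (by fun_prop) (continuousOn_const.mul (continuousOn_jostM hq t))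
  · refine DifferentiableOn.neg (differentiableOn_integral_of_dominated isOpen_im_pos hB
        (fun ρ hρ => hm ρ (im_pos_subset hρ)) (hb.mono fun t ht ρ hρ => ht ρ (im_pos_subset hρ))
        (Eventually.of_forall fun t => ?_))
    exact DifferentiableOn.smul (c := fun ρ => Complex.exp (2 * Complex.I * ρ * ((t - x : ℝ) : ℂ)))
      (by fun_prop)
      ((differentiableOn_const _).mul (differentiableOn_jostM hq t))

end Spectral

end MatrixScattering
end

/-! ### Solutions, Wronskians and backward uniqueness -/

noncomputable section
set_option linter.unusedSectionVars false

namespace MatrixScattering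

open Set

section Banach

variable {𝔸 : Type*} [NormedRing 𝔸] [NormedAlgebra ℂ 𝔸] [CompleteSpace 𝔸] {q : ℝ → 𝔸}

/-- `F` solves `-F'' + q F = lam F`, with derivative `F'`. -/
structure IsSol (q : ℝ → 𝔸) (lam : ℂ) (F F' : ℝ → 𝔸) : Prop where
  prim : IsPrimitive F F'
  prim' : IsPrimitive F' fun x => q x * F x - lam • F x

/-- `Z` solves the adjoint equation `-Z'' + Z q = lam Z`, with derivative `Z'`. -/
structure IsLeftSol (q : ℝ → 𝔸) (lam : ℂ) (Z Z' : ℝ → 𝔸) : Prop where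
  prim : IsPrimitive Z Z'
  prim' : IsPrimitive Z' fun x => Z x * q x - lam • Z x

theorem IsSol.hasDerivAt {lam : ℂ} {F F' : ℝ → 𝔸} (h : IsSol q lam F F') (x : ℝ) :
    HasDerivAt F (F' x) x := h.prim.hasDerivAt h.prim'.continuous x

theorem IsSol.mul_const {lam : ℂ} {F F' : ℝ → 𝔸} (h : IsSol q lam F F') (c : 𝔸) :
    IsSol q lam (fun x => F x * c) (fun x => F' x * c) :=
  ⟨h.prim.mul_const c, (h.prim'.mul_const c).congr (fun _ => rfl) fun x => by
    rw [sub_mul, mul_assoc, smul_mul_assoc]⟩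

theorem IsSol.sub {lam : ℂ} {F F' G G' : ℝ → 𝔸} (h : IsSol q lam F F') (k : IsSol q lam G G') :
    IsSol q lam (fun x => F x - G x) (fun x => F' x - G' x) :=
  ⟨h.prim.sub k.prim, (h.prim'.sub k.prim').congr (fun _ => rfl) fun x => by
    rw [mul_sub, smul_sub]; abel⟩

theorem IsSol.add {lam : ℂ} {F F' G G' : ℝ → 𝔸} (h : IsSol q lam F F') (k : IsSol q lam G G') :
    IsSol q lam (fun x => F x + G x) (fun x => F' x + G' x) :=
  ⟨h.prim.add k.prim, (h.prim'.add k.prim').congr (fun _ => rfl) fun x => by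
    rw [mul_add, smul_add]; abel⟩

theorem IsSol.comp_neg {lam : ℂ} {F F' : ℝ → 𝔸} (h : IsSol q lam F F') :
    IsSol (fun x => q (-x)) lam (fun x => F (-x)) (fun x => -F' (-x)) :=
  ⟨h.prim.comp_neg, (h.prim'.comp_neg.neg).congr (fun _ => rfl) fun x => by rw [neg_neg]⟩

/-- The Wronskian `Z' Y - Z Y'`. -/
def wr (Z Z' Y Y' : ℝ → 𝔸) (x : ℝ) : 𝔸 := Z' x * Y x - Z x * Y' x

/-- The potential cancels in the derivative of the Wronskian. Equal spectral parameters make it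
constant; conjugate ones give the energy identity `IsSol.im_functional`. -/
theorem wr_isPrimitive {lam mu : ℂ} {Z Z' Y Y' : ℝ → 𝔸} (hZ : IsLeftSol q mu Z Z')
    (hY : IsSol q lam Y Y') :
    IsPrimitive (wr Z Z' Y Y') (fun x => (lam - mu) • (Z x * Y x)) := by
  refine ((hZ.prim'.mul hY.prim).sub (hZ.prim.mul hY.prim')).congr (fun _ => rfl) fun x => ?_
  simp only [mul_sub, sub_mul, mul_smul_comm, smul_mul_assoc, sub_smul, mul_assoc]
  abel

theorem wr_const {lam : ℂ} {Z Z' Y Y' : ℝ → 𝔸} (hZ : IsLeftSol q lam Z Z')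
    (hY : IsSol q lam Y Y') (a b : ℝ) : wr Z Z' Y Y' a = wr Z Z' Y Y' b := by
  have := (wr_isPrimitive hZ hY).eq b a
  simp only [sub_self, zero_smul, intervalIntegral.integral_zero] at this
  exact sub_eq_zero.1 this

/-- The Jost solution normalised at `+∞`. -/
def jF (q : ℝ → 𝔸) (ρ : ℂ) (x : ℝ) : 𝔸 := Complex.exp (Complex.I * ρ * x) • jostM q ρ x

/-- The derivative of `jF`. -/
def jF' (q : ℝ → 𝔸) (ρ : ℂ) (x : ℝ) : 𝔸 :=
  Complex.exp (Complex.I * ρ * x) • (jostM' q ρ x + (Complex.I * ρ) • jostM q ρ x)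

theorem isSol_jF (hq : FirstMoment q) {ρ : ℂ} (hρ : ρ ∈ upperSet) :
    IsSol q (ρ ^ 2) (jF q ρ) (jF' q ρ) := by
  have hE := isPrimitive_exp (Complex.I * ρ)
  have h1 := isPrimitive_jostM hq hρ
  refine ⟨(hE.smul h1).congr (fun _ => rfl) fun x => ?_, ?_⟩
  · rw [jF', smul_add, smul_smul, mul_comm (Complex.exp _)]
  -- F' is rewritten as iρ e^{iρx} M - e^{-iρx} ∫_x^∞ e^{2iρt} q M dt, a combination of products
  -- whose factors are primitives, so the product rule applies once more.
  · have hE' := isPrimitive_exp (-(Complex.I * ρ))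
    have h2 := IsPrimitive.integral_Ioi (integrableOn_exp_smul' hρ (integrable_mul_jostM hq hρ))
    refine (((hE.smul h1).const_smul (Complex.I * ρ)).sub (hE'.smul h2)).congr (fun x => ?_)
      fun x => ?_
    · rw [jF', jostM', volterraDeriv_eq, smul_add, smul_neg, smul_smul, smul_smul, smul_smul,
        ← Complex.exp_add, mul_comm (Complex.exp _) (Complex.I * ρ)]
      have : Complex.I * ρ * x + -(2 * Complex.I * ρ * x) = -(Complex.I * ρ) * x := by ring
      rw [this]
      abel
    · rw [jF, jostM', volterraDeriv_eq]
      simp only [smul_neg, smul_smul, smul_add, neg_mul, neg_smul, mul_smul_comm,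
        ← Complex.exp_add]
      have e1 : Complex.exp (-(Complex.I * ρ * x) + 2 * Complex.I * ρ * x)
          = Complex.exp (Complex.I * ρ * x) := by congr 1; ring
      have e2 : Complex.I * ρ * (Complex.exp (Complex.I * ρ * x) *
          Complex.exp (-(2 * Complex.I * ρ * x))) = Complex.I * ρ * Complex.exp (-(Complex.I * ρ * x)) := by
        rw [← Complex.exp_add]; congr 2; ring
      have e3 : Complex.I * ρ * (Complex.I * ρ * Complex.exp (Complex.I * ρ * x))
          = -(ρ ^ 2 * Complex.exp (Complex.I * ρ * x)) := by
        linear_combination ρ ^ 2 * Complex.exp (Complex.I * ρ * x) * Complex.I_sq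
      have e4 : Complex.exp (Complex.I * ρ * x + -(2 * Complex.I * ρ * x)) =
         Complex.exp (-(Complex.I * ρ * x)) := by congr 1; ring
      rw [e1, e3, e4, neg_smul]
      abel

theorem exp_smul_jF (ρ : ℂ) (x : ℝ) :
    Complex.exp (-(Complex.I * ρ * x)) • jF q ρ x = jostM q ρ x := by
  rw [jF, smul_smul, ← Complex.exp_add, neg_add_cancel, Complex.exp_zero, one_smul]

/-- Backward uniqueness for the initial value problem. -/
theorem IsSol.eq_zero_of_le (hq : Integrable q) {lam : ℂ} {Y Y' : ℝ → 𝔸} (hY : IsSol q lam Y Y')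
    {X : ℝ} (h0 : Y X = 0) (h0' : Y' X = 0) {x : ℝ} (hx : x ≤ X) : Y x = 0 := by
  -- Iterated Gronwall argument: |Y| + |Y'| is bounded by the integral of p(|Y| + |Y'|). Cutting `p`
  -- off outside (x, X] lets the tail formula produce P^n/n!, which tends to 0.
  set p : ℝ → ℝ := (Ioc x X).indicator fun t => 1 + ‖q t‖ + ‖lam‖
  have hpi : Integrable p := by
    refine (integrable_indicator_iff measurableSet_Ioc).2 ?_
    exact ((integrableOn_const (by simp)).add hq.norm.integrableOn).add
      (integrableOn_const (by simp))
  have hp0 : ∀ t, 0 ≤ p t := fun t => indicator_nonneg (fun t _ => by positivity) t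
  have hYc := hY.prim.continuous
  have hYc' := hY.prim'.continuous
  obtain ⟨B, hB⟩ := isCompact_Icc.exists_bound_of_continuousOn (s := Icc x X)
    (f := fun t => ‖Y t‖ + ‖Y' t‖) (by fun_prop)
  have key : ∀ n : ℕ, ∀ t ∈ Icc x X,
      ‖Y t‖ + ‖Y' t‖ ≤ B * ((∫ s in Ioi t, p s) ^ n / n.factorial) := by
    intro n
    induction n with
    | zero =>
      intro t ht
      have := hB t ht
      rw [Real.norm_of_nonneg (by positivity)] at this
      simpa using this
    | succ n ih =>
      intro t ht
      have e1 : ‖Y t‖ ≤ ∫ s in t..X, ‖Y' s‖ := by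
        have := hY.prim.eq t X
        rw [h0, zero_sub] at this
        rw [← norm_neg, this]
        exact intervalIntegral.norm_integral_le_integral_norm ht.2
      have e2 : ‖Y' t‖ ≤ ∫ s in t..X, ‖q s * Y s - lam • Y s‖ := by
        have := hY.prim'.eq t X
        rw [h0', zero_sub] at this
        rw [← norm_neg, this]
        exact intervalIntegral.norm_integral_le_integral_norm ht.2
      have e3 : (∫ s in t..X, ‖Y' s‖) + ∫ s in t..X, ‖q s * Y s - lam • Y s‖
          ≤ ∫ s in Ioi t, p s * (∫ r in Ioi s, p r) ^ n * (B / n.factorial) := by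
        rw [← intervalIntegral.integral_add (hY.prim.int t X).norm (hY.prim'.int t X).norm,
          intervalIntegral.integral_of_le ht.2]
        have hi : IntegrableOn (fun s => p s * (∫ r in Ioi s, p r) ^ n * (B / n.factorial)) (Ioi t) :=
          (tail_pow_integrable hpi hp0 n t).mul_const (B / n.factorial)
        refine (setIntegral_mono_on (f := fun s => ‖Y' s‖ + ‖q s * Y s - lam • Y s‖)
          (((intervalIntegrable_iff_integrableOn_Ioc_of_le ht.2).1
          (hY.prim.int t X)).norm.add ((intervalIntegrable_iff_integrableOn_Ioc_of_le ht.2).1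
          (hY.prim'.int t X)).norm) (hi.mono_set Ioc_subset_Ioi_self) measurableSet_Ioc
          fun s hs => ?_).trans (setIntegral_mono_set hi ?_ Ioc_subset_Ioi_self.eventuallyLE)
        · have hs' : s ∈ Ioc x X := ⟨lt_of_le_of_lt ht.1 hs.1, hs.2⟩
          have hps : p s = 1 + ‖q s‖ + ‖lam‖ := indicator_of_mem hs' _
          have h3 := ih s ⟨hs'.1.le, hs'.2⟩
          have h4 : ‖q s * Y s - lam • Y s‖ ≤ ‖q s‖ * ‖Y s‖ + ‖lam‖ * ‖Y s‖ :=
            (norm_sub_le _ _).trans (add_le_add (norm_mul_le _ _) (norm_smul_le _ _))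
          have h5 : ‖Y' s‖ + ‖q s * Y s - lam • Y s‖ ≤ p s * (‖Y s‖ + ‖Y' s‖) := by
            rw [hps]
            have := mul_nonneg (norm_nonneg (q s)) (norm_nonneg (Y' s))
            have := mul_nonneg (norm_nonneg lam) (norm_nonneg (Y' s))
            nlinarith [norm_nonneg (Y s)]
          calc _ ≤ p s * (‖Y s‖ + ‖Y' s‖) := h5
            _ ≤ p s * (B * ((∫ r in Ioi s, p r) ^ n / n.factorial)) :=
              mul_le_mul_of_nonneg_left h3 (hp0 s)
            _ = _ := by ring
        · have hB0 : 0 ≤ B := (norm_nonneg _).trans (hB x ⟨le_rfl, hx⟩)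
          exact Eventually.of_forall fun s => by
            have := tail_nonneg hp0 s
            have := hp0 s
            show 0 ≤ _
            positivity
      rw [integral_mul_const, integral_Ioi_tail_pow hpi hp0] at e3
      refine (add_le_add e1 e2).trans (e3.trans (le_of_eq ?_))
      rw [Nat.factorial_succ]
      push_cast
      field_simp
  have hlim := ((summable_bound B (∫ s in Ioi x, p s)).tendsto_atTop_zero)
  have h1 := ge_of_tendsto' hlim fun n => key n x ⟨le_rfl, hx⟩
  have := norm_nonneg (Y' x)
  have := norm_nonneg (Y x)
  exact norm_eq_zero.1 (by linarith)

/-- A solution that tends to zero has a derivative that tends to zero. -/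
theorem IsSol.tendsto_deriv (hq : Integrable q) {lam : ℂ} {Y Y' : ℝ → 𝔸} (hY : IsSol q lam Y Y')
    (h : Tendsto Y atTop (𝓝 0)) : Tendsto Y' atTop (𝓝 0) := by
  -- If |Y| ≤ δ beyond `x`, then Y(x+1) - Y(x) contributes at most 2δ, and Y' varies on [x, x+1] by
  -- at most (‖q‖₁ + |lam|)δ. Hence |Y'(x)| ≤ Kδ.
  set K : ℝ := 2 + (∫ t, ‖q t‖) + ‖lam‖
  have hK : 0 < K := by
    have : 0 ≤ ∫ t, ‖q t‖ := integral_nonneg fun _ => norm_nonneg _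
    positivity
  rw [Metric.tendsto_atTop] at h ⊢
  intro ε hε
  obtain ⟨X, hX⟩ := h (ε / (2 * K)) (by positivity)
  refine ⟨X, fun x hx => ?_⟩
  set δ := ε / (2 * K)
  have hδ : 0 < δ := by positivity
  have hY0 : ∀ t, x ≤ t → ‖Y t‖ ≤ δ := fun t ht => by
    have := hX t (hx.trans ht); rw [dist_zero_right] at this; exact this.le
  have h1 : ∀ t ∈ Icc x (x + 1), ‖Y' t - Y' x‖ ≤ ((∫ t, ‖q t‖) + ‖lam‖) * δ := by
    intro t ht
    rw [hY.prim'.eq]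
    have hint : Integrable (fun s => ‖q s‖ * δ) := hq.norm.mul_const _
    calc ‖∫ s in x..t, (q s * Y s - lam • Y s)‖
        ≤ ∫ s in x..t, (‖q s‖ * δ + ‖lam‖ * δ) := by
          refine intervalIntegral.norm_integral_le_of_norm_le ht.1
            (Eventually.of_forall fun s hs => ?_)
            (hint.intervalIntegrable.add intervalIntegrable_const)
          refine (norm_sub_le _ _).trans (add_le_add ((norm_mul_le _ _).trans ?_)
            ((norm_smul_le _ _).trans ?_)) <;> gcongr <;> exact hY0 s hs.1.le
      _ = (∫ s in x..t, ‖q s‖) * δ + (t - x) * (‖lam‖ * δ) := by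
          rw [intervalIntegral.integral_add hint.intervalIntegrable intervalIntegrable_const,
            intervalIntegral.integral_mul_const, intervalIntegral.integral_const, smul_eq_mul]
      _ ≤ (∫ t, ‖q t‖) * δ + 1 * (‖lam‖ * δ) := by
          gcongr
          · rw [intervalIntegral.integral_of_le ht.1]
            exact setIntegral_le_integral hq.norm (Eventually.of_forall fun _ => norm_nonneg _)
          · linarith [ht.2]
      _ = _ := by ring
  have h2 : Y (x + 1) - Y x - ∫ t in x..(x + 1), (Y' t - Y' x) = Y' x := by
    rw [intervalIntegral.integral_sub (hY.prim.int _ _) intervalIntegrable_const,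
      intervalIntegral.integral_const, hY.prim.eq]
    simp
  have h3 : ‖∫ t in x..(x + 1), (Y' t - Y' x)‖ ≤ ((∫ t, ‖q t‖) + ‖lam‖) * δ := by
    have := intervalIntegral.norm_integral_le_of_norm_le_const (a := x) (b := x + 1)
      (f := fun t => Y' t - Y' x) fun t ht => h1 t (by
        rw [uIoc_of_le (by linarith)] at ht; exact ⟨ht.1.le, ht.2⟩)
    simpa using this
  rw [dist_zero_right, ← h2]
  have h4 := hY0 (x + 1) (by linarith)
  have h5 := hY0 x le_rfl
  have h6 : ‖Y (x + 1) - Y x - ∫ t in x..(x + 1), (Y' t - Y' x)‖ ≤ K * δ := by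
    refine (norm_sub_le _ _).trans ((add_le_add (norm_sub_le _ _) h3).trans ?_)
    simp only [K]
    linarith
  have h7 : K * δ = ε / 2 := by simp only [δ]; field_simp
  linarith

end Banach

end MatrixScattering
end

/-! ### Self-adjointness: the adjoint Jost solution and uniqueness -/

noncomputable section
set_option linter.unusedSectionVars false

namespace MatrixScattering

open Set

section CStar

variable {𝔸 : Type*} [CStarAlgebra 𝔸] {q : ℝ → 𝔸}

/-- Self-adjoint potentials with a finite first moment. -/
structure SelfAdjointPotential (q : ℝ → 𝔸) : Prop extends FirstMoment q where
  sa : ∀ᵐ x, star (q x) = q x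

theorem ae_comp_neg {p : ℝ → Prop} (h : ∀ᵐ x, p x) : ∀ᵐ x, p (-x) :=
  (Measure.measurePreserving_neg (volume : Measure ℝ)).quasiMeasurePreserving.ae h

theorem FirstMoment.comp_neg (hq : FirstMoment q) : FirstMoment fun x => q (-x) :=
  ⟨hq.int.comp_neg, by simpa using hq.moment.comp_neg⟩

theorem SelfAdjointPotential.comp_neg (hq : SelfAdjointPotential q) :
    SelfAdjointPotential fun x => q (-x) :=
  ⟨hq.toFirstMoment.comp_neg, ae_comp_neg hq.sa⟩

theorem IsPrimitive.congr_ae {E : Type*} [NormedAddCommGroup E] [NormedSpace ℝ E]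
    {f f' g' : ℝ → E} (hf : IsPrimitive f f') (h : f' =ᵐ[volume] g') : IsPrimitive f g' :=
  ⟨fun a b => (hf.int a b).congr_ae (ae_restrict_of_ae h), fun a b => by
    rw [hf.eq, intervalIntegral.integral_congr_ae (h.mono fun x hx _ => hx)]⟩

theorem IsSol.star_left {lam : ℂ} {F F' : ℝ → 𝔸} (hq : SelfAdjointPotential q)
    (h : IsSol q lam F F') :
    IsLeftSol q (starRingEnd ℂ lam) (fun x => star (F x)) (fun x => star (F' x)) := by
  refine ⟨h.prim.map ((starL' ℝ : 𝔸 ≃L[ℝ] 𝔸) : 𝔸 →L[ℝ] 𝔸),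
    (h.prim'.map ((starL' ℝ : 𝔸 ≃L[ℝ] 𝔸) : 𝔸 →L[ℝ] 𝔸)).congr_ae ?_⟩
  filter_upwards [hq.sa] with x hx
  simp [hx]

/-- The Jost solution of the adjoint equation, `F̄_+(x, σ) = F_+(x, -conj σ)^*`. -/
def jFb (q : ℝ → 𝔸) (σ : ℂ) (x : ℝ) : 𝔸 := star (jF q (-(starRingEnd ℂ σ)) x)

/-- The derivative of `jFb`. -/
def jFb' (q : ℝ → 𝔸) (σ : ℂ) (x : ℝ) : 𝔸 := star (jF' q (-(starRingEnd ℂ σ)) x)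

theorem neg_conj_mem {σ : ℂ} (h : σ ∈ upperSet) : -(starRingEnd ℂ σ) ∈ upperSet :=
  ⟨by simpa using h.1, by simpa using h.2⟩

theorem isLeftSol_jFb (hq : SelfAdjointPotential q) {σ : ℂ} (h : σ ∈ upperSet) :
    IsLeftSol q (σ ^ 2) (jFb q σ) (jFb' q σ) := by
  have := (isSol_jF hq.toFirstMoment (neg_conj_mem h)).star_left hq
  have e : starRingEnd ℂ ((-(starRingEnd ℂ σ)) ^ 2) = σ ^ 2 := by simp
  rwa [e] at this

/-- `M̄(x, σ) = M(x, -conj σ)^*`. -/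
def jMb (q : ℝ → 𝔸) (σ : ℂ) (x : ℝ) : 𝔸 := star (jostM q (-(starRingEnd ℂ σ)) x)

/-- The derivative of `jMb`. -/
def jMb' (q : ℝ → 𝔸) (σ : ℂ) (x : ℝ) : 𝔸 := star (jostM' q (-(starRingEnd ℂ σ)) x)

theorem star_exp_neg_conj (σ : ℂ) (x : ℝ) :
    star (Complex.exp (Complex.I * -(starRingEnd ℂ σ) * x)) = Complex.exp (Complex.I * σ * x) := by
  rw [Complex.star_def, ← Complex.exp_conj]
  simp

theorem jFb_eq (σ : ℂ) (x : ℝ) : jFb q σ x = Complex.exp (Complex.I * σ * x) • jMb q σ x := by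
  rw [jFb, jF, star_smul, star_exp_neg_conj, jMb]

theorem jFb'_eq (σ : ℂ) (x : ℝ) : jFb' q σ x =
    Complex.exp (Complex.I * σ * x) • (jMb' q σ x + (Complex.I * σ) • jMb q σ x) := by
  rw [jFb', jF', star_smul, star_exp_neg_conj, star_add, star_smul, jMb, jMb']
  simp

theorem tendsto_jMb (hq : FirstMoment q) {σ : ℂ} (h : σ ∈ upperSet) :
    Tendsto (jMb q σ) atTop (𝓝 1) := by
  simpa using! (tendsto_jostM hq (neg_conj_mem h)).star

theorem tendsto_jMb' (hq : FirstMoment q) {σ : ℂ} (h : σ ∈ upperSet) :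
    Tendsto (jMb' q σ) atTop (𝓝 0) := by
  simpa using! (tendsto_jostM' hq (neg_conj_mem h)).star

theorem wr_jFb_jF (σ ρ : ℂ) (x : ℝ) :
    wr (jFb q σ) (jFb' q σ) (jF q ρ) (jF' q ρ) x = Complex.exp (Complex.I * (σ + ρ) * x) •
      ((jMb' q σ x + (Complex.I * σ) • jMb q σ x) * jostM q ρ x -
        jMb q σ x * (jostM' q ρ x + (Complex.I * ρ) • jostM q ρ x)) := by
  rw [wr, jFb_eq, jFb'_eq, jF, jF', smul_mul_smul_comm, smul_mul_smul_comm, ← smul_sub,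
    ← Complex.exp_add]
  congr 2; ring

theorem tendsto_bracket (hq : FirstMoment q) {σ ρ : ℂ} (h : σ ∈ upperSet) (hρ : ρ ∈ upperSet) :
    Tendsto (fun x => (jMb' q σ x + (Complex.I * σ) • jMb q σ x) * jostM q ρ x -
        jMb q σ x * (jostM' q ρ x + (Complex.I * ρ) • jostM q ρ x)) atTop
      (𝓝 ((Complex.I * (σ - ρ)) • (1 : 𝔸))) := by
  have := ((((tendsto_jMb' hq h).add ((tendsto_jMb hq h).const_smul (Complex.I * σ))).mul
    (tendsto_jostM hq hρ)).sub ((tendsto_jMb hq h).mul ((tendsto_jostM' hq hρ).add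
      ((tendsto_jostM hq hρ).const_smul (Complex.I * ρ)))))
  refine this.congr_dist ?_ |>.trans (le_of_eq ?_)
  · simp
  · simp [mul_sub, sub_smul]

theorem norm_exp_I_le {ρ : ℂ} (hρ : 0 ≤ ρ.im) {x : ℝ} (hx : 0 ≤ x) :
    ‖Complex.exp (Complex.I * ρ * x)‖ ≤ 1 := by
  rw [Complex.norm_exp]
  refine Real.exp_le_one_iff.2 ?_
  have : (Complex.I * ρ * x).re = -(ρ.im * x) := by simp
  rw [this]
  have := mul_nonneg hρ hx
  linarith

/-- The Wronskian is constant in `x`. At +∞ the bracket tends to 0 and the exponential factor stays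
bounded. -/
theorem wr_jFb_jF_self (hq : SelfAdjointPotential q) {ρ : ℂ} (hρ : ρ ∈ upperSet) (x : ℝ) :
    wr (jFb q ρ) (jFb' q ρ) (jF q ρ) (jF' q ρ) x = 0 := by
  have h1 := tendsto_bracket hq.toFirstMoment hρ hρ
  rw [sub_self, mul_zero, zero_smul, tendsto_zero_iff_norm_tendsto_zero] at h1
  have h2 : Tendsto (fun y => wr (jFb q ρ) (jFb' q ρ) (jF q ρ) (jF' q ρ) y) atTop (𝓝 0) := by
    rw [tendsto_zero_iff_norm_tendsto_zero]
    refine squeeze_zero' (Eventually.of_forall fun _ => norm_nonneg _) ?_ h1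
    filter_upwards [eventually_ge_atTop 0] with y hy
    rw [wr_jFb_jF, norm_smul]
    refine mul_le_of_le_one_left (norm_nonneg _) (norm_exp_I_le ?_ hy)
    simpa using hρ.1
  have h3 : Tendsto (fun y => wr (jFb q ρ) (jFb' q ρ) (jF q ρ) (jF' q ρ) y) atTop
      (𝓝 (wr (jFb q ρ) (jFb' q ρ) (jF q ρ) (jF' q ρ) x)) :=
    tendsto_const_nhds.congr fun y =>
      wr_const (isLeftSol_jFb hq hρ) (isSol_jF hq.toFirstMoment hρ) x y
  exact tendsto_nhds_unique h3 h2

/-- For opposite parameters, which must then be real, the exponentials cancel exactly and the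
constant is read off from the limit of the bracket. -/
theorem wr_jFb_jF_neg (hq : SelfAdjointPotential q) {ρ : ℂ} (hρ : ρ ∈ upperSet)
    (hρ' : -ρ ∈ upperSet) (x : ℝ) :
    wr (jFb q ρ) (jFb' q ρ) (jF q (-ρ)) (jF' q (-ρ)) x = (2 * Complex.I * ρ) • 1 := by
  have h1 := tendsto_bracket hq.toFirstMoment hρ hρ'
  have h3 : Tendsto (fun y => wr (jFb q ρ) (jFb' q ρ) (jF q (-ρ)) (jF' q (-ρ)) y) atTop
      (𝓝 (wr (jFb q ρ) (jFb' q ρ) (jF q (-ρ)) (jF' q (-ρ)) x)) :=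
    tendsto_const_nhds.congr fun y => wr_const (isLeftSol_jFb hq hρ) (by
      simpa using isSol_jF hq.toFirstMoment hρ') x y
  have h4 := tendsto_nhds_unique (h3.congr fun y => by
    rw [wr_jFb_jF, add_neg_cancel, mul_zero, zero_mul, Complex.exp_zero, one_smul]) h1
  rw [h4]; congr 1; ring

theorem isUnit_of_norm_sub_one_le {a : 𝔸} (h : ‖a - 1‖ ≤ 1 / 2) : IsUnit a := by
  have := (Units.oneSub (1 - a) (by rw [norm_sub_rev]; linarith)).isUnit
  simpa using this

/-- The first moment bound provides one point `X` beyond which the Jost solutions are invertible for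
all ρ at once; uniformity near ρ = 0 is used in the lower bound for D. -/
theorem exists_forall_norm_jostM_sub_one_le (hq : FirstMoment q) :
    ∃ X : ℝ, 0 ≤ X ∧ ∀ ρ ∈ upperSet, ∀ x, X ≤ x → ‖jostM q ρ x - 1‖ ≤ 1 / 2 := by
  have h1 : Tendsto (fun x => ‖(1 : 𝔸)‖ * (Real.exp (∫ s in Ioi x, |s - 0| * ‖q s‖) - 1)) atTop
      (𝓝 0) := by
    have := (Real.continuous_exp.tendsto 0).comp
      (tendsto_integral_Ioi_zero (f := fun s => |s - 0| * ‖q s‖) (μ := volume) tendsto_id)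
    simpa using (this.sub_const 1).const_mul ‖(1 : 𝔸)‖
  obtain ⟨X, hX⟩ := eventually_atTop.1 ((h1.eventually_le_const (by norm_num : (0 : ℝ) < 1 / 2)).and
    (eventually_ge_atTop 0))
  refine ⟨X, (hX X le_rfl).2, fun ρ hρ x hx => ?_⟩
  exact (norm_jostM_sub_one_le hq hρ (kernelBound_abs hq hρ 0) (hX x hx).2).trans (hX x hx).1

theorem isUnit_exp_smul {a : 𝔸} (h : IsUnit a) (z : ℂ) : IsUnit (Complex.exp z • a) := by
  have := h.smul (Units.mk0 _ (Complex.exp_ne_zero z))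
  simpa [Units.smul_def] using this

theorem norm_star_sub_one (a : 𝔸) : ‖star a - 1‖ = ‖a - 1‖ := by
  rw [← norm_star (a - 1)]; simp

/-- A solution whose Wronskian with `F̄_+` vanishes is a multiple of `F_+`. -/
theorem exists_eq_jF_mul (hq : SelfAdjointPotential q) {ρ : ℂ} (hρ : ρ ∈ upperSet)
    {Y Y' : ℝ → 𝔸} (hY : IsSol q (ρ ^ 2) Y Y')
    (hw : ∀ x, wr (jFb q ρ) (jFb' q ρ) Y Y' x = 0) : ∃ c, ∀ x, Y x = jF q ρ x * c := by
  obtain ⟨X, -, hX⟩ := exists_forall_norm_jostM_sub_one_le hq.toFirstMoment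
  have hF := isSol_jF hq.toFirstMoment hρ
  have u1 : ∀ x, X ≤ x → IsUnit (jF q ρ x) := fun x hx =>
    isUnit_exp_smul (isUnit_of_norm_sub_one_le (hX ρ hρ x hx)) _
  have u2 : ∀ x, X ≤ x → IsUnit (jFb q ρ x) := fun x hx => by
    rw [jFb_eq]
    refine isUnit_exp_smul (isUnit_of_norm_sub_one_le ?_) _
    rw [jMb, norm_star_sub_one]
    exact hX _ (neg_conj_mem hρ) x hx
  -- Vanishing Wronskians mean that Y and F satisfy the same first order equation Y' = (F̄⁻¹F̄')Y to
  -- the right of `X`, where F̄ is invertible. Hence F⁻¹Y has derivative zero.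
  have hd : ∀ x, X ≤ x → HasDerivAt (fun y => Ring.inverse (jF q ρ y) * Y y) 0 x := by
    intro x hx
    obtain ⟨u, hu⟩ := u1 x hx
    obtain ⟨b, hb⟩ := u2 x hx
    have h1 := hasFDerivAt_ringInverse (𝕜 := ℝ) u
    rw [hu] at h1
    have h2 := (h1.comp_hasDerivAt x (hF.hasDerivAt x)).mul (hY.hasDerivAt x)
    refine h2.congr_deriv ?_
    have e1 := hw x
    have e2 := wr_jFb_jF_self hq hρ x
    rw [wr, ← hb, sub_eq_zero] at e1 e2
    have e1' : Y' x = (↑b⁻¹ : 𝔸) * (jFb' q ρ x * Y x) := by rw [e1, Units.inv_mul_cancel_left]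
    have e2' : jF' q ρ x = (↑b⁻¹ : 𝔸) * (jFb' q ρ x * jF q ρ x) := by
      rw [e2, Units.inv_mul_cancel_left]
    have e3 : Ring.inverse (jF q ρ x) = (↑u⁻¹ : 𝔸) := by rw [← hu, Ring.inverse_unit]
    rw [e1', e2', ← hu]
    simp [mul_assoc, e3]
  have hc : ∀ x, X ≤ x → Y x = jF q ρ x * (Ring.inverse (jF q ρ X) * Y X) := by
    intro x hx
    have h3 := constant_of_has_deriv_right_zero (a := X) (b := x)
      (f := fun y => Ring.inverse (jF q ρ y) * Y y)
      (fun y hy => (hd y hy.1).continuousAt.continuousWithinAt)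
      (fun y hy => (hd y hy.1).hasDerivWithinAt) x ⟨hx, le_rfl⟩
    rw [← h3, ← mul_assoc, Ring.mul_inverse_cancel _ (u1 x hx), one_mul]
  set c := Ring.inverse (jF q ρ X) * Y X
  refine ⟨c, fun x => ?_⟩
  rcases le_total X x with h | h
  · exact hc x h
  -- To the left of `X` invertibility may fail. There the difference, which vanishes near X + 1, is
  -- killed by backward uniqueness.
  · have hS := hY.sub (hF.mul_const c)
    have hz : (fun y => Y y - jF q ρ y * c) =ᶠ[𝓝 (X + 1)] fun _ => 0 := by
      filter_upwards [lt_mem_nhds (lt_add_one X)] with y hy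
      rw [hc y hy.le, sub_self]
    have h4 : HasDerivAt (fun y => Y y - jF q ρ y * c) 0 (X + 1) :=
      (hasDerivAt_const (X + 1) (0 : 𝔸)).congr_of_eventuallyEq hz
    have h5 := (hS.hasDerivAt (X + 1)).unique h4
    exact sub_eq_zero.1 (hS.eq_zero_of_le hq.int hz.self_of_nhds h5 (by linarith : x ≤ X + 1))

/-- Uniqueness of the Jost solution. -/
theorem eq_jF_of_tendsto (hq : SelfAdjointPotential q) {ρ : ℂ} (hρ : ρ ∈ upperSet)
    {Y Y' : ℝ → 𝔸} (hY : IsSol q (ρ ^ 2) Y Y')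
    (h : Tendsto (fun x : ℝ => Complex.exp (-(Complex.I * ρ * x)) • Y x) atTop (𝓝 1)) :
    Y = jF q ρ := by
  have hF := isSol_jF hq.toFirstMoment hρ
  have hS := hY.sub hF
  have h1 : Tendsto (fun x : ℝ => Complex.exp (-(Complex.I * ρ * x)) • (Y x - jF q ρ x)) atTop
      (𝓝 0) := by
    have := h.sub (tendsto_jostM hq.toFirstMoment hρ)
    rw [sub_self] at this
    refine this.congr fun x => ?_
    rw [smul_sub, exp_smul_jF]
  have h2 : Tendsto (fun x => Y x - jF q ρ x) atTop (𝓝 0) := by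
    rw [tendsto_zero_iff_norm_tendsto_zero] at h1 ⊢
    refine squeeze_zero' (Eventually.of_forall fun _ => norm_nonneg _) ?_ h1
    filter_upwards [eventually_ge_atTop 0] with x hx
    have e : Y x - jF q ρ x = Complex.exp (Complex.I * ρ * x) •
        (Complex.exp (-(Complex.I * ρ * x)) • (Y x - jF q ρ x)) := by
      rw [smul_smul, ← Complex.exp_add, add_neg_cancel, Complex.exp_zero, one_smul]
    calc ‖Y x - jF q ρ x‖ = _ := by rw [e]
      _ ≤ 1 * _ := by
        rw [norm_smul]
        exact mul_le_mul_of_nonneg_right (norm_exp_I_le hρ.1 hx) (norm_nonneg _)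
      _ = _ := one_mul _
  have h3 := hS.tendsto_deriv hq.int h2
  have hb : ∀ {f : ℝ → 𝔸} {l : 𝔸}, Tendsto f atTop (𝓝 l) → ∀ {g : ℝ → 𝔸}, Tendsto g atTop (𝓝 0) →
      Tendsto (fun x : ℝ => (Complex.exp (Complex.I * ρ * x) • f x) * g x) atTop (𝓝 0) := by
    intro f l hf g hg
    have h4 := hf.mul hg
    rw [mul_zero, tendsto_zero_iff_norm_tendsto_zero] at h4
    rw [tendsto_zero_iff_norm_tendsto_zero]
    refine squeeze_zero' (Eventually.of_forall fun _ => norm_nonneg _) ?_ h4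
    filter_upwards [eventually_ge_atTop 0] with x hx
    rw [smul_mul_assoc, norm_smul]
    exact mul_le_of_le_one_left (norm_nonneg _) (norm_exp_I_le hρ.1 hx)
  -- The difference of the two solutions and its derivative tend to 0 and the adjoint Jost solution
  -- stays bounded, so their constant Wronskian is 0. The difference is therefore F c, and the
  -- normalisation forces c = 0.
  have h5 : ∀ x, wr (jFb q ρ) (jFb' q ρ) (fun x => Y x - jF q ρ x) (fun x => Y' x - jF' q ρ x) x
      = 0 := by
    intro x
    have h6 := (hb ((tendsto_jMb' hq.toFirstMoment hρ).add
      ((tendsto_jMb hq.toFirstMoment hρ).const_smul (Complex.I * ρ))) h2).sub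
      (hb (tendsto_jMb hq.toFirstMoment hρ) h3)
    rw [sub_self] at h6
    refine tendsto_nhds_unique (tendsto_const_nhds.congr fun y => ?_) h6
    rw [← jFb_eq, ← jFb'_eq]
    exact wr_const (isLeftSol_jFb hq hρ) hS x y
  obtain ⟨c, hc⟩ := exists_eq_jF_mul hq hρ hS h5
  have h7 : c = 0 := by
    have h8 := (tendsto_jostM hq.toFirstMoment hρ).mul_const c
    rw [one_mul] at h8
    refine tendsto_nhds_unique h8 (h1.congr fun x => ?_)
    rw [hc, ← smul_mul_assoc, exp_smul_jF]
  ext x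
  have := hc x
  rw [h7, mul_zero] at this
  exact sub_eq_zero.1 this

end CStar

end MatrixScattering
end

/-! ### The Jost solution at -∞ and the coefficient D -/

noncomputable section
set_option linter.unusedSectionVars false

namespace MatrixScattering

open Set

section Minus

variable {𝔸 : Type*} [CStarAlgebra 𝔸] {q : ℝ → 𝔸}

/-- The Jost solution normalised at `-∞`. -/
def jG (q : ℝ → 𝔸) (ρ : ℂ) (x : ℝ) : 𝔸 := jF (fun t => q (-t)) ρ (-x)

/-- The derivative of `jG`. -/
def jG' (q : ℝ → 𝔸) (ρ : ℂ) (x : ℝ) : 𝔸 := -jF' (fun t => q (-t)) ρ (-x)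

theorem isSol_jG (hq : FirstMoment q) {ρ : ℂ} (hρ : ρ ∈ upperSet) :
    IsSol q (ρ ^ 2) (jG q ρ) (jG' q ρ) := by
  have := (isSol_jF hq.comp_neg hρ).comp_neg
  simp only [neg_neg] at this
  exact this

/-- The coefficient `D(ρ) = (2iρ)⁻¹ ⟨F̄_+, F_-⟩`. -/
def jD (q : ℝ → 𝔸) (ρ : ℂ) : 𝔸 :=
  (2 * Complex.I * ρ)⁻¹ • wr (jFb q ρ) (jFb' q ρ) (jG q ρ) (jG' q ρ) 0

theorem wr_jFb_jG (hq : SelfAdjointPotential q) {ρ : ℂ} (hρ : ρ ∈ upperSet) (x : ℝ) :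
    wr (jFb q ρ) (jFb' q ρ) (jG q ρ) (jG' q ρ) x = (2 * Complex.I * ρ) • jD q ρ := by
  rw [jD, smul_smul, mul_inv_cancel₀ (two_I_mul_ne hρ.2), one_smul]
  exact wr_const (isLeftSol_jFb hq hρ) (isSol_jG hq.toFirstMoment hρ) x 0

theorem jD_eq (ρ : ℂ) : jD q ρ = (2 * Complex.I * ρ)⁻¹ •
    ((jMb' q ρ 0 + (Complex.I * ρ) • jMb q ρ 0) * jostM (fun t => q (-t)) ρ 0 +
      jMb q ρ 0 * (jostM' (fun t => q (-t)) ρ 0 + (Complex.I * ρ) • jostM (fun t => q (-t)) ρ 0)) := by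
  rw [jD, wr, jFb_eq, jFb'_eq, jG, jG', jF, jF', mul_neg, sub_neg_eq_add]
  simp only [neg_zero, Complex.ofReal_zero, mul_zero, Complex.exp_zero, one_smul]

theorem continuousOn_jD (hq : FirstMoment q) : ContinuousOn (jD q) upperSet := by
  have hmaps : MapsTo (fun ρ : ℂ => -(starRingEnd ℂ ρ)) upperSet upperSet := fun _ h => neg_conj_mem h
  have hc : ContinuousOn (fun ρ : ℂ => -(starRingEnd ℂ ρ)) upperSet :=
    Complex.continuous_conj.neg.continuousOn
  have h1 : ContinuousOn (fun ρ => jMb q ρ 0) upperSet :=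
    ((continuousOn_jostM hq 0).comp hc hmaps).star
  have h2 : ContinuousOn (fun ρ => jMb' q ρ 0) upperSet :=
    ((spectral_jostM' hq 0).1.comp hc hmaps).star
  have h3 := continuousOn_jostM hq.comp_neg 0
  have h4 := (spectral_jostM' hq.comp_neg 0).1
  have h5 : ContinuousOn (fun ρ : ℂ => Complex.I * ρ) upperSet := by fun_prop
  have h6 : ContinuousOn (fun ρ : ℂ => (2 * Complex.I * ρ)⁻¹) upperSet :=
    ContinuousOn.inv₀ (by fun_prop) fun ρ hρ => two_I_mul_ne hρ.2
  exact (h6.smul (((h2.add (h5.smul h1)).mul h3).add (h1.mul (h4.add (h5.smul h3))))).congr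
    fun ρ _ => jD_eq ρ

/-- Both the involution and ρ ↦ -ρ̄ are antiholomorphic, and the latter preserves the upper half
plane. -/
theorem differentiableOn_star_neg_conj {f : ℂ → 𝔸} (hf : DifferentiableOn ℂ f {ρ | 0 < ρ.im}) :
    DifferentiableOn ℂ (fun ρ => star (f (-(starRingEnd ℂ ρ)))) {ρ | 0 < ρ.im} := by
  intro ρ hρ
  have h1 : DifferentiableAt ℂ f (-(starRingEnd ℂ ρ)) :=
    hf.differentiableAt (isOpen_im_pos.mem_nhds (by simpa using hρ))
  have h2 : DifferentiableAt ℂ (fun z => f (-z)) (star ρ) := h1.comp (star ρ) differentiableAt_id.neg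
  have := h2.star_star
  rw [star_star] at this
  exact this.differentiableWithinAt

theorem differentiableOn_jMb (hq : FirstMoment q) (x : ℝ) :
    DifferentiableOn ℂ (fun ρ => jMb q ρ x) {ρ | 0 < ρ.im} :=
  differentiableOn_star_neg_conj (differentiableOn_jostM hq x)

theorem differentiableOn_jD (hq : FirstMoment q) : DifferentiableOn ℂ (jD q) {ρ | 0 < ρ.im} := by
  have h1 := differentiableOn_jMb hq 0
  have h2 : DifferentiableOn ℂ (fun ρ => jMb' q ρ 0) {ρ | 0 < ρ.im} :=
    differentiableOn_star_neg_conj (spectral_jostM' hq 0).2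
  have h3 := differentiableOn_jostM hq.comp_neg 0
  have h4 := (spectral_jostM' hq.comp_neg 0).2
  have h5 : DifferentiableOn ℂ (fun ρ : ℂ => Complex.I * ρ) {ρ | 0 < ρ.im} := by fun_prop
  have h6 : DifferentiableOn ℂ (fun ρ : ℂ => (2 * Complex.I * ρ)⁻¹) {ρ | 0 < ρ.im} :=
    DifferentiableOn.inv (by fun_prop) fun ρ hρ => two_I_mul_ne (im_pos_subset hρ).2
  exact (h6.smul (((h2.add (h5.smul h1)).mul h3).add (h1.mul (h4.add (h5.smul h3))))).congr
    fun ρ _ => jD_eq ρ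

/-- `M(x, ρ) = 1 + O(1/ρ)` and `M'(x, ρ) = O(1)` as `ρ → ∞`. -/
theorem exists_jostM_asymp (hq : FirstMoment q) : ∃ C, 0 ≤ C ∧ ∀ ρ ∈ upperSet, 1 ≤ ‖ρ‖ → ∀ x,
    ‖jostM q ρ x - 1‖ ≤ C / ‖ρ‖ ∧ ‖jostM' q ρ x‖ ≤ C ∧ ‖jostM q ρ x‖ ≤ C := by
  set I := ∫ t, ‖q t‖
  have hI : 0 ≤ I := integral_nonneg fun _ => norm_nonneg _
  set n1 := ‖(1 : 𝔸)‖
  have hn : 0 ≤ n1 := norm_nonneg _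
  refine ⟨(n1 + n1 * I) * Real.exp I + I * (n1 * Real.exp I), by positivity, fun ρ hρ h1 x => ?_⟩
  have hρ0 : 0 < ‖ρ‖ := by linarith
  have hp := kernelBound_inv hq hρ x
  have e1 : ∫ s in Ioi x, 1 / ‖ρ‖ * ‖q s‖ ≤ I / ‖ρ‖ := by
    rw [integral_const_mul, one_div, div_eq_inv_mul]
    gcongr
    exact setIntegral_le_integral hq.int.norm (Eventually.of_forall fun _ => norm_nonneg _)
  have e2 : I / ‖ρ‖ ≤ I := div_le_self hI h1
  have e3 : (∫ t in Ioi x, ‖q t‖) ≤ I :=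
    setIntegral_le_integral hq.int.norm (Eventually.of_forall fun _ => norm_nonneg _)
  have e0 : 0 ≤ ∫ s in Ioi x, 1 / ‖ρ‖ * ‖q s‖ := tail_nonneg hp.nonneg x
  have hE : 0 ≤ Real.exp I := (Real.exp_pos _).le
  have e4 : Real.exp (∫ s in Ioi x, 1 / ‖ρ‖ * ‖q s‖) ≤ Real.exp I := Real.exp_le_exp.2 (e1.trans e2)
  have p1 : 0 ≤ n1 * I * Real.exp I := by positivity
  have p2 : 0 ≤ I * (n1 * Real.exp I) := by positivity
  have p3 : 0 ≤ n1 * Real.exp I := by positivity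
  refine ⟨?_, ?_, ?_⟩
  · refine (norm_jostM_sub_one_le hq hρ hp le_rfl).trans ?_
    set P := ∫ s in Ioi x, 1 / ‖ρ‖ * ‖q s‖
    -- Multiply 1 - P ≤ e^{-P} by e^P. With P ≤ I/|ρ| this gives the order 1/|ρ|.
    have e5 : Real.exp P - 1 ≤ P * Real.exp P := by
      have := Real.add_one_le_exp (-P)
      rw [Real.exp_neg] at this
      have hP := Real.exp_pos P
      have h6 : (-P + 1) * Real.exp P ≤ 1 := by
        calc _ ≤ (Real.exp P)⁻¹ * Real.exp P := by gcongr
          _ = 1 := inv_mul_cancel₀ hP.ne'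
      linarith
    calc n1 * (Real.exp P - 1) ≤ n1 * ((I / ‖ρ‖) * Real.exp I) := by
          gcongr
          exact e5.trans (by gcongr)
      _ = (n1 * I * Real.exp I) / ‖ρ‖ := by ring
      _ ≤ _ := by
          gcongr
          linarith
  · refine (norm_jostM'_le hq hρ hp le_rfl).trans ?_
    have : (∫ t in Ioi x, ‖q t‖) * (n1 * Real.exp (∫ s in Ioi x, 1 / ‖ρ‖ * ‖q s‖)) ≤
        I * (n1 * Real.exp I) := by gcongr
    linarith
  · refine (norm_jostM_le hp le_rfl).trans ?_
    have : n1 * Real.exp (∫ s in Ioi x, 1 / ‖ρ‖ * ‖q s‖) ≤ n1 * Real.exp I := by gcongr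
    linarith

theorem exists_jD_asymp (hq : FirstMoment q) : ∃ C, 0 ≤ C ∧ ∀ ρ ∈ upperSet, 1 ≤ ‖ρ‖ →
    ‖jD q ρ - 1‖ ≤ C / ‖ρ‖ := by
  obtain ⟨C, hC0, hC⟩ := exists_jostM_asymp hq
  obtain ⟨D, hD0, hD⟩ := exists_jostM_asymp hq.comp_neg
  refine ⟨C * D + C * D + (C * D + D), by positivity, fun ρ hρ h1 => ?_⟩
  have hρ0 : 0 < ‖ρ‖ := by linarith
  have hn : ‖-(starRingEnd ℂ ρ)‖ = ‖ρ‖ := by simp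
  obtain ⟨a1, a2, a3⟩ := hC _ (neg_conj_mem hρ) (by rw [hn]; exact h1) 0
  obtain ⟨b1, b2, b3⟩ := hD ρ hρ h1 0
  rw [hn] at a1
  rw [← norm_star_sub_one] at a1
  rw [← norm_star] at a2 a3
  change ‖jMb q ρ 0 - 1‖ ≤ _ at a1
  change ‖jMb' q ρ 0‖ ≤ _ at a2
  change ‖jMb q ρ 0‖ ≤ _ at a3
  set m := jMb q ρ 0
  set m' := jMb' q ρ 0
  set g := jostM (fun t => q (-t)) ρ 0
  set g' := jostM' (fun t => q (-t)) ρ 0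
  -- The two terms with factor iρ contribute one half of m g each, so m g - 1 = (m - 1)g + (g - 1)
  -- remains; the terms with derivatives keep the factor 1/(2iρ).
  have e : jD q ρ - 1 = (2 * Complex.I * ρ)⁻¹ • (m' * g + m * g') + ((m - 1) * g + (g - 1)) := by
    rw [jD_eq]
    have h2 := two_I_mul_ne hρ.2
    have h3 : (2 * Complex.I * ρ)⁻¹ * (Complex.I * ρ) = 1 / 2 := by
      field_simp [hρ.2]
    simp only [add_mul, mul_add, smul_add, smul_mul_assoc, mul_smul_comm, smul_smul, h3, sub_mul,
      one_mul]
    have : m * g = (1 / 2 : ℂ) • (m * g) + (1 / 2 : ℂ) • (m * g) := by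
      rw [← add_smul]; norm_num
    rw [sub_add_sub_cancel]
    nth_rewrite 3 [this]
    abel
  rw [e]
  have n1 : ‖(2 * Complex.I * ρ)⁻¹ • (m' * g + m * g')‖ ≤ (C * D + C * D) / ‖ρ‖ := by
    rw [norm_smul, norm_inv, norm_two_I_mul, div_eq_inv_mul]
    have : ‖m' * g + m * g'‖ ≤ C * D + C * D := by
      refine (norm_add_le _ _).trans (add_le_add ((norm_mul_le _ _).trans ?_)
        ((norm_mul_le _ _).trans ?_)) <;> gcongr
    gcongr
    linarith
  have n2 : ‖(m - 1) * g + (g - 1)‖ ≤ (C * D + D) / ‖ρ‖ := by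
    refine (norm_add_le _ _).trans ?_
    rw [add_div]
    refine add_le_add ((norm_mul_le _ _).trans ?_) b1
    rw [mul_div_right_comm]
    gcongr
  calc _ ≤ _ := norm_add_le _ _
    _ ≤ _ := add_le_add n1 n2
    _ = _ := by ring

end Minus

/-! ### Energy identity and jump inequality -/

section Functional

variable {𝔸 : Type*} [CStarAlgebra 𝔸] {q : ℝ → 𝔸}

/-- A positive hermitian functional. -/
structure IsPositiveFunctional (φ : 𝔸 →L[ℂ] ℂ) : Prop where
  conj : ∀ a, φ (star a) = starRingEnd ℂ (φ a)
  nonneg : ∀ a, 0 ≤ (φ (star a * a)).re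

/-- Taking the imaginary part removes the self-adjoint potential: this is the Wronskian identity for
Y* and Y, whose spectral parameters are conjugate. -/
theorem IsSol.im_functional (hq : SelfAdjointPotential q) {lam : ℂ} {Y Y' : ℝ → 𝔸}
    (hY : IsSol q lam Y Y') {φ : 𝔸 →L[ℂ] ℂ} (hφ : IsPositiveFunctional φ) (a b : ℝ) :
    (φ (star (Y' b) * Y b)).im - (φ (star (Y' a) * Y a)).im
      = lam.im * ∫ t in a..b, (φ (star (Y t) * Y t)).re := by
  have h1 := (wr_isPrimitive (hY.star_left hq) hY).map (φ.restrictScalars ℝ)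
  have h2 := h1.map Complex.imCLM
  have h3 := h2.eq a b
  have e1 : ∀ x, (φ (wr (fun x => star (Y x)) (fun x => star (Y' x)) Y Y' x)).im
      = 2 * (φ (star (Y' x) * Y x)).im := by
    intro x
    have : star (Y x) * Y' x = star (star (Y' x) * Y x) := by simp
    rw [wr, this, map_sub, hφ.conj, Complex.sub_im, Complex.conj_im]
    ring
  have e2 : ∀ x, (φ ((lam - starRingEnd ℂ lam) • (star (Y x) * Y x))).im =
      2 * (lam.im * (φ (star (Y x) * Y x)).re) := by
    intro x
    rw [map_smul, smul_eq_mul, Complex.mul_im]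
    simp
    ring
  simp only [ContinuousLinearMap.coe_restrictScalars', Complex.imCLM_apply, e1, e2] at h3
  rw [intervalIntegral.integral_const_mul, intervalIntegral.integral_const_mul] at h3
  linarith

/-- The boundary term at the right end vanishes at +∞, and the integral beyond `b` is discarded by
positivity. Multiplication by `lam.im` makes the statement independent of its sign. -/
theorem IsSol.im_functional_le (hq : SelfAdjointPotential q) {lam : ℂ} {Y Y' : ℝ → 𝔸}
    (hY : IsSol q lam Y Y') (h0 : Tendsto Y atTop (𝓝 0)) {φ : 𝔸 →L[ℂ] ℂ}
    (hφ : IsPositiveFunctional φ) {x b : ℝ} (hxb : x ≤ b) :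
    lam.im * (φ (star (Y' x) * Y x)).im
      + lam.im ^ 2 * (∫ t in x..b, (φ (star (Y t) * Y t)).re) ≤ 0 := by
  have h1 : ∀ c, lam.im * (φ (star (Y' c) * Y c)).im - lam.im * (φ (star (Y' x) * Y x)).im
      = lam.im ^ 2 * ∫ t in x..c, (φ (star (Y t) * Y t)).re := by
    intro c
    rw [← mul_sub, hY.im_functional hq hφ]; ring
  have h2 : Tendsto (fun c => lam.im * (φ (star (Y' c) * Y c)).im) atTop (𝓝 0) := by
    have h3 := ((hY.tendsto_deriv hq.int h0).star.mul h0)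
    rw [mul_zero] at h3
    have h4 := ((Complex.continuous_im.comp φ.continuous).tendsto 0).comp h3
    simpa using h4.const_mul lam.im
  have hc : Continuous fun t => (φ (star (Y t) * Y t)).re :=
    Complex.continuous_re.comp (φ.continuous.comp
      (hY.prim.continuous.star.mul hY.prim.continuous))
  have h5 : ∀ c, b ≤ c → lam.im * (φ (star (Y' x) * Y x)).im
      + lam.im ^ 2 * (∫ t in x..b, (φ (star (Y t) * Y t)).re)
      ≤ lam.im * (φ (star (Y' c) * Y c)).im := by
    intro c hbc
    have h6 : ∫ t in x..b, (φ (star (Y t) * Y t)).re ≤ ∫ t in x..c, (φ (star (Y t) * Y t)).re :=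
      intervalIntegral.integral_mono_interval le_rfl hxb hbc
        (Eventually.of_forall fun t => hφ.nonneg _) (hc.intervalIntegrable _ _)
    have h7 := mul_le_mul_of_nonneg_left h6 (sq_nonneg lam.im)
    linarith [h1 c]
  exact ge_of_tendsto h2 ((eventually_ge_atTop b).mono h5)

theorem tendsto_jF_zero (hq : FirstMoment q) {ρ : ℂ} (hρ : 0 < ρ.im) :
    Tendsto (jF q ρ) atTop (𝓝 0) := by
  have h1 : Tendsto (fun x : ℝ => Complex.exp (Complex.I * ρ * x)) atTop (𝓝 0) := by
    rw [tendsto_zero_iff_norm_tendsto_zero]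
    have : ∀ x : ℝ, ‖Complex.exp (Complex.I * ρ * x)‖ = Real.exp (-(ρ.im * x)) := by
      intro x; rw [Complex.norm_exp]; simp
    simp_rw [this]
    exact Real.tendsto_exp_neg_atTop_nhds_zero.comp (tendsto_id.const_mul_atTop hρ)
  simpa using! h1.smul (tendsto_jostM hq (mem_upperSet_of_pos hρ))

/-- The jump inequality for the function that agrees with `F_-` to the left of `x` and is
continued by a multiple of `F_+` to the right of `x`. -/
theorem jump_inequality (hq : SelfAdjointPotential q) {ρ : ℂ} (hρ : 0 < ρ.im)
    {φ : 𝔸 →L[ℂ] ℂ} (hφ : IsPositiveFunctional φ) {x a : ℝ} (hax : a ≤ x)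
    (u1 : IsUnit (jF q ρ x)) (u2 : IsUnit (jFb q ρ x)) :
    (ρ ^ 2).im ^ 2 * (∫ t in a..x, (φ (star (jG q ρ t) * jG q ρ t)).re) ≤
      (ρ ^ 2).im * (φ (star (-(2 * Complex.I * ρ) • (Ring.inverse (jFb q ρ x) * jD q ρ)) *
        jG q ρ x)).im := by
  have hρ' := mem_upperSet_of_pos hρ
  -- With this factor F_+ c takes the value of F_- at `x`, so the glued function is continuous and
  -- only its derivative jumps.
  set c := Ring.inverse (jF q ρ x) * jG q ρ x
  have hR := ((isSol_jF hq.toFirstMoment hρ').mul_const c).im_functional_le hq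
    (by simpa using (tendsto_jF_zero hq.toFirstMoment hρ).mul_const c) hφ (le_refl x)
  -- The left half line is treated by reflection, where F_- becomes the Jost solution decaying at
  -- +∞.
  have hL := (isSol_jF hq.comp_neg.toFirstMoment hρ').im_functional_le hq.comp_neg
    (tendsto_jF_zero hq.comp_neg.toFirstMoment hρ) hφ (x := -x) (b := -a) (neg_le_neg hax)
  rw [intervalIntegral.integral_same, mul_zero, add_zero] at hR
  have e1 : jF q ρ x * c = jG q ρ x := by
    rw [← mul_assoc, Ring.mul_inverse_cancel _ u1, one_mul]
  rw [e1] at hR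
  -- The jump is computed by applying F̄_+: its Wronskian with F_+ is 0 and with F_- is 2iρD.
  have e2 : jG' q ρ x - jF' q ρ x * c =
      -(2 * Complex.I * ρ) • (Ring.inverse (jFb q ρ x) * jD q ρ) := by
    have w1 := wr_jFb_jF_self hq hρ' x
    have w2 := wr_jFb_jG hq hρ' x
    have w3 : jFb q ρ x * (jG' q ρ x - jF' q ρ x * c) = -(2 * Complex.I * ρ) • jD q ρ := by
      rw [neg_smul, ← w2, wr, mul_sub, ← mul_assoc (jFb q ρ x) (jF' q ρ x)]
      rw [wr, sub_eq_zero] at w1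
      rw [← w1, mul_assoc, e1]
      abel
    rw [← mul_smul_comm, ← w3, ← mul_assoc (Ring.inverse (jFb q ρ x)) (jFb q ρ x),
      Ring.inverse_mul_cancel _ u2, one_mul]
  have e3 : ∫ t in -x..-a, (φ (star (jF (fun t => q (-t)) ρ t) * jF (fun t => q (-t)) ρ t)).re
      = ∫ t in a..x, (φ (star (jG q ρ t) * jG q ρ t)).re := by
    rw [← intervalIntegral.integral_comp_neg]
    rfl
  rw [e3] at hL
  rw [← e2, star_sub, sub_mul, map_sub, Complex.sub_im]
  have e4 : (φ (star (jG' q ρ x) * jG q ρ x)).im =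
      -(φ (star (jF' (fun t => q (-t)) ρ (-x)) * jF (fun t => q (-t)) ρ (-x))).im := by
    rw [jG', jG, star_neg, neg_mul, map_neg, Complex.neg_im]
  rw [e4]
  nlinarith [hL, hR]

end Functional

end MatrixScattering
end

/-! ### Lower bound for D in horizontal strips -/

noncomputable section
set_option linter.unusedSectionVars false

namespace MatrixScattering

open Set
open scoped Matrix.Norms.L2Operator Matrix

variable {m : ℕ}

/-- The Euclidean norm of a vector. -/
def vn (v : Fin m → ℂ) : ℝ := ‖WithLp.toLp 2 v‖

theorem vn_nonneg (v : Fin m → ℂ) : 0 ≤ vn v := norm_nonneg _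

theorem vn_mulVec_le (A : Mat m) (v : Fin m → ℂ) : vn (A *ᵥ v) ≤ ‖A‖ * vn v :=
  Matrix.l2_opNorm_mulVec A (WithLp.toLp 2 v)

theorem dot_re_self (v : Fin m → ℂ) : (star v ⬝ᵥ v).re = vn v ^ 2 := by
  rw [vn, EuclideanSpace.norm_sq_eq]
  simp [dotProduct, ← Complex.normSq_eq_norm_sq, Complex.normSq_apply]

theorem norm_dot_le (u v : Fin m → ℂ) : ‖star u ⬝ᵥ v‖ ≤ vn u * vn v := by
  have := norm_inner_le_norm (𝕜 := ℂ) (WithLp.toLp 2 u) (WithLp.toLp 2 v)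
  rw [EuclideanSpace.inner_eq_star_dotProduct] at this
  rwa [dotProduct_comm] at this

theorem eq_zero_of_vn {v : Fin m → ℂ} (h : vn v = 0) : v = 0 := by
  have := norm_eq_zero.1 h
  simpa using this

theorem vn_smul (c : ℂ) (v : Fin m → ℂ) : vn (c • v) = ‖c‖ * vn v := by
  rw [vn, WithLp.toLp_smul, norm_smul, vn]

theorem isUnit_and_norm_inv_le {A : Mat m} {K : ℝ} (hK : 0 ≤ K) (h : ∀ v, vn v ≤ K * vn (A *ᵥ v)) :
    IsUnit A ∧ ‖A⁻¹‖ ≤ K := by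
  have hA : IsUnit A := by
    rw [← Matrix.mulVec_injective_iff_isUnit]
    intro u v huv
    have h1 := h (u - v)
    rw [Matrix.mulVec_sub, sub_eq_zero.2 huv] at h1
    have h2 : vn (0 : Fin m → ℂ) = 0 := by simp [vn]
    rw [h2, mul_zero] at h1
    exact sub_eq_zero.1 (eq_zero_of_vn (le_antisymm h1 (vn_nonneg _)))
  refine ⟨hA, ?_⟩
  rw [Matrix.l2_opNorm_def]
  refine ContinuousLinearMap.opNorm_le_bound _ hK fun x => ?_
  have h1 := h (A⁻¹ *ᵥ x.ofLp)
  rw [Matrix.mulVec_mulVec, Matrix.mul_nonsing_inv _ ((Matrix.isUnit_iff_isUnit_det A).1 hA),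
    Matrix.one_mulVec] at h1
  exact h1

/-- The functional `M ↦ v^* M v`. -/
def quad (v : Fin m → ℂ) : Mat m →L[ℂ] ℂ :=
  LinearMap.toContinuousLinearMap
    { toFun := fun M => star v ⬝ᵥ (M *ᵥ v)
      map_add' := fun M N => by rw [Matrix.add_mulVec, dotProduct_add]
      map_smul' := fun c M => by
        rw [Matrix.smul_mulVec, dotProduct_smul, RingHom.id_apply] }

theorem quad_apply (v : Fin m → ℂ) (M : Mat m) : quad v M = star v ⬝ᵥ (M *ᵥ v) := rfl

theorem quad_star_mul (v : Fin m → ℂ) (A B : Mat m) :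
    quad v (star A * B) = star (A *ᵥ v) ⬝ᵥ (B *ᵥ v) := by
  rw [quad_apply, ← Matrix.mulVec_mulVec, Matrix.star_mulVec, Matrix.dotProduct_mulVec,
    Matrix.star_eq_conjTranspose]

theorem isPositiveFunctional_quad (v : Fin m → ℂ) : IsPositiveFunctional (quad v) where
  conj a := by
    have h := quad_star_mul v a 1
    rw [mul_one, Matrix.one_mulVec] at h
    rw [h, quad_apply]
    have : star (a *ᵥ v) ⬝ᵥ v = star (star v ⬝ᵥ (a *ᵥ v)) := by
      rw [Matrix.star_dotProduct]
    rw [this]; rfl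
  nonneg a := by
    rw [quad_star_mul, dot_re_self]; positivity

theorem norm_ringInverse_le {𝔸 : Type*} [CStarAlgebra 𝔸] {a : 𝔸} (h : ‖a - 1‖ ≤ 1 / 2) :
    ‖Ring.inverse a‖ ≤ 2 * ‖(1 : 𝔸)‖ := by
  have h1 := Ring.inverse_mul_cancel a (isUnit_of_norm_sub_one_le h)
  have h2 : Ring.inverse a = 1 - Ring.inverse a * (a - 1) := by
    rw [mul_sub, h1, mul_one]; abel
  have h3 : ‖Ring.inverse a‖ ≤ ‖(1 : 𝔸)‖ + ‖Ring.inverse a‖ * (1 / 2) := by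
    calc ‖Ring.inverse a‖ = ‖1 - Ring.inverse a * (a - 1)‖ := by rw [← h2]
      _ ≤ _ := (norm_sub_le _ _).trans (add_le_add le_rfl ((norm_mul_le _ _).trans (by gcongr)))
  linarith

theorem ringInverse_exp_smul {𝔸 : Type*} [CStarAlgebra 𝔸] {a : 𝔸} (h : IsUnit a) (z : ℂ) :
    Ring.inverse (Complex.exp z • a) = Complex.exp (-z) • Ring.inverse a := by
  have h1 : (Complex.exp z • a) * (Complex.exp (-z) • Ring.inverse a) = 1 := by
    rw [smul_mul_smul_comm, ← Complex.exp_add, add_neg_cancel, Complex.exp_zero, one_smul,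
      Ring.mul_inverse_cancel _ h]
  rw [← Ring.inverse_mul_cancel_left _ (Complex.exp (-z) • Ring.inverse a) (isUnit_exp_smul h z),
    h1, mul_one]

variable {Q : ℝ → Mat m}

/-- The lower bound `|Re ρ| |v| ≤ C |ρ| |D(ρ) v|` in horizontal strips. -/
theorem exists_jD_lower (hQ : SelfAdjointPotential Q) (T : ℝ) :
    ∃ C, 0 ≤ C ∧ ∀ ρ : ℂ, 0 < ρ.im → ρ.im ≤ T → ∀ v, |ρ.re| * vn v ≤ C * ‖ρ‖ * vn (jD Q ρ *ᵥ v) := by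
  obtain ⟨X1, hX10, hX1⟩ := exists_forall_norm_jostM_sub_one_le hQ.toFirstMoment
  obtain ⟨X2, hX20, hX2⟩ := exists_forall_norm_jostM_sub_one_le hQ.comp_neg.toFirstMoment
  set X := max X1 X2
  have hX0 : 0 ≤ X := hX10.trans (le_max_left _ _)
  set n1 := ‖(1 : Mat m)‖
  have hn1 : 0 ≤ n1 := norm_nonneg _
  set K := n1 * Real.exp (∫ s in Ioi (-X), |s - -X| * ‖Q (-s)‖)
  have hK : 0 ≤ K := by positivity
  -- On [-X - 1/τ, -X] one has |F_- v| ≥ e^{-TX-1}|v|/2: the exponential is at least e^{-TX-1}, and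
  -- the reduced Jost solution differs from 1 by at most 1/2. Squaring gives `k`.
  set k := Real.exp (-(T * X) - 1) ^ 2 / 4
  have hk : 0 < k := by positivity
  refine ⟨(2 * n1 * Real.exp (T * X)) * (Real.exp (T * X) * K) / k, by positivity,
    fun ρ hρ hT v => ?_⟩
  have hρ' := mem_upperSet_of_pos hρ
  set τ := ρ.im
  have hnormexp : ∀ (z : ℂ) (y : ℝ), ‖Complex.exp (Complex.I * z * y)‖ = Real.exp (-(z.im * y)) := by
    intro z y; rw [Complex.norm_exp]; simp
  have hexp : ∀ y : ℝ, |y| ≤ X → Real.exp (-(τ * y)) ≤ Real.exp (T * X) := fun y hy => by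
    refine Real.exp_le_exp.2 ?_
    have : τ * -y ≤ T * X := by
      calc τ * -y ≤ τ * X := by
            gcongr; exact (neg_le_abs y).trans hy
        _ ≤ T * X := by gcongr
    linarith
  have m1 := hX1 ρ hρ' X (le_max_left _ _)
  have m2 : ‖jMb Q ρ X - 1‖ ≤ 1 / 2 := by
    rw [jMb, norm_star_sub_one]; exact hX1 _ (neg_conj_mem hρ') X (le_max_left _ _)
  have u2 : IsUnit (jFb Q ρ X) := by
    rw [jFb_eq]; exact isUnit_exp_smul (isUnit_of_norm_sub_one_le m2) _
  have hinv : ‖Ring.inverse (jFb Q ρ X)‖ ≤ 2 * n1 * Real.exp (T * X) := by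
    rw [jFb_eq, ringInverse_exp_smul (isUnit_of_norm_sub_one_le m2), norm_smul]
    have e : -(Complex.I * ρ * (X : ℂ)) = Complex.I * ρ * ((-X : ℝ) : ℂ) := by push_cast; ring
    rw [e, hnormexp, mul_comm]
    exact mul_le_mul (norm_ringInverse_le m2) (hexp (-X) (by rw [abs_neg, abs_of_nonneg hX0]))
      (Real.exp_pos _).le (by positivity)
  have hG : ‖jG Q ρ X‖ ≤ Real.exp (T * X) * K := by
    rw [jG, jF, norm_smul, hnormexp]
    refine mul_le_mul (hexp (-X) (by rw [abs_neg, abs_of_nonneg hX0])) ?_ (norm_nonneg _)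
      (Real.exp_pos _).le
    exact norm_jostM_le (kernelBound_abs hQ.comp_neg.toFirstMoment hρ' (-X)) le_rfl
  have hlow : ∀ t ∈ Icc (-X - 1 / τ) (-X), k * vn v ^ 2 ≤
      (quad v (star (jG Q ρ t) * jG Q ρ t)).re := by
    intro t ht
    rw [quad_star_mul, dot_re_self, jG, jF, Matrix.smul_mulVec, vn_smul, hnormexp]
    have h1 : Real.exp (-(T * X) - 1) ≤ Real.exp (-(τ * -t)) := by
      refine Real.exp_le_exp.2 ?_
      have : τ * (-X - 1 / τ) ≤ τ * t := by gcongr; exact ht.1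
      have h2 : τ * (1 / τ) = 1 := by field_simp
      have h3 : τ * X ≤ T * X := by gcongr
      nlinarith
    have h2 : vn v / 2 ≤ vn (jostM (fun t => Q (-t)) ρ (-t) *ᵥ v) := by
      have h3 := hX2 ρ hρ' (-t) (by linarith [ht.2, le_max_right X1 X2])
      have h4 := vn_mulVec_le (jostM (fun t => Q (-t)) ρ (-t) - 1) v
      have h5 : vn v - vn (jostM (fun t => Q (-t)) ρ (-t) *ᵥ v) ≤
          vn ((jostM (fun t => Q (-t)) ρ (-t) - 1) *ᵥ v) := by
        rw [Matrix.sub_mulVec, Matrix.one_mulVec]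
        simp only [vn, WithLp.toLp_sub]
        rw [norm_sub_rev]
        exact norm_sub_norm_le _ _
      have := mul_le_mul_of_nonneg_right h3 (vn_nonneg v)
      linarith
    have h3 := vn_nonneg v
    calc k * vn v ^ 2 = (Real.exp (-(T * X) - 1) * (vn v / 2)) ^ 2 := by simp only [k]; ring
      _ ≤ _ := by gcongr
  have hcont : Continuous fun t => (quad v (star (jG Q ρ t) * jG Q ρ t)).re := by
    have hc := (isSol_jG hQ.toFirstMoment hρ').prim.continuous
    exact Complex.continuous_re.comp ((quad v).continuous.comp (hc.star.mul hc))
  have hpos := isPositiveFunctional_quad v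
  have hτ1 : 0 < 1 / τ := by positivity
  -- The interval has length 1/τ. This factor compensates the τ in Im ρ² = 2τ Re ρ, so the final
  -- constant does not degenerate as τ → 0.
  have hint : k * vn v ^ 2 / τ ≤
      ∫ t in (-X - 1 / τ)..X, (quad v (star (jG Q ρ t) * jG Q ρ t)).re := by
    have h1 : ∫ t in (-X - 1 / τ)..(-X), k * vn v ^ 2 ≤
        ∫ t in (-X - 1 / τ)..(-X), (quad v (star (jG Q ρ t) * jG Q ρ t)).re :=
      intervalIntegral.integral_mono_on (by linarith) intervalIntegrable_const
        (hcont.intervalIntegrable _ _) hlow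
    have h2 : ∫ t in (-X - 1 / τ)..(-X), (quad v (star (jG Q ρ t) * jG Q ρ t)).re ≤
        ∫ t in (-X - 1 / τ)..X, (quad v (star (jG Q ρ t) * jG Q ρ t)).re :=
      intervalIntegral.integral_mono_interval le_rfl (by linarith) (by linarith)
        (Eventually.of_forall fun t => hpos.nonneg _) (hcont.intervalIntegrable _ _)
    rw [intervalIntegral.integral_const, smul_eq_mul] at h1
    refine le_trans (le_of_eq ?_) (h1.trans h2)
    field_simp
    ring
  have hJ := jump_inequality hQ hρ hpos (x := X) (a := -X - 1 / τ) (by linarith)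
    (isUnit_exp_smul (isUnit_of_norm_sub_one_le m1) _) u2
  have him : (ρ ^ 2).im = 2 * ρ.re * τ := by
    rw [sq, Complex.mul_im]; simp only [τ]; ring
  set A := -(2 * Complex.I * ρ) • (Ring.inverse (jFb Q ρ X) * jD Q ρ)
  have hA : vn (A *ᵥ v) ≤ 2 * ‖ρ‖ * (2 * n1 * Real.exp (T * X)) * vn (jD Q ρ *ᵥ v) := by
    rw [Matrix.smul_mulVec, vn_smul, norm_neg, norm_two_I_mul, ← Matrix.mulVec_mulVec,
      mul_assoc (2 * ‖ρ‖)]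
    exact mul_le_mul_of_nonneg_left ((vn_mulVec_le _ _).trans
      (mul_le_mul_of_nonneg_right hinv (vn_nonneg _))) (by positivity)
  have hup : |(quad v (star A * jG Q ρ X)).im| ≤
      2 * ‖ρ‖ * (2 * n1 * Real.exp (T * X)) * vn (jD Q ρ *ᵥ v) *
        (Real.exp (T * X) * K * vn v) := by
    refine (Complex.abs_im_le_norm _).trans ?_
    rw [quad_star_mul]
    refine (norm_dot_le _ _).trans (mul_le_mul hA ((vn_mulVec_le _ _).trans ?_) (vn_nonneg _) ?_)
    · gcongr; exact vn_nonneg _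
    · have := vn_nonneg (jD Q ρ *ᵥ v); positivity
  set W := vn (jD Q ρ *ᵥ v)
  have hW : 0 ≤ W := vn_nonneg _
  have hv := vn_nonneg v
  rcases hv.eq_or_lt with hv0 | hv0
  · rw [← hv0, mul_zero]; positivity
  by_cases hre : ρ.re = 0
  · rw [hre, abs_zero, zero_mul]; positivity
  have hre' : 0 < |ρ.re| := abs_pos.2 hre
  have h1 : (2 * |ρ.re| * τ) ^ 2 * (k * vn v ^ 2 / τ) ≤ (2 * |ρ.re| * τ) *
      (2 * ‖ρ‖ * (2 * n1 * Real.exp (T * X)) * W * (Real.exp (T * X) * K * vn v)) := by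
    have e1 : (2 * |ρ.re| * τ) ^ 2 = (ρ ^ 2).im ^ 2 := by
      rw [him, mul_pow, mul_pow, mul_pow, mul_pow, sq_abs]
    have e2 : 2 * |ρ.re| * τ = |(ρ ^ 2).im| := by
      rw [him, abs_mul, abs_mul, abs_of_pos hρ, abs_of_pos (by norm_num : (0 : ℝ) < 2)]
    calc _ ≤ (ρ ^ 2).im ^ 2 * _ := by
            rw [e1]; exact mul_le_mul_of_nonneg_left hint (sq_nonneg _)
      _ ≤ _ := hJ
      _ ≤ |(ρ ^ 2).im| * |(quad v (star A * jG Q ρ X)).im| := by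
        rw [← abs_mul]; exact le_abs_self _
      _ ≤ _ := by
        rw [e2]; exact mul_le_mul_of_nonneg_left hup (abs_nonneg _)
  -- The common factor to be cancelled is positive, since the cases v = 0 and Re ρ = 0 have been
  -- settled.
  have h2 : (2 * |ρ.re| * τ) * (2 * vn v) * (k * (|ρ.re| * vn v)) ≤
      (2 * |ρ.re| * τ) * (2 * vn v) *
      (‖ρ‖ * (2 * n1 * Real.exp (T * X)) * W * (Real.exp (T * X) * K)) := by
    refine le_trans (le_of_eq ?_) (h1.trans (le_of_eq ?_))
    · field_simp
    · ring
  have h3 := le_of_mul_le_mul_left h2 (by positivity)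
  rw [mul_comm k] at h3
  rw [div_mul_eq_mul_div, div_mul_eq_mul_div, le_div_iff₀ hk]
  linarith

end MatrixScattering
end

/-! ### Poles of D⁻¹ and weight matrices -/

noncomputable section
set_option linter.unusedSectionVars false

namespace MatrixScattering

open Set
open scoped Matrix.Norms.L2Operator Matrix

variable {m : ℕ} {Q : ℝ → Mat m}

/-- `D(ρ)` is invertible off the imaginary axis, with `|D(ρ)⁻¹| ≤ C |ρ| / |Re ρ|`. -/
theorem exists_norm_jD_inv_le (hQ : SelfAdjointPotential Q) (T : ℝ) :
    ∃ C, 0 ≤ C ∧ ∀ ρ : ℂ, 0 < ρ.im → ρ.im ≤ T → ρ.re ≠ 0 →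
      IsUnit (jD Q ρ) ∧ ‖(jD Q ρ)⁻¹‖ ≤ C * ‖ρ‖ / |ρ.re| := by
  obtain ⟨C, hC0, hC⟩ := exists_jD_lower hQ T
  refine ⟨C, hC0, fun ρ h1 h2 h3 => ?_⟩
  have h4 : 0 < |ρ.re| := abs_pos.2 h3
  refine isUnit_and_norm_inv_le (by positivity) fun v => ?_
  rw [div_mul_eq_mul_div, le_div_iff₀ h4, mul_comm]
  exact hC ρ h1 h2 v

theorem isUnit_jD_of_re_ne_zero (hQ : SelfAdjointPotential Q) {ρ : ℂ} (h1 : 0 < ρ.im)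
    (h2 : ρ.re ≠ 0) : IsUnit (jD Q ρ) := by
  obtain ⟨C, -, hC⟩ := exists_norm_jD_inv_le hQ ρ.im
  exact (hC ρ h1 le_rfl h2).1

theorem differentiableAt_entry {f : ℂ → Mat m} {z : ℂ} (hf : DifferentiableAt ℂ f z) (j k : Fin m) :
    DifferentiableAt ℂ (fun w => f w j k) z := by
  let L : Mat m →L[ℂ] ℂ := LinearMap.toContinuousLinearMap (Matrix.entryLinearMap ℂ ℂ j k)
  exact L.differentiableAt.comp z hf

theorem differentiableAt_of_entry {f : ℂ → Mat m} {z : ℂ}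
    (hf : ∀ j k, DifferentiableAt ℂ (fun w => f w j k) z) : DifferentiableAt ℂ f z := by
  have : f = fun w => ∑ j, ∑ k, f w j k • Matrix.single j k (1 : ℂ) := by
    ext1 w
    conv_lhs => rw [Matrix.matrix_eq_sum_single (f w)]
    simp
  rw [this]
  exact DifferentiableAt.fun_sum fun j _ => DifferentiableAt.fun_sum fun k _ =>
    (hf j k).smul_const _

theorem differentiableAt_det {f : ℂ → Mat m} {z : ℂ} (hf : DifferentiableAt ℂ f z) :
    DifferentiableAt ℂ (fun w => (f w).det) z := by
  simp only [Matrix.det_apply]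
  refine DifferentiableAt.fun_sum fun σ _ => DifferentiableAt.const_smul ?_ _
  exact DifferentiableAt.fun_finsetProd fun i _ => differentiableAt_entry hf _ _

theorem differentiableAt_adjugate {f : ℂ → Mat m} {z : ℂ} (hf : DifferentiableAt ℂ f z) :
    DifferentiableAt ℂ (fun w => (f w).adjugate) z := by
  refine differentiableAt_of_entry fun j k => ?_
  simp only [Matrix.adjugate_apply]
  refine differentiableAt_det (differentiableAt_of_entry fun a b => ?_)
  by_cases h : a = k
  · subst h; simp
  · simpa [Matrix.updateRow_ne h] using differentiableAt_entry hf a b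

theorem inv_eq_smul_adjugate (A : Mat m) : A⁻¹ = A.det⁻¹ • A.adjugate := by
  rw [Matrix.inv_def, Ring.inverse_eq_inv']

theorem meromorphicAt_jD_inv (hQ : SelfAdjointPotential Q) {ρ₀ : ℂ} (h0 : 0 < ρ₀.im) :
    MeromorphicAt (fun ρ => (jD Q ρ)⁻¹) ρ₀ := by
  have hd : ∀ ρ ∈ {ρ : ℂ | 0 < ρ.im}, DifferentiableAt ℂ (jD Q) ρ := fun ρ hρ =>
    (differentiableOn_jD hQ.toFirstMoment).differentiableAt (isOpen_im_pos.mem_nhds hρ)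
  have h1 : AnalyticAt ℂ (fun ρ => (jD Q ρ).det) ρ₀ :=
    DifferentiableOn.analyticAt (s := {ρ : ℂ | 0 < ρ.im})
      (fun ρ hρ => (differentiableAt_det (hd ρ hρ)).differentiableWithinAt)
      (isOpen_im_pos.mem_nhds h0)
  have h2 : AnalyticAt ℂ (fun ρ => (jD Q ρ).adjugate) ρ₀ :=
    DifferentiableOn.analyticAt (s := {ρ : ℂ | 0 < ρ.im})
      (fun ρ hρ => (differentiableAt_adjugate (hd ρ hρ)).differentiableWithinAt)
      (isOpen_im_pos.mem_nhds h0)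
  have : (fun ρ => (jD Q ρ)⁻¹) = (fun ρ => (jD Q ρ).det)⁻¹ • fun ρ => (jD Q ρ).adjugate := by
    ext1 ρ; simp [inv_eq_smul_adjugate]
  rw [this]
  exact h1.meromorphicAt.inv.smul h2.meromorphicAt

/-- The horizontal ray from `ρ₀` to the right. -/
theorem tendsto_ray (ρ₀ : ℂ) : Tendsto (fun s : ℝ => ρ₀ + s) (𝓝[>] 0) (𝓝[≠] ρ₀) := by
  rw [tendsto_nhdsWithin_iff]
  constructor
  · refine Tendsto.mono_left ?_ nhdsWithin_le_nhds
    exact (by fun_prop : Continuous fun s : ℝ => ρ₀ + s).tendsto' 0 _ (by simp)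
  · filter_upwards [self_mem_nhdsWithin] with s hs
    have hs' : s ≠ 0 := (mem_Ioi.1 hs).ne'
    simp [hs']

/-- The poles of `D⁻¹` in the upper half plane are simple. -/
theorem exists_residue (hQ : SelfAdjointPotential Q) {ρ₀ : ℂ} (h0 : 0 < ρ₀.im) :
    ∃ R, Tendsto (fun ρ => (ρ - ρ₀) • (jD Q ρ)⁻¹) (𝓝[≠] ρ₀) (𝓝 R) := by
  have hmer : MeromorphicAt (fun ρ => (ρ - ρ₀) • (jD Q ρ)⁻¹) ρ₀ :=
    MeromorphicAt.smul (f := fun ρ => ρ - ρ₀) (by fun_prop) (meromorphicAt_jD_inv hQ h0)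
  rw [tendsto_nhds_iff_meromorphicOrderAt_nonneg hmer]
  -- A negative order would make (ρ - ρ₀)D⁻¹ tend to infinity in norm. Along the horizontal ray it
  -- is bounded, since |s| ≤ 2|Re ρ₀ + s| offsets the bound |ρ|/|Re ρ| for D⁻¹.
  by_contra hneg
  rw [not_le, ← tendsto_cobounded_iff_meromorphicOrderAt_neg hmer] at hneg
  have h1 := tendsto_norm_atTop_iff_cobounded.2 (hneg.comp (tendsto_ray ρ₀))
  obtain ⟨C, hC0, hC⟩ := exists_norm_jD_inv_le hQ ρ₀.im
  have h2 : ∀ᶠ s : ℝ in 𝓝[>] 0, ρ₀.re + s ≠ 0 ∧ |s| ≤ 2 * |ρ₀.re + s| ∧ s ≤ 1 := by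
    rcases eq_or_ne ρ₀.re 0 with h | h
    · filter_upwards [Ioo_mem_nhdsGT (zero_lt_one' ℝ)] with s hs
      rw [h, zero_add]
      exact ⟨hs.1.ne', by linarith [abs_nonneg s], hs.2.le⟩
    · have hpos : 0 < min 1 (|ρ₀.re| / 2) := lt_min one_pos (by positivity)
      filter_upwards [Ioo_mem_nhdsGT hpos] with s hs
      have h3 : s < |ρ₀.re| / 2 := hs.2.trans_le (min_le_right _ _)
      have h4 : |ρ₀.re| - |s| ≤ |ρ₀.re + s| := by
        have := abs_sub_abs_le_abs_sub ρ₀.re (-s)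
        rwa [abs_neg, sub_neg_eq_add] at this
      rw [abs_of_pos hs.1] at h4 ⊢
      have h0' : 0 < |ρ₀.re| := abs_pos.2 h
      have h5 : 0 < |ρ₀.re + s| := by linarith
      exact ⟨abs_pos.1 h5, by linarith, (hs.2.trans_le (min_le_left _ _)).le⟩
  have h3 : ∀ᶠ s : ℝ in 𝓝[>] 0, ‖((ρ₀ + s) - ρ₀ : ℂ) • (jD Q (ρ₀ + s))⁻¹‖ ≤
      2 * (C * (‖ρ₀‖ + 1)) := by
    filter_upwards [h2, self_mem_nhdsWithin] with s hs hs0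
    have him : (ρ₀ + s : ℂ).im = ρ₀.im := by simp
    have hre : (ρ₀ + s : ℂ).re = ρ₀.re + s := by simp
    have h4 := (hC (ρ₀ + s) (by rw [him]; exact h0) him.le (by rw [hre]; exact hs.1)).2
    rw [hre] at h4
    have h5 : 0 < |ρ₀.re + s| := abs_pos.2 hs.1
    have hs0' : 0 < s := hs0
    have h6 : ‖(ρ₀ + s : ℂ)‖ ≤ ‖ρ₀‖ + 1 := by
      refine (norm_add_le _ _).trans ?_
      rw [Complex.norm_real, Real.norm_of_nonneg hs0'.le]
      linarith [hs.2.2]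
    rw [norm_smul, add_sub_cancel_left, Complex.norm_real, Real.norm_eq_abs]
    calc |s| * ‖(jD Q (ρ₀ + s))⁻¹‖ ≤ (2 * |ρ₀.re + s|) * (C * (‖ρ₀‖ + 1) / |ρ₀.re + s|) := by
          gcongr
          · exact hs.2.1
          · exact h4.trans (by gcongr)
      _ = _ := by field_simp
  obtain ⟨s, hs1, hs2⟩ := ((h1.eventually_gt_atTop (2 * (C * (‖ρ₀‖ + 1)))).and h3).exists
  exact absurd hs2 (not_le.2 hs1)

theorem eventually_ray_isUnit (hQ : SelfAdjointPotential Q) {ρ₀ : ℂ} (h0 : 0 < ρ₀.im) :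
    ∀ᶠ s : ℝ in 𝓝[>] 0, IsUnit (jD Q (ρ₀ + s)) := by
  have h2 : ∀ᶠ s : ℝ in 𝓝[>] 0, ρ₀.re + s ≠ 0 := by
    have : ∀ᶠ s : ℝ in 𝓝[≠] (-ρ₀.re), s ≠ -ρ₀.re := self_mem_nhdsWithin
    rcases eq_or_ne ρ₀.re 0 with h | h
    · filter_upwards [self_mem_nhdsWithin] with s hs
      rw [h, zero_add]; exact (mem_Ioi.1 hs).ne'
    · have h1 : Tendsto (fun s : ℝ => ρ₀.re + s) (𝓝[>] 0) (𝓝 ρ₀.re) :=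
        Tendsto.mono_left ((by fun_prop : Continuous fun s : ℝ => ρ₀.re + s).tendsto' 0 _ (by simp))
          nhdsWithin_le_nhds
      exact h1.eventually_ne h
  filter_upwards [h2] with s hs
  exact isUnit_jD_of_re_ne_zero hQ (by simpa using h0) (by simpa using hs)

theorem continuousAt_jD (hQ : SelfAdjointPotential Q) {ρ₀ : ℂ} (h0 : 0 < ρ₀.im) :
    ContinuousAt (jD Q) ρ₀ :=
  ((differentiableOn_jD hQ.toFirstMoment).differentiableAt
    (isOpen_im_pos.mem_nhds h0)).continuousAt

/-- Pass to the limit in D · (ρ - ρ₀)D⁻¹ = ρ - ρ₀ along the horizontal ray, where D is invertible.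
-/
theorem jD_mul_residue (hQ : SelfAdjointPotential Q) {ρ₀ : ℂ} (h0 : 0 < ρ₀.im) {R : Mat m}
    (hR : Tendsto (fun ρ => (ρ - ρ₀) • (jD Q ρ)⁻¹) (𝓝[≠] ρ₀) (𝓝 R)) : jD Q ρ₀ * R = 0 := by
  have h1 := (((continuousAt_jD hQ h0).tendsto.mono_left nhdsWithin_le_nhds).mul hR).comp
    (tendsto_ray ρ₀)
  have h2 : Tendsto (fun s : ℝ => (s : ℂ) • (1 : Mat m)) (𝓝[>] 0) (𝓝 0) := by
    refine Tendsto.mono_left ?_ nhdsWithin_le_nhds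
    exact (by fun_prop : Continuous fun s : ℝ => (s : ℂ) • (1 : Mat m)).tendsto' 0 _ (by simp)
  refine tendsto_nhds_unique h1 (h2.congr' ?_)
  filter_upwards [eventually_ray_isUnit hQ h0] with s hs
  simp only [Function.comp_apply, add_sub_cancel_left, mul_smul_comm]
  rw [Matrix.mul_nonsing_inv _ ((Matrix.isUnit_iff_isUnit_det _).1 hs)]

/-- The weight matrix: `F_- R = i F_+ N`. -/
theorem exists_weight (hQ : SelfAdjointPotential Q) {ρ₀ : ℂ} (h0 : 0 < ρ₀.im) {R : Mat m}
    (hR : jD Q ρ₀ * R = 0) :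
    ∃ N, ∀ x, jG Q ρ₀ x * R = Complex.I • (jF Q ρ₀ x * N) := by
  have hρ := mem_upperSet_of_pos h0
  obtain ⟨c, hc⟩ := exists_eq_jF_mul hQ hρ ((isSol_jG hQ.toFirstMoment hρ).mul_const R) (by
    intro x
    have : wr (jFb Q ρ₀) (jFb' Q ρ₀) (fun x => jG Q ρ₀ x * R) (fun x => jG' Q ρ₀ x * R) x
        = wr (jFb Q ρ₀) (jFb' Q ρ₀) (jG Q ρ₀) (jG' Q ρ₀) x * R := by
      simp only [wr, sub_mul, mul_assoc]
    rw [this, wr_jFb_jG hQ hρ, smul_mul_assoc, hR, smul_zero])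
  refine ⟨-Complex.I • c, fun x => ?_⟩
  rw [hc x, mul_smul_comm, smul_smul]
  simp

/-- The weight matrices are positive semidefinite. -/
theorem weight_nonneg (hQ : SelfAdjointPotential Q) {ρ₀ : ℂ} (h0 : 0 < ρ₀.im) (hre : ρ₀.re = 0)
    {R N : Mat m} (hR : Tendsto (fun ρ => (ρ - ρ₀) • (jD Q ρ)⁻¹) (𝓝[≠] ρ₀) (𝓝 R))
    (hN : ∀ x, jG Q ρ₀ x * R = Complex.I • (jF Q ρ₀ x * N)) (v : Fin m → ℂ) :
    0 ≤ (quad v N).re := by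
  obtain ⟨X, -, hX⟩ := exists_forall_norm_jostM_sub_one_le hQ.toFirstMoment
  have hρ := mem_upperSet_of_pos h0
  have hu1 : ∀ ρ ∈ upperSet, IsUnit (jF Q ρ X) := fun ρ hρ =>
    isUnit_exp_smul (isUnit_of_norm_sub_one_le (hX ρ hρ X le_rfl)) _
  have hu2 : ∀ ρ ∈ upperSet, IsUnit (jFb Q ρ X) := fun ρ hρ => (hu1 _ (neg_conj_mem hρ)).star
  have hconj : -(starRingEnd ℂ ρ₀) = ρ₀ := by
    apply Complex.ext <;> simp [hre]
  -- The jump inequality at ρ₀ + s with an empty interval only states a sign. Multiplied by s > 0 it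
  -- passes to the limit s → 0 and becomes a sign for the residue.
  have key : ∀ w : Fin m → ℂ, 0 ≤ (star w ⬝ᵥ ((jF Q ρ₀ X * N * jFb Q ρ₀ X) *ᵥ w)).re := by
    intro w
    have hcG : ContinuousAt (fun ρ => jG Q ρ X) ρ₀ := by
      have h1 := ((differentiableOn_jostM hQ.comp_neg.toFirstMoment (-X)).differentiableAt
        (isOpen_im_pos.mem_nhds h0)).continuousAt
      exact ContinuousAt.smul (f := fun ρ : ℂ => Complex.exp (Complex.I * ρ * ((-X : ℝ) : ℂ)))
        (by fun_prop) h1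
    have hcF : ContinuousAt (fun ρ => jFb Q ρ X) ρ₀ := by
      have h1 := ((differentiableOn_jMb hQ.toFirstMoment X).differentiableAt
        (isOpen_im_pos.mem_nhds h0)).continuousAt
      have : (fun ρ => jFb Q ρ X) = _ := funext fun ρ => jFb_eq ρ X
      rw [this]
      exact ContinuousAt.smul (f := fun ρ : ℂ => Complex.exp (Complex.I * ρ * (X : ℂ)))
        (by fun_prop) h1
    have hlim : Tendsto (fun ρ => star (-(2 * Complex.I * ρ) • (1 : Mat m)) *
        (jG Q ρ X * ((ρ - ρ₀) • (jD Q ρ)⁻¹) * jFb Q ρ X)) (𝓝[≠] ρ₀)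
        (𝓝 (star (-(2 * Complex.I * ρ₀) • (1 : Mat m)) * (jG Q ρ₀ X * R * jFb Q ρ₀ X))) := by
      have h1 : ContinuousAt (fun ρ : ℂ => star (-(2 * Complex.I * ρ) • (1 : Mat m))) ρ₀ := by
        fun_prop
      exact (h1.tendsto.mono_left nhdsWithin_le_nhds).mul
        (((hcG.tendsto.mono_left nhdsWithin_le_nhds).mul hR).mul
          (hcF.tendsto.mono_left nhdsWithin_le_nhds))
    have hlim2 := ((Complex.continuous_im.comp (quad w).continuous).tendsto _).comp
      (hlim.comp (tendsto_ray ρ₀))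
    have hge : 0 ≤ (quad w (star (-(2 * Complex.I * ρ₀) • (1 : Mat m)) *
        (jG Q ρ₀ X * R * jFb Q ρ₀ X))).im := by
      refine ge_of_tendsto hlim2 ?_
      filter_upwards [eventually_ray_isUnit hQ h0, self_mem_nhdsWithin] with s hs hs0
      have hs0' : 0 < s := hs0
      set ρ : ℂ := ρ₀ + s
      have him : ρ.im = ρ₀.im := by simp [ρ]
      have hre' : ρ.re = s := by simp [ρ, hre]
      have hρ0 : 0 < ρ.im := by rw [him]; exact h0
      have hρ' := mem_upperSet_of_pos hρ0
      -- Chosen so that F̄⁻¹ D v = w: the jump becomes a scalar multiple of w, while F_- v carries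
      -- D⁻¹.
      set v := ((jD Q ρ)⁻¹ * jFb Q ρ X) *ᵥ w
      have hJ := jump_inequality hQ hρ0 (isPositiveFunctional_quad v) (le_refl X) (hu1 ρ hρ') (hu2 ρ hρ')
      rw [intervalIntegral.integral_same, mul_zero] at hJ
      have hsq : (ρ ^ 2).im = 2 * s * ρ₀.im := by
        rw [sq, Complex.mul_im, him, hre']; ring
      rw [hsq] at hJ
      have h3 := nonneg_of_mul_nonneg_right hJ (by positivity)
      have h4 : quad v (star (-(2 * Complex.I * ρ) • (Ring.inverse (jFb Q ρ X) * jD Q ρ)) *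
          jG Q ρ X) = quad w (star (-(2 * Complex.I * ρ) • (1 : Mat m)) *
            (jG Q ρ X * (jD Q ρ)⁻¹ * jFb Q ρ X)) := by
        rw [quad_star_mul, quad_star_mul, Matrix.mulVec_mulVec, Matrix.mulVec_mulVec,
          smul_mul_assoc, mul_assoc (Ring.inverse _), ← mul_assoc (jD Q ρ),
          Matrix.mul_nonsing_inv _ ((Matrix.isUnit_iff_isUnit_det _).1 hs), one_mul,
          Ring.inverse_mul_cancel _ (hu2 ρ hρ'), ← mul_assoc]
      rw [h4] at h3
      have h5 : ρ - ρ₀ = (s : ℂ) := by simp [ρ]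
      simp only [Function.comp_apply]
      change 0 ≤ (quad w (star (-(2 * Complex.I * ρ) • (1 : Mat m)) *
            (jG Q ρ X * ((ρ - ρ₀) • (jD Q ρ)⁻¹) * jFb Q ρ X))).im
      rw [h5, mul_smul_comm, smul_mul_assoc, mul_smul_comm, map_smul, smul_eq_mul,
        Complex.im_ofReal_mul]
      exact mul_nonneg hs0'.le h3
    rw [hN X, smul_mul_assoc, star_smul, star_one, smul_mul_smul_comm, one_mul, map_smul,
      quad_apply] at hge
    have e : star (-(2 * Complex.I * ρ₀)) * Complex.I = ((2 * ρ₀.im : ℝ) : ℂ) * Complex.I := by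
      congr 1
      apply Complex.ext <;> simp [hre]
    rw [e, smul_eq_mul, mul_assoc, Complex.im_ofReal_mul, Complex.I_mul_im] at hge
    exact nonneg_of_mul_nonneg_right hge (by positivity)
  -- On the imaginary axis -ρ̄₀ = ρ₀, so F N F̄ = F̄* N F̄ is congruent to N by an invertible
  -- matrix.
  obtain ⟨b, hb⟩ := hu2 ρ₀ hρ
  have h1 := key ((↑b⁻¹ : Mat m) *ᵥ v)
  rw [quad_apply]
  have h2 : jF Q ρ₀ X = star (jFb Q ρ₀ X) := by rw [jFb, star_star, hconj]
  have h3 : (jFb Q ρ₀ X) *ᵥ ((↑b⁻¹ : Mat m) *ᵥ v) = v := by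
    rw [Matrix.mulVec_mulVec, ← hb, Units.mul_inv, Matrix.one_mulVec]
  have h4 := quad_star_mul ((↑b⁻¹ : Mat m) *ᵥ v) (jFb Q ρ₀ X) (N * jFb Q ρ₀ X)
  rw [← Matrix.mulVec_mulVec, h3, quad_apply, ← mul_assoc, ← h2] at h4
  rwa [h4] at h1

end MatrixScattering
end

/-! ### Scattering relations on the real axis -/

noncomputable section
set_option linter.unusedSectionVars false

namespace MatrixScattering

open Set
open scoped Matrix.Norms.L2Operator Matrix

variable {m : ℕ} {Q : ℝ → Mat m}

theorem real_mem_upperSet {r : ℝ} (hr : r ≠ 0) : (r : ℂ) ∈ upperSet :=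
  ⟨by simp, by simpa using hr⟩

theorem neg_real_mem_upperSet {r : ℝ} (hr : r ≠ 0) : -(r : ℂ) ∈ upperSet :=
  ⟨by simp, by simpa using hr⟩

/-- The coefficient `C(ρ)` for real `ρ`. -/
def jC (Q : ℝ → Mat m) (r : ℝ) : Mat m :=
  (2 * Complex.I * -(r : ℂ))⁻¹ • wr (jFb Q (-r)) (jFb' Q (-r)) (jG Q r) (jG' Q r) 0

theorem wr_jFb_neg_jG (hQ : SelfAdjointPotential Q) {r : ℝ} (hr : r ≠ 0) (x : ℝ) :
    wr (jFb Q (-r)) (jFb' Q (-r)) (jG Q r) (jG' Q r) x = (2 * Complex.I * -(r : ℂ)) • jC Q r := by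
  have h := neg_real_mem_upperSet hr
  rw [jC, smul_smul, mul_inv_cancel₀ (two_I_mul_ne h.2), one_smul]
  exact wr_const (by simpa using isLeftSol_jFb hQ h)
    (isSol_jG hQ.toFirstMoment (real_mem_upperSet hr)) x 0

/-- A left inverse of a `2 × 2` block matrix is a right inverse. -/
theorem block_inverse {a b c d a' b' c' d' : Mat m} (h11 : a * a' + b * c' = 1)
    (h12 : a * b' + b * d' = 0) (h21 : c * a' + d * c' = 0) (h22 : c * b' + d * d' = 1) :
    a' * a + b' * c = 1 ∧ a' * b + b' * d = 0 ∧ c' * a + d' * c = 0 ∧ c' * b + d' * d = 1 := by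
  have h : Matrix.fromBlocks a b c d * Matrix.fromBlocks a' b' c' d' = 1 := by
    rw [Matrix.fromBlocks_multiply, h11, h12, h21, h22, Matrix.fromBlocks_one]
  rw [mul_eq_one_comm, Matrix.fromBlocks_multiply, ← Matrix.fromBlocks_one,
    Matrix.fromBlocks_inj] at h
  exact h

/-- `F_-(x, ρ) = F_+(x, ρ) C(ρ) + F_+(x, -ρ) D(ρ)`, with the corresponding formula for the
derivatives. -/
theorem jG_eq (hQ : SelfAdjointPotential Q) {r : ℝ} (hr : r ≠ 0) (x : ℝ) :
    jG Q r x = jF Q r x * jC Q r + jF Q (-r) x * jD Q r ∧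
    jG' Q r x = jF' Q r x * jC Q r + jF' Q (-r) x * jD Q r := by
  have hp := real_mem_upperSet hr
  have hn := neg_real_mem_upperSet hr
  have w11 := wr_jFb_jF_neg hQ hn (by simpa using hp) x
  have w12 := wr_jFb_jF_self hQ hn x
  have w21 := wr_jFb_jF_self hQ hp x
  have w22 := wr_jFb_jF_neg hQ hp hn x
  rw [neg_neg] at w11
  have z1 := two_I_mul_ne hn.2
  have z2 := two_I_mul_ne hp.2
  set α := (2 * Complex.I * -(r : ℂ))⁻¹
  set β := (2 * Complex.I * (r : ℂ))⁻¹
  rw [wr] at w11 w12 w21 w22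
  -- The four Wronskian relations say that the adjoint solutions form a left inverse of the
  -- fundamental matrix of F_+(·, r), F_+(·, -r). Being also a right inverse, it expands F_- and its
  -- derivative.
  obtain ⟨k1, k2, k3, k4⟩ := block_inverse
    (a := α • jFb' Q (-r) x) (b := -(α • jFb Q (-r) x)) (c := β • jFb' Q r x) (d := -(β • jFb Q r x))
    (a' := jF Q r x) (b' := jF Q (-r) x) (c' := jF' Q r x) (d' := jF' Q (-r) x)
    (by rw [neg_mul, ← sub_eq_add_neg, smul_mul_assoc, smul_mul_assoc, ← smul_sub, w11, smul_smul,
      inv_mul_cancel₀ z1, one_smul])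
    (by rw [neg_mul, ← sub_eq_add_neg, smul_mul_assoc, smul_mul_assoc, ← smul_sub, w12, smul_zero])
    (by rw [neg_mul, ← sub_eq_add_neg, smul_mul_assoc, smul_mul_assoc, ← smul_sub, w21, smul_zero])
    (by rw [neg_mul, ← sub_eq_add_neg, smul_mul_assoc, smul_mul_assoc, ← smul_sub, w22, smul_smul,
      inv_mul_cancel₀ z2, one_smul])
  have hC : jC Q r = (α • jFb' Q (-r) x) * jG Q r x + -(α • jFb Q (-r) x) * jG' Q r x := by
    rw [neg_mul, ← sub_eq_add_neg, smul_mul_assoc, smul_mul_assoc, ← smul_sub]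
    have := wr_jFb_neg_jG hQ hr x
    rw [wr] at this
    rw [this, smul_smul, inv_mul_cancel₀ z1, one_smul]
  have hD : jD Q r = (β • jFb' Q r x) * jG Q r x + -(β • jFb Q r x) * jG' Q r x := by
    rw [neg_mul, ← sub_eq_add_neg, smul_mul_assoc, smul_mul_assoc, ← smul_sub]
    have := wr_jFb_jG hQ hp x
    rw [wr] at this
    rw [this, smul_smul, inv_mul_cancel₀ z2, one_smul]
  constructor
  · calc jG Q r x = (jF Q r x * α • jFb' Q (-r) x + jF Q (-r) x * β • jFb' Q r x) * jG Q r x +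
          (jF Q r x * -(α • jFb Q (-r) x) + jF Q (-r) x * -(β • jFb Q r x)) * jG' Q r x := by
          rw [k1, k2, one_mul, zero_mul, add_zero]
      _ = _ := by
          rw [hC, hD, mul_add, mul_add, add_mul, add_mul]
          simp only [mul_assoc]
          abel
  · calc jG' Q r x = (jF' Q r x * α • jFb' Q (-r) x + jF' Q (-r) x * β • jFb' Q r x) * jG Q r x +
          (jF' Q r x * -(α • jFb Q (-r) x) + jF' Q (-r) x * -(β • jFb Q r x)) * jG' Q r x := by
          rw [k3, k4, one_mul, zero_mul, zero_add]
      _ = _ := by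
          rw [hC, hD, mul_add, mul_add, add_mul, add_mul]
          simp only [mul_assoc]
          abel

/-- Uniqueness of the coefficients `C`, `D`. -/
theorem jC_jD_unique (hQ : SelfAdjointPotential Q) {r : ℝ} (hr : r ≠ 0) {A B : Mat m}
    (h : ∀ x, jG Q r x = jF Q r x * A + jF Q (-r) x * B) : A = jC Q r ∧ B = jD Q r := by
  have hp := real_mem_upperSet hr
  have hn := neg_real_mem_upperSet hr
  have hs := (isSol_jF hQ.toFirstMoment hn)
  rw [neg_sq] at hs
  have hsum := ((isSol_jF hQ.toFirstMoment hp).mul_const A).add (hs.mul_const B)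
  have h' : ∀ x, jG' Q r x = jF' Q r x * A + jF' Q (-r) x * B := fun x => by
    have e : jG Q r = fun x => jF Q r x * A + jF Q (-r) x * B := funext h
    have h1 := (isSol_jG hQ.toFirstMoment hp).hasDerivAt x
    rw [e] at h1
    exact h1.unique (hsum.hasDerivAt x)
  have w11 := wr_jFb_jF_neg hQ hn (by simpa using hp) 0
  have w12 := wr_jFb_jF_self hQ hn 0
  have w21 := wr_jFb_jF_self hQ hp 0
  have w22 := wr_jFb_jF_neg hQ hp hn 0
  have v1 := wr_jFb_neg_jG hQ hr 0
  have v2 := wr_jFb_jG hQ hp 0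
  rw [neg_neg] at w11
  have expand : ∀ Z Z' : ℝ → Mat m, wr Z Z' (jG Q r) (jG' Q r) 0 =
      wr Z Z' (jF Q r) (jF' Q r) 0 * A + wr Z Z' (jF Q (-r)) (jF' Q (-r)) 0 * B := fun Z Z' => by
    simp only [wr, h, h', sub_mul, mul_add, mul_assoc]
    abel
  rw [expand, w11, w12, zero_mul, add_zero, smul_mul_assoc, one_mul] at v1
  rw [expand, w21, w22, zero_mul, zero_add, smul_mul_assoc, one_mul] at v2
  exact ⟨smul_right_injective _ (two_I_mul_ne hn.2) v1, smul_right_injective _ (two_I_mul_ne hp.2) v2⟩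

theorem jFb_real (r : ℝ) (x : ℝ) : jFb Q r x = star (jF Q (-r) x) ∧ jFb' Q r x = star (jF' Q (-r) x) := by
  simp [jFb, jFb']

theorem jFb_neg_real (r : ℝ) (x : ℝ) :
    jFb Q (-r) x = star (jF Q r x) ∧ jFb' Q (-r) x = star (jF' Q r x) := by
  simp [jFb, jFb']

/-- `D^* D = 1 + C^* C`. -/
theorem star_jD_mul_jD (hQ : SelfAdjointPotential Q) {r : ℝ} (hr : r ≠ 0) :
    star (jD Q r) * jD Q r = 1 + star (jC Q r) * jC Q r := by
  have hp := real_mem_upperSet hr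
  have hn := neg_real_mem_upperSet hr
  have w11 := wr_jFb_jF_neg hQ hn (by simpa using hp) 0
  have w12 := wr_jFb_jF_self hQ hn 0
  have w21 := wr_jFb_jF_self hQ hp 0
  have w22 := wr_jFb_jF_neg hQ hp hn 0
  -- The Wronskian of F_-* with F_- is known from the reflected potential, up to the sign of the
  -- derivative. Expanding it through C and D gives the identity.
  have v := wr_jFb_jF_neg hQ.comp_neg hn (by simpa using hp) 0
  rw [neg_neg] at w11 v
  simp only [wr, (jFb_real r 0).1, (jFb_real r 0).2, (jFb_neg_real r 0).1, (jFb_neg_real r 0).2]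
    at w11 w12 w21 w22 v
  obtain ⟨e1, e2⟩ := jG_eq hQ hr 0
  have v' : star (jG' Q r 0) * jG Q r 0 - star (jG Q r 0) * jG' Q r 0 =
      -((2 * Complex.I * -(r : ℂ)) • 1) := by
    rw [← v, jG, jG', neg_zero, star_neg]
    noncomm_ring
  rw [e1, e2] at v'
  set F1 := jF Q r 0
  set F2 := jF Q (-r) 0
  set F1' := jF' Q r 0
  set F2' := jF' Q (-r) 0
  set C := jC Q r
  set D := jD Q r
  have e : star (F1' * C + F2' * D) * (F1 * C + F2 * D) - star (F1 * C + F2 * D) * (F1' * C + F2' * D)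
      = star C * (star F1' * F1 - star F1 * F1') * C + star C * (star F1' * F2 - star F1 * F2') * D +
        star D * (star F2' * F1 - star F2 * F1') * C + star D * (star F2' * F2 - star F2 * F2') * D := by
    simp only [star_add, star_mul]
    noncomm_ring
  rw [e, w11, w12, w21, w22] at v'
  simp only [mul_zero, zero_mul, add_zero, mul_smul_comm, smul_mul_assoc, mul_one, mul_neg,
    neg_smul, neg_neg] at v'
  rw [neg_mul, smul_mul_assoc, neg_add_eq_iff_eq_add, ← smul_add] at v'
  have := smul_right_injective _ (two_I_mul_ne hp.2) v'
  rw [this, add_comm]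

theorem vn_jD (hQ : SelfAdjointPotential Q) {r : ℝ} (hr : r ≠ 0) (v : Fin m → ℂ) :
    vn (jD Q r *ᵥ v) ^ 2 = vn v ^ 2 + vn (jC Q r *ᵥ v) ^ 2 := by
  have h := congrArg (quad v) (star_jD_mul_jD hQ hr)
  rw [map_add, quad_star_mul, quad_star_mul, quad_apply, Matrix.one_mulVec] at h
  have := congrArg Complex.re h
  rwa [Complex.add_re, dot_re_self, dot_re_self, dot_re_self] at this

theorem isUnit_jD_real (hQ : SelfAdjointPotential Q) {r : ℝ} (hr : r ≠ 0) : IsUnit (jD Q r) := by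
  refine (isUnit_and_norm_inv_le zero_le_one fun v => ?_).1
  rw [one_mul]
  refine abs_le_of_sq_le_sq' ?_ (vn_nonneg _) |>.2
  rw [vn_jD hQ hr]
  nlinarith [sq_nonneg (vn (jC Q r *ᵥ v))]

/-- The scattering matrix is a contraction. -/
theorem norm_jC_mul_inv_le (hQ : SelfAdjointPotential Q) {r : ℝ} (hr : r ≠ 0) :
    ‖jC Q r * (jD Q r)⁻¹‖ ≤ 1 := by
  rw [Matrix.l2_opNorm_def]
  refine ContinuousLinearMap.opNorm_le_bound _ zero_le_one fun x => ?_
  have h1 := vn_jD hQ hr ((jD Q r)⁻¹ *ᵥ x.ofLp)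
  rw [Matrix.mulVec_mulVec, Matrix.mul_nonsing_inv _ ((Matrix.isUnit_iff_isUnit_det _).1
    (isUnit_jD_real hQ hr)), Matrix.one_mulVec, Matrix.mulVec_mulVec] at h1
  rw [one_mul]
  change vn ((jC Q r * (jD Q r)⁻¹) *ᵥ x.ofLp) ≤ vn x.ofLp
  refine abs_le_of_sq_le_sq' ?_ (vn_nonneg _) |>.2
  nlinarith [sq_nonneg (vn ((jD Q r)⁻¹ *ᵥ x.ofLp))]

end MatrixScattering
end

/-! ### A residue theorem for the upper half plane -/

noncomputable section
set_option linter.unusedSectionVars false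

namespace MatrixScattering

open Set

section Residue

/-- Cauchy's theorem on the rectangle with base [-R, R] and height R: the three other sides
contribute O(1/R). -/
theorem integral_real_eq_zero {f : ℂ → ℂ} (hd : ∀ z : ℂ, 0 ≤ z.im → DifferentiableAt ℂ f z)
    (hi : Integrable fun x : ℝ => f x) {C R₀ : ℝ}
    (hb : ∀ z : ℂ, 0 ≤ z.im → R₀ ≤ ‖z‖ → ‖f z‖ ≤ C / ‖z‖ ^ 2) : ∫ x : ℝ, f x = 0 := by
  have h1 := intervalIntegral_tendsto_integral hi tendsto_neg_atTop_atBot tendsto_id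
  have key : ∀ R : ℝ, max R₀ 1 ≤ R → ‖∫ x : ℝ in (-R)..R, f x‖ ≤ 4 * |C| / R := by
    intro R hR
    have hR0 : R₀ ≤ R := (le_max_left _ _).trans hR
    have hR1 : 1 ≤ R := (le_max_right _ _).trans hR
    have hRpos : 0 < R := by linarith
    have h2 := Complex.integral_boundary_rect_eq_zero_of_differentiableOn f (⟨-R, 0⟩ : ℂ) (⟨R, R⟩ : ℂ)
      (fun z hz => (hd z (by
        have := hz.2
        simp only [mem_preimage, uIcc_of_le hRpos.le] at this
        exact this.1)).differentiableWithinAt)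
    simp only at h2
    have hbound : ∀ z : ℂ, 0 ≤ z.im → R ≤ ‖z‖ → ‖f z‖ ≤ |C| / R ^ 2 := fun z h0 hz => by
      refine (hb z h0 (hR0.trans hz)).trans ?_
      have : C ≤ |C| := le_abs_self C
      gcongr
    have e1 : ‖∫ x : ℝ in (-R)..R, f (x + (R : ℂ) * Complex.I)‖ ≤ |C| / R ^ 2 * |R - -R| := by
      refine intervalIntegral.norm_integral_le_of_norm_le_const fun x _ => ?_
      refine hbound _ (by simpa using hRpos.le) ?_
      have := Complex.abs_im_le_norm (x + (R : ℂ) * Complex.I)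
      simpa [abs_of_pos hRpos] using this
    have e2 : ∀ s : ℝ, |s| = R → ‖∫ y : ℝ in (0 : ℝ)..R, f ((s : ℂ) + y * Complex.I)‖ ≤
        |C| / R ^ 2 * |R - 0| := by
      intro s hs
      refine intervalIntegral.norm_integral_le_of_norm_le_const fun y hy => ?_
      rw [uIoc_of_le hRpos.le] at hy
      refine hbound _ (by simpa using hy.1.le) ?_
      have := Complex.abs_re_le_norm ((s : ℂ) + y * Complex.I)
      simpa [hs] using this
    have e3 := e2 R (abs_of_pos hRpos)
    have e4 := e2 (-R) (by rw [abs_neg, abs_of_pos hRpos])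
    have h3 : ∫ x : ℝ in (-R)..R, f x = (∫ x : ℝ in (-R)..R, f (x + (R : ℂ) * Complex.I)) -
        Complex.I * (∫ y : ℝ in (0 : ℝ)..R, f ((R : ℂ) + y * Complex.I)) +
        Complex.I * (∫ y : ℝ in (0 : ℝ)..R, f (((-R : ℝ) : ℂ) + y * Complex.I)) := by
      simp only [Complex.ofReal_zero, zero_mul, add_zero, smul_eq_mul] at h2
      linear_combination h2
    rw [h3]
    refine (norm_add_le _ _).trans ((add_le_add (norm_sub_le _ _) le_rfl).trans ?_)
    rw [norm_mul, norm_mul, Complex.norm_I, one_mul, one_mul]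
    rw [sub_neg_eq_add, abs_of_pos (by linarith : 0 < R + R)] at e1
    rw [sub_zero, abs_of_pos hRpos] at e3 e4
    have e5 : |C| / R ^ 2 * (R + R) = 2 * |C| / R := by field_simp; ring
    have e6 : |C| / R ^ 2 * R = |C| / R := by field_simp
    rw [e5] at e1
    rw [e6] at e3 e4
    calc _ ≤ 2 * |C| / R + |C| / R + |C| / R := add_le_add (add_le_add e1 e3) e4
      _ = _ := by ring
  have h2 : Tendsto (fun R : ℝ => ∫ x : ℝ in (-R)..R, f x) atTop (𝓝 0) := by
    rw [tendsto_zero_iff_norm_tendsto_zero]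
    refine squeeze_zero' (Eventually.of_forall fun _ => norm_nonneg _) ?_
      (tendsto_const_nhds.div_atTop tendsto_id : Tendsto (fun R : ℝ => 4 * |C| / R) atTop (𝓝 0))
    filter_upwards [eventually_ge_atTop (max R₀ 1)] with R hR using key R hR
  exact tendsto_nhds_unique h1 h2

/-- The function `1/(z - p) - 1/(z - conj p)`. -/
def poissonPole (p z : ℂ) : ℂ := (p - starRingEnd ℂ p) / ((z - p) * (z - starRingEnd ℂ p))

/-- On the real axis the pole with its reflection subtracted is a multiple of a Poisson kernel. It
decays like |z|⁻² and has no other singularity in the closed upper half plane, so poles can be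
removed one at a time while the hypotheses persist. -/
theorem poissonPole_real {p : ℂ} (hp : 0 < p.im) (x : ℝ) :
    poissonPole p x = (2 * Complex.I / p.im) * ((1 + ((x - p.re) / p.im) ^ 2)⁻¹ : ℝ) := by
  have h1 : ((x : ℂ) - p) * (x - starRingEnd ℂ p) = (((x - p.re) ^ 2 + p.im ^ 2 : ℝ) : ℂ) := by
    apply Complex.ext <;> simp [sq]; ring
  have h2 : p - starRingEnd ℂ p = 2 * Complex.I * p.im := by
    apply Complex.ext <;> simp
    ring
  have h3 : (1 + ((x - p.re) / p.im) ^ 2)⁻¹ = p.im ^ 2 / ((x - p.re) ^ 2 + p.im ^ 2) := by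
    have : 0 < (x - p.re) ^ 2 + p.im ^ 2 := by positivity
    field_simp
    ring
  rw [poissonPole, h1, h2, h3]
  have : (p.im : ℂ) ≠ 0 := by exact_mod_cast hp.ne'
  rw [Complex.ofReal_div]
  push_cast
  field_simp

theorem integrable_poissonPole {p : ℂ} (hp : 0 < p.im) :
    Integrable (fun x : ℝ => poissonPole p x) ∧
      ∫ x : ℝ, poissonPole p x = 2 * Real.pi * Complex.I := by
  have h1 : Integrable fun x : ℝ => (1 + ((x - p.re) / p.im) ^ 2)⁻¹ := by
    have := (integrable_inv_one_add_sq.comp_div hp.ne').comp_sub_right p.re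
    exact this
  have h2 : ∫ x : ℝ, (1 + ((x - p.re) / p.im) ^ 2)⁻¹ = p.im * Real.pi := by
    rw [integral_sub_right_eq_self (fun x : ℝ => (1 + (x / p.im) ^ 2)⁻¹) p.re,
      Measure.integral_comp_div (fun x : ℝ => (1 + x ^ 2)⁻¹), integral_univ_inv_one_add_sq,
      abs_of_pos hp, smul_eq_mul]
  have h3 : (fun x : ℝ => poissonPole p x) = fun x : ℝ =>
      (2 * Complex.I / p.im) * ((1 + ((x - p.re) / p.im) ^ 2)⁻¹ : ℝ) :=
    funext (poissonPole_real hp)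
  rw [h3]
  refine ⟨h1.ofReal.const_mul _, ?_⟩
  rw [integral_const_mul, integral_complex_ofReal, h2]
  have : (p.im : ℂ) ≠ 0 := by exact_mod_cast hp.ne'
  push_cast
  field_simp

theorem differentiableAt_poissonPole {p z : ℂ} (h1 : z ≠ p) (h2 : z ≠ starRingEnd ℂ p) :
    DifferentiableAt ℂ (poissonPole p) z := by
  unfold poissonPole
  refine DifferentiableAt.div (by fun_prop) (by fun_prop) ?_
  exact mul_ne_zero (sub_ne_zero.2 h1) (sub_ne_zero.2 h2)

theorem norm_poissonPole_le {p z : ℂ} (hz : 2 * ‖p‖ ≤ ‖z‖) (hz0 : 0 < ‖z‖) :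
    ‖poissonPole p z‖ ≤ 8 * ‖p‖ / ‖z‖ ^ 2 := by
  have h1 : ‖z‖ / 2 ≤ ‖z - p‖ := by
    have := norm_sub_norm_le z p; linarith
  have h2 : ‖z‖ / 2 ≤ ‖z - starRingEnd ℂ p‖ := by
    have := norm_sub_norm_le z (starRingEnd ℂ p)
    rw [RCLike.norm_conj] at this; linarith
  have h3 : ‖p - starRingEnd ℂ p‖ ≤ 2 * ‖p‖ := by
    have := norm_sub_le p (starRingEnd ℂ p)
    rw [RCLike.norm_conj] at this; linarith
  rw [poissonPole, norm_div, norm_mul]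
  calc _ ≤ 2 * ‖p‖ / (‖z‖ / 2 * (‖z‖ / 2)) := by gcongr
    _ = _ := by field_simp; ring

/-- The residue theorem for the upper half plane and functions with simple poles. -/
theorem integral_real_eq_sum_residues (P : Finset ℂ) (c : ℂ → ℂ) : ∀ {f : ℂ → ℂ},
    (∀ p ∈ P, 0 < p.im) → (∀ z : ℂ, 0 ≤ z.im → z ∉ P → DifferentiableAt ℂ f z) →
    (Integrable fun x : ℝ => f x) →
    (∀ p ∈ P, Tendsto (fun z => (z - p) * f z) (𝓝[≠] p) (𝓝 (c p))) →
    (∃ C R₀ : ℝ, ∀ z : ℂ, 0 ≤ z.im → R₀ ≤ ‖z‖ → ‖f z‖ ≤ C / ‖z‖ ^ 2) →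
    ∫ x : ℝ, f x = 2 * Real.pi * Complex.I * ∑ p ∈ P, c p := by
  induction P using Finset.induction_on with
  | empty =>
    intro f _ hd hi _ ⟨C, R₀, hb⟩
    rw [Finset.sum_empty, mul_zero]
    exact integral_real_eq_zero (fun z hz => hd z hz (by simp)) hi hb
  | insert p P hpP ih =>
    intro f hP hd hi hres ⟨C, R₀, hb⟩
    have hp : 0 < p.im := hP p (Finset.mem_insert_self _ _)
    have hpc : p ≠ starRingEnd ℂ p := fun h => by
      have := congrArg Complex.im h
      simp at this; linarith
    have him : ∀ z : ℂ, 0 ≤ z.im → z ≠ starRingEnd ℂ p := fun z hz h => by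
      rw [h, Complex.conj_im] at hz; linarith
    obtain ⟨hφi, hφ⟩ := integrable_poissonPole hp
    -- Subtracting the pole at `p` leaves a removable singularity there. The induction hypothesis is
    -- applied to the extension across `p`, which agrees with `F` on the real axis.
    set F : ℂ → ℂ := fun z => f z - c p * poissonPole p z
    have hFd : ∀ z : ℂ, 0 ≤ z.im → z ∉ P → z ≠ p → DifferentiableAt ℂ F z := fun z hz h1 h2 =>
      (hd z hz (by simp [h1, h2])).sub ((differentiableAt_poissonPole h2 (him z hz)).const_mul _)
    have hFres : Tendsto (fun z => (z - p) * F z) (𝓝[≠] p) (𝓝 0) := by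
      have h1 := hres p (Finset.mem_insert_self _ _)
      have h2 : Tendsto (fun z => c p * ((p - starRingEnd ℂ p) / (z - starRingEnd ℂ p))) (𝓝[≠] p)
          (𝓝 (c p * 1)) := by
        refine Tendsto.mono_left ?_ nhdsWithin_le_nhds
        have hne := sub_ne_zero.2 hpc
        have : ContinuousAt (fun z => c p * ((p - starRingEnd ℂ p) / (z - starRingEnd ℂ p))) p :=
          ContinuousAt.mul continuousAt_const (ContinuousAt.div (by fun_prop) (by fun_prop) hne)
        have h3 := this.tendsto
        rwa [div_self hne] at h3
      have h3 := h1.sub h2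
      rw [mul_one, sub_self] at h3
      refine h3.congr' ?_
      filter_upwards [self_mem_nhdsWithin] with z hz
      have hz' : z - p ≠ 0 := sub_ne_zero.2 hz
      simp only [F, poissonPole]
      rw [mul_sub]
      congr 1
      field_simp
    obtain ⟨U, hU, hUo, hUP, hUim⟩ : ∃ U : Set ℂ, p ∈ U ∧ IsOpen U ∧ (∀ z ∈ U, z ∉ P) ∧
        ∀ z ∈ U, 0 < z.im := by
      refine ⟨{z | 0 < z.im} \ (P : Set ℂ), ⟨hp, by simpa using hpP⟩,
        isOpen_im_pos.sdiff P.finite_toSet.isClosed, fun z hz => by simpa using hz.2, fun z hz => hz.1⟩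
    set L := limUnder (𝓝[≠] p) F
    have hupd : DifferentiableOn ℂ (Function.update F p L) U := by
      refine Complex.differentiableOn_update_limUnder_of_isLittleO (hUo.mem_nhds hU)
        (fun z hz => (hFd z (hUim z hz.1).le (hUP z hz.1) hz.2).differentiableWithinAt) ?_
      rw [Asymptotics.isLittleO_iff_tendsto']
      · have h4 : Tendsto (fun z => (z - p) * F p) (𝓝[≠] p) (𝓝 0) := by
          refine Tendsto.mono_left ?_ nhdsWithin_le_nhds
          exact (by fun_prop : Continuous fun z => (z - p) * F p).tendsto' p 0 (by simp)
        have h5 := hFres.sub h4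
        rw [sub_zero] at h5
        refine h5.congr fun z => ?_
        rw [div_inv_eq_mul]; ring
      · filter_upwards [self_mem_nhdsWithin] with z hz h
        exact absurd (inv_eq_zero.1 h) (sub_ne_zero.2 hz)
    have hne : ∀ z : ℂ, z ≠ p → Function.update F p L =ᶠ[𝓝 z] F := fun z hz => by
      filter_upwards [isOpen_ne.mem_nhds hz] with w hw
      exact Function.update_of_ne hw _ _
    have hreal : ∀ x : ℝ, Function.update F p L x = F x := fun x =>
      Function.update_of_ne (fun h => by rw [← h] at hp; simp at hp) _ _
    have h6 := ih (f := Function.update F p L)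
      (fun p' hp' => hP p' (Finset.mem_insert_of_mem hp'))
      (fun z hz hzP => by
        rcases eq_or_ne z p with rfl | h
        · exact hupd.differentiableAt (hUo.mem_nhds hU)
        · exact (hne z h).differentiableAt_iff.2 (hFd z hz hzP h))
      (by simp only [hreal]; exact hi.sub (hφi.const_mul _))
      (fun p' hp' => by
        have hpp : p' ≠ p := fun h => hpP (h ▸ hp')
        have h7 := hres p' (Finset.mem_insert_of_mem hp')
        have h8 : Tendsto (fun z => (z - p') * (c p * poissonPole p z)) (𝓝[≠] p') (𝓝 0) := by
          refine Tendsto.mono_left ?_ nhdsWithin_le_nhds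
          have : ContinuousAt (fun z => (z - p') * (c p * poissonPole p z)) p' :=
            ContinuousAt.mul (by fun_prop) (continuousAt_const.mul
              (differentiableAt_poissonPole hpp
                (him p' (hP p' (Finset.mem_insert_of_mem hp')).le)).continuousAt)
          have h3 := this.tendsto
          simpa using h3
        have h9 := h7.sub h8
        rw [sub_zero] at h9
        refine h9.congr' ?_
        filter_upwards [nhdsWithin_le_nhds (hne p' hpp)] with z hz
        rw [hz]; simp only [F]; ring)
      ⟨|C| + ‖c p‖ * (8 * ‖p‖), max R₀ (2 * ‖p‖ + 1), fun z hz0 hz => by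
        have h1 : R₀ ≤ ‖z‖ := (le_max_left _ _).trans hz
        have h2 : 2 * ‖p‖ + 1 ≤ ‖z‖ := (le_max_right _ _).trans hz
        have h3 : z ≠ p := fun h => by rw [h] at h2; linarith [norm_nonneg p]
        have hn := norm_nonneg p
        rw [Function.update_of_ne h3, add_div]
        refine (norm_sub_le _ _).trans (add_le_add ((hb z hz0 h1).trans ?_) ?_)
        · have := le_abs_self C
          gcongr
        · rw [norm_mul, mul_div_assoc]
          gcongr
          exact norm_poissonPole_le (by linarith) (by linarith)⟩
    simp only [hreal, F] at h6
    rw [integral_sub hi (hφi.const_mul _), integral_const_mul, hφ] at h6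
    rw [Finset.sum_insert hpP]
    linear_combination h6

end Residue

end MatrixScattering
end

/-! ### Weyl solutions, their differences and the damping factor -/

noncomputable section
set_option linter.unusedSectionVars false

namespace MatrixScattering

open Set
open scoped Matrix.Norms.L2Operator Matrix

variable {m : ℕ} {Q : ℝ → Mat m}

/-- The determinant is analytic and does not vanish identically near ρ₀, being nonzero along the
horizontal ray. -/
theorem eventually_isUnit_jD (hQ : SelfAdjointPotential Q) {ρ₀ : ℂ} (h0 : 0 < ρ₀.im) :
    ∀ᶠ ρ in 𝓝[≠] ρ₀, IsUnit (jD Q ρ) := by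
  have h1 : AnalyticAt ℂ (fun ρ => (jD Q ρ).det) ρ₀ :=
    DifferentiableOn.analyticAt (s := {ρ : ℂ | 0 < ρ.im})
      (fun ρ hρ => (differentiableAt_det ((differentiableOn_jD hQ.toFirstMoment).differentiableAt
        (isOpen_im_pos.mem_nhds hρ))).differentiableWithinAt)
      (isOpen_im_pos.mem_nhds h0)
  rcases h1.eventually_eq_zero_or_eventually_ne_zero with h | h
  · obtain ⟨s, hs1, hs2⟩ := (((tendsto_ray ρ₀).eventually (nhdsWithin_le_nhds h)).and
      (eventually_ray_isUnit hQ h0)).exists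
    exact absurd hs1 ((Matrix.isUnit_iff_isUnit_det _).1 hs2).ne_zero
  · filter_upwards [h] with ρ hρ
    exact (Matrix.isUnit_iff_isUnit_det _).2 hρ.isUnit

/-- `D(ρ)` is close to the identity for large `ρ`. -/
theorem exists_jD_sub_one_le (hQ : SelfAdjointPotential Q) :
    ∃ R, 1 ≤ R ∧ ∀ ρ ∈ upperSet, R ≤ ‖ρ‖ → ‖jD Q ρ - 1‖ ≤ 1 / 2 := by
  obtain ⟨C, hC0, hC⟩ := exists_jD_asymp hQ.toFirstMoment
  refine ⟨max 1 (2 * C), le_max_left _ _, fun ρ hρ hR => ?_⟩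
  have h1 := (le_max_left _ _).trans hR
  have h2 := (le_max_right _ _).trans hR
  refine (hC ρ hρ h1).trans ?_
  rw [div_le_iff₀ (by linarith)]
  linarith

/-- In a half-plane `Im ρ ≥ ε`, `D` is singular at finitely many points only. -/
theorem finite_singular (hQ : SelfAdjointPotential Q) {ε : ℝ} (hε : 0 < ε) :
    {ρ : ℂ | ε ≤ ρ.im ∧ ¬ IsUnit (jD Q ρ)}.Finite := by
  obtain ⟨R, -, hR⟩ := exists_jD_sub_one_le hQ
  by_contra hinf
  have hK : IsCompact ({ρ : ℂ | ε ≤ ρ.im} ∩ Metric.closedBall 0 R) :=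
    (isCompact_closedBall 0 R).inter_left (isClosed_le continuous_const Complex.continuous_im)
  obtain ⟨ρ₀, hρ₀, hacc⟩ := Set.Infinite.exists_accPt_of_subset_isCompact hinf hK fun ρ hρ => by
    refine ⟨hρ.1, ?_⟩
    rw [mem_closedBall_zero_iff]
    by_contra h
    exact hρ.2 (isUnit_of_norm_sub_one_le
      (hR ρ (mem_upperSet_of_pos (hε.trans_le hρ.1)) (not_le.1 h).le))
  obtain ⟨ρ, h1, h2⟩ := ((accPt_iff_frequently_nhdsNE.1 hacc).and_eventually
    (eventually_isUnit_jD hQ (hε.trans_le hρ₀.1))).exists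
  exact h1.2 h2

/-- `e^{iρx} F_-(x, ρ) D(ρ)⁻¹`. -/
def jH (Q : ℝ → Mat m) (x : ℝ) (ρ : ℂ) : Mat m := jostM (fun t => Q (-t)) ρ (-x) * (jD Q ρ)⁻¹

theorem jG_mul_inv (x : ℝ) (ρ : ℂ) :
    jG Q ρ x * (jD Q ρ)⁻¹ = Complex.exp (-(Complex.I * ρ * x)) • jH Q x ρ := by
  rw [jH, jG, jF, smul_mul_assoc]
  congr 2
  push_cast
  ring

theorem continuousWithinAt_jH (hQ : SelfAdjointPotential Q) (x : ℝ) {ρ : ℂ} (hρ : ρ ∈ upperSet)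
    (hu : IsUnit (jD Q ρ)) : ContinuousWithinAt (jH Q x) upperSet ρ := by
  have h1 := continuousOn_jostM hQ.comp_neg.toFirstMoment (-x) ρ hρ
  have h2 := continuousOn_jD hQ.toFirstMoment ρ hρ
  obtain ⟨u, hu⟩ := hu
  have h3 : ContinuousAt (Ring.inverse : Mat m → Mat m) (jD Q ρ) := by
    rw [← hu]; exact NormedRing.inverse_continuousAt u
  refine h1.mul ?_
  simp only [Matrix.nonsing_inv_eq_ringInverse]
  exact h3.comp_continuousWithinAt h2

theorem differentiableAt_jH (hQ : SelfAdjointPotential Q) (x : ℝ) {ρ : ℂ} (hρ : 0 < ρ.im)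
    (hu : IsUnit (jD Q ρ)) : DifferentiableAt ℂ (jH Q x) ρ := by
  have h1 := (differentiableOn_jostM hQ.comp_neg.toFirstMoment (-x)).differentiableAt
    (isOpen_im_pos.mem_nhds hρ)
  have h2 := (differentiableOn_jD hQ.toFirstMoment).differentiableAt (isOpen_im_pos.mem_nhds hρ)
  refine h1.mul ?_
  simp only [Matrix.nonsing_inv_eq_ringInverse]
  exact (differentiableAt_inverse hu).comp ρ h2

/-- The asymptotics of `jH` for large `ρ`. -/
theorem exists_jH_asymp (hQ : SelfAdjointPotential Q) :
    ∃ C R, 0 ≤ C ∧ 1 ≤ R ∧ ∀ ρ ∈ upperSet, R ≤ ‖ρ‖ → ∀ x, ‖jH Q x ρ - 1‖ ≤ C / ‖ρ‖ := by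
  obtain ⟨C1, hC10, hC1⟩ := exists_jD_asymp hQ.toFirstMoment
  obtain ⟨C2, hC20, hC2⟩ := exists_jostM_asymp hQ.comp_neg.toFirstMoment
  obtain ⟨R, hR1, hR⟩ := exists_jD_sub_one_le hQ
  refine ⟨(C2 + C1) * (2 * ‖(1 : Mat m)‖), R, by positivity, hR1, fun ρ hρ hn x => ?_⟩
  have h1 := hR ρ hρ hn
  have hu := (Matrix.isUnit_iff_isUnit_det _).1 (isUnit_of_norm_sub_one_le h1)
  have h2 := norm_ringInverse_le h1
  rw [← Matrix.nonsing_inv_eq_ringInverse] at h2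
  have h3 := hC1 ρ hρ (hR1.trans hn)
  have h4 := (hC2 ρ hρ (hR1.trans hn) (-x)).1
  have e : jH Q x ρ - 1 = ((jostM (fun t => Q (-t)) ρ (-x) - 1) - (jD Q ρ - 1)) * (jD Q ρ)⁻¹ := by
    rw [sub_sub_sub_cancel_right, sub_mul, Matrix.mul_nonsing_inv _ hu, jH]
  rw [e]
  refine (norm_mul_le _ _).trans ?_
  have h5 := (norm_sub_le (jostM (fun t => Q (-t)) ρ (-x) - 1) (jD Q ρ - 1)).trans (add_le_add h4 h3)
  rw [← add_div] at h5
  calc _ ≤ (C2 + C1) / ‖ρ‖ * (2 * ‖(1 : Mat m)‖) := by gcongr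
    _ = _ := by ring

theorem exists_norm_jostM_le (hQ : SelfAdjointPotential Q) (x : ℝ) :
    ∃ C, 0 ≤ C ∧ ∀ ρ ∈ upperSet, ‖jostM Q ρ x‖ ≤ C :=
  ⟨‖(1 : Mat m)‖ * Real.exp (∫ s in Ioi x, |s - x| * ‖Q s‖), by positivity, fun _ hρ =>
    norm_jostM_le (kernelBound_abs hQ.toFirstMoment hρ x) le_rfl⟩

theorem exists_norm_jH_le (hQ : SelfAdjointPotential Q) (x : ℝ) :
    ∃ C, 0 ≤ C ∧ ∀ ρ : ℂ, 0 < ρ.im → ρ.im ≤ 1 → ρ.re ≠ 0 → ‖jH Q x ρ‖ ≤ C * ‖ρ‖ / |ρ.re| := by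
  obtain ⟨C1, hC10, hC1⟩ := exists_norm_jD_inv_le hQ 1
  obtain ⟨C2, hC20, hC2⟩ := exists_norm_jostM_le hQ.comp_neg (-x)
  refine ⟨C2 * C1, by positivity, fun ρ h1 h2 h3 => ?_⟩
  refine (norm_mul_le _ _).trans ?_
  calc _ ≤ C2 * (C1 * ‖ρ‖ / |ρ.re|) :=
        mul_le_mul (hC2 ρ (mem_upperSet_of_pos h1)) (hC1 ρ h1 h2 h3).2 (norm_nonneg _) hC20
    _ = _ := by ring

/-- The scattering matrix enters the proof through this relation. It is affine in the Jost data, so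
for equal scattering matrices it passes to differences. -/
theorem jH_real (hQ : SelfAdjointPotential Q) (x : ℝ) {r : ℝ} (hr : r ≠ 0) :
    jH Q x r = Complex.exp (2 * Complex.I * r * x) • (jostM Q r x * (jC Q r * (jD Q r)⁻¹)) +
      jostM Q (-r) x := by
  have h1 := congrArg (· * (jD Q r)⁻¹) (jG_eq hQ hr x).1
  have hu := (Matrix.isUnit_iff_isUnit_det _).1 (isUnit_jD_real hQ hr)
  simp only [jG_mul_inv, add_mul, mul_assoc, Matrix.mul_nonsing_inv _ hu, mul_one, jF,
    smul_mul_assoc] at h1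
  have h2 := congrArg (Complex.exp (Complex.I * r * x) • ·) h1
  simp only [smul_add, smul_smul, ← Complex.exp_add] at h2
  have e0 : Complex.I * r * x + -(Complex.I * (r * x)) = 0 := by ring
  have e1 : Complex.I * r * x + Complex.I * (-r * x) = 0 := by ring
  have e2 : Complex.I * r * x + Complex.I * (r * x) = 2 * Complex.I * r * x := by ring
  rwa [e0, e1, e2, Complex.exp_zero, one_smul, one_smul] at h2

section Difference

variable {Q₁ Q₂ : ℝ → Mat m}

/-- The difference of the reduced right Jost solutions. -/
def dG (Q₁ Q₂ : ℝ → Mat m) (x : ℝ) (ρ : ℂ) : Mat m := jostM Q₁ ρ x - jostM Q₂ ρ x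

/-- The difference of the reduced left Weyl solutions. -/
def dH (Q₁ Q₂ : ℝ → Mat m) (x : ℝ) (ρ : ℂ) : Mat m := jH Q₁ x ρ - jH Q₂ x ρ

theorem exists_norm_dG_le (h₁ : SelfAdjointPotential Q₁) (h₂ : SelfAdjointPotential Q₂) (x : ℝ) :
    ∃ C, 0 ≤ C ∧ ∀ ρ ∈ upperSet, ‖dG Q₁ Q₂ x ρ‖ ≤ C / (1 + ‖ρ‖) := by
  obtain ⟨C1, hC10, hC1⟩ := exists_norm_jostM_le h₁ x
  obtain ⟨C2, hC20, hC2⟩ := exists_norm_jostM_le h₂ x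
  obtain ⟨C3, hC30, hC3⟩ := exists_jostM_asymp h₁.toFirstMoment
  obtain ⟨C4, hC40, hC4⟩ := exists_jostM_asymp h₂.toFirstMoment
  refine ⟨2 * (C1 + C2 + C3 + C4), by positivity, fun ρ hρ => ?_⟩
  have hn := norm_nonneg ρ
  rw [le_div_iff₀ (by positivity)]
  rcases le_total ‖ρ‖ 1 with h | h
  · have := (norm_sub_le _ _).trans (add_le_add (hC1 ρ hρ) (hC2 ρ hρ))
    calc ‖dG Q₁ Q₂ x ρ‖ * (1 + ‖ρ‖) ≤ (C1 + C2) * 2 := by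
          gcongr; exact this; linarith
      _ ≤ _ := by linarith
  · have hpos : 0 < ‖ρ‖ := by linarith
    have := (norm_sub_le (jostM Q₁ ρ x - 1) (jostM Q₂ ρ x - 1)).trans
      (add_le_add (hC3 ρ hρ h x).1 (hC4 ρ hρ h x).1)
    rw [sub_sub_sub_cancel_right, ← add_div] at this
    calc ‖dG Q₁ Q₂ x ρ‖ * (1 + ‖ρ‖) ≤ (C3 + C4) / ‖ρ‖ * (2 * ‖ρ‖) := by
          gcongr; exact this; linarith
      _ = 2 * (C3 + C4) := by field_simp
      _ ≤ _ := by linarith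

theorem exists_dH_asymp (h₁ : SelfAdjointPotential Q₁) (h₂ : SelfAdjointPotential Q₂) (x : ℝ) :
    ∃ C R, 0 ≤ C ∧ 1 ≤ R ∧ ∀ ρ ∈ upperSet, R ≤ ‖ρ‖ → ‖dH Q₁ Q₂ x ρ‖ ≤ C / ‖ρ‖ := by
  obtain ⟨C1, R1, hC10, hR1, hC1⟩ := exists_jH_asymp h₁
  obtain ⟨C2, R2, hC20, hR2, hC2⟩ := exists_jH_asymp h₂
  refine ⟨C1 + C2, max R1 R2, by positivity, hR1.trans (le_max_left _ _), fun ρ hρ h => ?_⟩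
  have := (norm_sub_le (jH Q₁ x ρ - 1) (jH Q₂ x ρ - 1)).trans
    (add_le_add (hC1 ρ hρ ((le_max_left _ _).trans h) x) (hC2 ρ hρ ((le_max_right _ _).trans h) x))
  rwa [sub_sub_sub_cancel_right, ← add_div] at this

theorem exists_norm_dH_le (h₁ : SelfAdjointPotential Q₁) (h₂ : SelfAdjointPotential Q₂) (x : ℝ) :
    ∃ C, 0 ≤ C ∧ ∀ ρ : ℂ, 0 < ρ.im → ρ.im ≤ 1 → ρ.re ≠ 0 →
      ‖dH Q₁ Q₂ x ρ‖ ≤ C * ‖ρ‖ / |ρ.re| := by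
  obtain ⟨C1, hC10, hC1⟩ := exists_norm_jH_le h₁ x
  obtain ⟨C2, hC20, hC2⟩ := exists_norm_jH_le h₂ x
  refine ⟨C1 + C2, by positivity, fun ρ h1 h2 h3 => ?_⟩
  refine (norm_sub_le _ _).trans ((add_le_add (hC1 ρ h1 h2 h3) (hC2 ρ h1 h2 h3)).trans (le_of_eq ?_))
  ring

/-- The damping factor that removes the singularities of `D⁻¹` at the origin. -/
def damp (ε : ℝ) (ρ : ℂ) : ℂ := 1 + ε ^ 2 / ρ ^ 2

theorem norm_damp_le_two {ε : ℝ} {ρ : ℂ} (h : |ε| ≤ ‖ρ‖) : ‖damp ε ρ‖ ≤ 2 := by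
  refine (norm_add_le _ _).trans ?_
  rw [norm_one, norm_div, norm_pow, norm_pow, Complex.norm_real, Real.norm_eq_abs, ← div_pow]
  have : (|ε| / ‖ρ‖) ^ 2 ≤ 1 := pow_le_one₀ (by positivity) (div_le_one_of_le₀ h (norm_nonneg _))
  linarith

/-- The factor equals (ρ - iε)(ρ + iε)/ρ², and on this line ρ - iε is the real number Re ρ. Its zero
at iε thus absorbs the 1/|Re ρ| in the bound for D⁻¹. -/
theorem norm_damp_line {ε : ℝ} (hε : 0 < ε) {ρ : ℂ} (h : ρ.im = ε) :
    ‖damp ε ρ‖ ≤ 2 * |ρ.re| / ‖ρ‖ := by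
  have hρ : ρ ≠ 0 := fun h0 => by rw [h0] at h; simp at h; linarith
  have hε' : ε ≤ ‖ρ‖ := by
    have := Complex.abs_im_le_norm ρ
    rwa [h, abs_of_pos hε] at this
  have h1 : ρ - ε * Complex.I = ρ.re := by
    apply Complex.ext <;> simp [h]
  have h2 : damp ε ρ = ρ.re * (ρ + ε * Complex.I) / ρ ^ 2 := by
    rw [damp, ← h1]
    field_simp
    ring_nf
    rw [Complex.I_sq]
    ring
  have h3 : ‖ρ + ε * Complex.I‖ ≤ 2 * ‖ρ‖ := by
    refine (norm_add_le _ _).trans ?_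
    rw [norm_mul, Complex.norm_I, mul_one, Complex.norm_real, Real.norm_of_nonneg hε.le]
    linarith
  rw [h2, norm_div, norm_mul, norm_pow, Complex.norm_real, Real.norm_eq_abs]
  have hpos := norm_pos_iff.2 hρ
  calc _ ≤ |ρ.re| * (2 * ‖ρ‖) / ‖ρ‖ ^ 2 := by gcongr
    _ = _ := by field_simp

/-- The constant is the same for all heights Im ρ in (0, 1], including the neighbourhood of the
origin; this allows the line to descend to the real axis. -/
theorem exists_norm_damp_mul_dH_le (h₁ : SelfAdjointPotential Q₁) (h₂ : SelfAdjointPotential Q₂)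
    (x : ℝ) : ∃ C, 0 ≤ C ∧ ∀ ρ : ℂ, 0 < ρ.im → ρ.im ≤ 1 → ρ.re ≠ 0 →
      ‖damp ρ.im ρ‖ * ‖dH Q₁ Q₂ x ρ‖ ≤ C / (1 + ‖ρ‖) := by
  obtain ⟨C1, R, hC10, hR, hC1⟩ := exists_dH_asymp h₁ h₂ x
  obtain ⟨C2, hC20, hC2⟩ := exists_norm_dH_le h₁ h₂ x
  refine ⟨4 * C1 + 2 * C2 * (1 + R), by positivity, fun ρ hp hle hre => ?_⟩
  have hn := norm_nonneg ρ
  rw [le_div_iff₀ (by positivity)]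
  rcases le_total ‖ρ‖ R with h | h
  · have hpos : 0 < ‖ρ‖ := (abs_pos.2 hre).trans_le (Complex.abs_re_le_norm ρ)
    have hre' := abs_pos.2 hre
    calc _ ≤ (2 * |ρ.re| / ‖ρ‖) * (C2 * ‖ρ‖ / |ρ.re|) * (1 + R) := by
          gcongr
          · exact norm_damp_line hp rfl
          · exact hC2 ρ hp hle hre
      _ = 2 * C2 * (1 + R) := by field_simp
      _ ≤ _ := by linarith
  · have hpos : 0 < ‖ρ‖ := by linarith
    calc _ ≤ 2 * (C1 / ‖ρ‖) * (2 * ‖ρ‖) := by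
          gcongr
          · exact norm_damp_le_two (Complex.abs_im_le_norm ρ)
          · exact hC1 ρ (mem_upperSet_of_pos hp) h
          · linarith
      _ = 4 * C1 := by field_simp; ring
      _ ≤ _ := by
          have : 0 ≤ 2 * C2 * (1 + R) := by positivity
          linarith

end Difference

end MatrixScattering
end

/-! ### The contour integral of the pairing -/

noncomputable section
set_option linter.unusedSectionVars false

namespace MatrixScattering

open Set
open scoped Matrix.Norms.L2Operator Matrix

section Pairing

variable {m : ℕ} {Q Q₁ Q₂ : ℝ → Mat m}

theorem norm_quad_le (v : Fin m → ℂ) (M : Mat m) : ‖quad v M‖ ≤ vn v ^ 2 * ‖M‖ := by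
  rw [quad_apply]
  refine (norm_dot_le v _).trans ?_
  calc _ ≤ vn v * (‖M‖ * vn v) := mul_le_mul_of_nonneg_left (vn_mulVec_le M v) (vn_nonneg v)
    _ = _ := by ring

/-- The pairing of `dH` and the adjoint of `dG`. -/
def pairing (Q₁ Q₂ : ℝ → Mat m) (x : ℝ) (v : Fin m → ℂ) (ρ : ℂ) : ℂ :=
  quad v (dH Q₁ Q₂ x ρ * star (dG Q₁ Q₂ x (-(starRingEnd ℂ ρ))))

theorem norm_pairing_le (x : ℝ) (v : Fin m → ℂ) (ρ : ℂ) : ‖pairing Q₁ Q₂ x v ρ‖ ≤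
    vn v ^ 2 * (‖dH Q₁ Q₂ x ρ‖ * ‖dG Q₁ Q₂ x (-(starRingEnd ℂ ρ))‖) := by
  refine (norm_quad_le v _).trans (mul_le_mul_of_nonneg_left ?_ (by positivity))
  refine (norm_mul_le _ _).trans ?_
  rw [norm_star]

theorem star_dG_neg_conj (x : ℝ) (ρ : ℂ) :
    star (dG Q₁ Q₂ x (-(starRingEnd ℂ ρ))) = jMb Q₁ ρ x - jMb Q₂ ρ x := by
  rw [dG, star_sub, jMb, jMb]

theorem differentiableAt_pairing (h₁ : SelfAdjointPotential Q₁) (h₂ : SelfAdjointPotential Q₂)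
    (x : ℝ) (v : Fin m → ℂ) {ρ : ℂ} (hρ : 0 < ρ.im) (u₁ : IsUnit (jD Q₁ ρ)) (u₂ : IsUnit (jD Q₂ ρ)) :
    DifferentiableAt ℂ (pairing Q₁ Q₂ x v) ρ := by
  have hn := isOpen_im_pos.mem_nhds hρ
  have h1 := (differentiableAt_jH h₁ x hρ u₁).sub (differentiableAt_jH h₂ x hρ u₂)
  have h2 := ((differentiableOn_jMb h₁.toFirstMoment x).differentiableAt hn).sub
    ((differentiableOn_jMb h₂.toFirstMoment x).differentiableAt hn)
  have h3 := (quad v).differentiableAt.comp ρ (h1.mul h2)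
  refine h3.congr_of_eventuallyEq (Eventually.of_forall fun z => ?_)
  rw [pairing, star_dG_neg_conj]
  rfl

theorem continuousWithinAt_pairing (h₁ : SelfAdjointPotential Q₁) (h₂ : SelfAdjointPotential Q₂)
    (x : ℝ) (v : Fin m → ℂ) {r : ℝ} (hr : r ≠ 0) :
    ContinuousWithinAt (pairing Q₁ Q₂ x v) upperSet r := by
  have hp := real_mem_upperSet hr
  have h1 := (continuousWithinAt_jH h₁ x hp (isUnit_jD_real h₁ hr)).sub
    (continuousWithinAt_jH h₂ x hp (isUnit_jD_real h₂ hr))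
  have h2 : ContinuousOn (dG Q₁ Q₂ x) upperSet :=
    (continuousOn_jostM h₁.toFirstMoment x).sub (continuousOn_jostM h₂.toFirstMoment x)
  have h3 : ContinuousOn (fun ρ => star (dG Q₁ Q₂ x (-(starRingEnd ℂ ρ)))) upperSet :=
    (h2.comp (by fun_prop : Continuous fun ρ : ℂ => -(starRingEnd ℂ ρ)).continuousOn
      fun _ h => neg_conj_mem h).star
  exact (quad v).continuous.continuousAt.comp_continuousWithinAt (h1.mul (h3 _ hp))

/-- The weight relation expresses the residue through `jostM` and N. With a common N the residue of
`dH` becomes a multiple of `dG` times N. -/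
theorem tendsto_residue_jH (hQ : SelfAdjointPotential Q) (x : ℝ) {ρ₀ : ℂ} (h0 : 0 < ρ₀.im)
    {R N : Mat m} (hR : Tendsto (fun ρ => (ρ - ρ₀) • (jD Q ρ)⁻¹) (𝓝[≠] ρ₀) (𝓝 R))
    (hN : jG Q ρ₀ x * R = Complex.I • (jF Q ρ₀ x * N)) :
    Tendsto (fun ρ => (ρ - ρ₀) • jH Q x ρ) (𝓝[≠] ρ₀)
      (𝓝 ((Complex.I * Complex.exp (2 * Complex.I * ρ₀ * x)) • (jostM Q ρ₀ x * N))) := by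
  have h1 := ((differentiableOn_jostM hQ.comp_neg.toFirstMoment (-x)).differentiableAt
    (isOpen_im_pos.mem_nhds h0)).continuousAt.tendsto.mono_left
      (nhdsWithin_le_nhds (s := {ρ₀}ᶜ))
  have h2 := h1.mul hR
  have h3 := congrArg (Complex.exp (Complex.I * ρ₀ * x) • ·) hN
  simp only [jG, jF, smul_mul_assoc, smul_smul, ← Complex.exp_add] at h3
  have e1 : Complex.I * ρ₀ * x + Complex.I * ρ₀ * ((-x : ℝ) : ℂ) = 0 := by push_cast; ring
  have e2 : Complex.exp (Complex.I * ρ₀ * x) * (Complex.I * Complex.exp (Complex.I * ρ₀ * x)) =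
      Complex.I * Complex.exp (2 * Complex.I * ρ₀ * x) := by
    rw [mul_left_comm, ← Complex.exp_add]
    congr 2
    ring
  rw [e1, Complex.exp_zero, one_smul, ← mul_assoc, mul_assoc (Complex.exp _), e2] at h3
  rw [← h3]
  exact h2.congr fun ρ => by rw [jH, mul_smul_comm]

theorem quad_conj_star (v : Fin m → ℂ) (g N : Mat m) :
    quad v (g * N * star g) = quad (star g *ᵥ v) N := by
  have := quad_star_mul v (star g) (N * star g)
  rwa [star_star, ← mul_assoc, ← Matrix.mulVec_mulVec, ← quad_apply] at this

/-- The common discrete data of two potentials. -/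
def CommonWeights (Q₁ Q₂ : ℝ → Mat m) : Prop :=
  ∀ ρ₀ : ℂ, 0 < ρ₀.im → ¬ (IsUnit (jD Q₁ ρ₀) ∧ IsUnit (jD Q₂ ρ₀)) → ∃ R₁ R₂ N : Mat m,
    Tendsto (fun ρ => (ρ - ρ₀) • (jD Q₁ ρ)⁻¹) (𝓝[≠] ρ₀) (𝓝 R₁) ∧
    Tendsto (fun ρ => (ρ - ρ₀) • (jD Q₂ ρ)⁻¹) (𝓝[≠] ρ₀) (𝓝 R₂) ∧
    (∀ x, jG Q₁ ρ₀ x * R₁ = Complex.I • (jF Q₁ ρ₀ x * N)) ∧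
    (∀ x, jG Q₂ ρ₀ x * R₂ = Complex.I • (jF Q₂ ρ₀ x * N))

/-- At a singular point the residue is the damping factor times i e^{-2τx} v* g N g* v.
Multiplication by 2πi makes it real and nonpositive, because N ≥ 0. -/
theorem exists_residue_pairing (h₁ : SelfAdjointPotential Q₁) (h₂ : SelfAdjointPotential Q₂)
    (hW : CommonWeights Q₁ Q₂) (x : ℝ) (v : Fin m → ℂ) {ε : ℝ} (hε : 0 < ε) {ρ₀ : ℂ}
    (h0 : ε ≤ ρ₀.im) (hs : ¬ (IsUnit (jD Q₁ ρ₀) ∧ IsUnit (jD Q₂ ρ₀))) :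
    ∃ c : ℂ, Tendsto (fun ρ => (ρ - ρ₀) * (damp ε ρ * pairing Q₁ Q₂ x v ρ)) (𝓝[≠] ρ₀) (𝓝 c) ∧
      (2 * Real.pi * Complex.I * c).re ≤ 0 := by
  have h0' : 0 < ρ₀.im := hε.trans_le h0
  have hre : ρ₀.re = 0 := by
    by_contra h
    exact hs ⟨isUnit_jD_of_re_ne_zero h₁ h0' h, isUnit_jD_of_re_ne_zero h₂ h0' h⟩
  obtain ⟨R₁, R₂, N, hR₁, hR₂, hN₁, hN₂⟩ := hW ρ₀ h0' hs
  have hconj : -(starRingEnd ℂ ρ₀) = ρ₀ := by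
    apply Complex.ext <;> simp [hre]
  have hne : ρ₀ ≠ 0 := (mem_upperSet_of_pos h0').2
  have hn := isOpen_im_pos.mem_nhds h0'
  have t1 := (tendsto_residue_jH h₁ x h0' hR₁ (hN₁ x)).sub (tendsto_residue_jH h₂ x h0' hR₂ (hN₂ x))
  rw [← smul_sub, ← sub_mul] at t1
  have t2 : Tendsto (fun ρ => star (dG Q₁ Q₂ x (-(starRingEnd ℂ ρ)))) (𝓝[≠] ρ₀)
      (𝓝 (star (dG Q₁ Q₂ x ρ₀))) := by
    have h2 := (((differentiableOn_jMb h₁.toFirstMoment x).differentiableAt hn).sub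
      ((differentiableOn_jMb h₂.toFirstMoment x).differentiableAt hn)).continuousAt
    have h3 : (fun ρ => star (dG Q₁ Q₂ x (-(starRingEnd ℂ ρ)))) =
        (fun ρ => jMb Q₁ ρ x) - fun ρ => jMb Q₂ ρ x := funext fun ρ => star_dG_neg_conj x ρ
    rw [← h3] at h2
    have h4 := h2.tendsto.mono_left (nhdsWithin_le_nhds (s := {ρ₀}ᶜ))
    rwa [hconj] at h4
  have t3 : Tendsto (damp ε) (𝓝[≠] ρ₀) (𝓝 (damp ε ρ₀)) := by
    refine Tendsto.mono_left ?_ nhdsWithin_le_nhds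
    have : ContinuousAt (damp ε) ρ₀ := by
      unfold damp
      exact continuousAt_const.add (continuousAt_const.div (by fun_prop) (pow_ne_zero 2 hne))
    exact this.tendsto
  have t4 := t3.mul (((quad v).continuous.tendsto _).comp (t1.mul t2))
  refine ⟨_, t4.congr fun ρ => ?_, ?_⟩
  · simp only [Function.comp_apply, pairing, dH]
    rw [← smul_sub, smul_mul_assoc, map_smul, smul_eq_mul]
    ring
  · change (2 * Real.pi * Complex.I * (damp ε ρ₀ * quad v (_ • (dG Q₁ Q₂ x ρ₀ * N) *
      star (dG Q₁ Q₂ x ρ₀)))).re ≤ 0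
    rw [smul_mul_assoc, map_smul, quad_conj_star, smul_eq_mul]
    have hq := weight_nonneg h₁ h0' hre hR₁ hN₁ (star (dG Q₁ Q₂ x ρ₀) *ᵥ v)
    set q := quad (star (dG Q₁ Q₂ x ρ₀) *ᵥ v) N
    have hτ : ρ₀ = ρ₀.im * Complex.I := by apply Complex.ext <;> simp [hre]
    have e1 : Complex.exp (2 * Complex.I * ρ₀ * x) = (Real.exp (-(2 * ρ₀.im * x)) : ℂ) := by
      rw [hτ, Complex.ofReal_exp]
      congr 1
      push_cast
      simp only [Complex.mul_im, Complex.ofReal_re, Complex.I_im, mul_one, Complex.ofReal_im,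
        Complex.I_re, mul_zero, add_zero]
      linear_combination (2 * (ρ₀.im : ℂ) * x) * Complex.I_sq
    have e2 : damp ε ρ₀ = ((1 - ε ^ 2 / ρ₀.im ^ 2 : ℝ) : ℂ) := by
      have : ρ₀ ^ 2 = -((ρ₀.im : ℂ) ^ 2) := by
        rw [hτ, mul_pow, Complex.I_sq]; simp
      rw [damp, this]
      push_cast
      rw [div_neg, sub_eq_add_neg]
    -- The damping factor keeps the sign exactly for poles on or above the line Im ρ = ε.
    have h5 : 0 ≤ 1 - ε ^ 2 / ρ₀.im ^ 2 := by
      rw [sub_nonneg, ← div_pow]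
      exact pow_le_one₀ (by positivity) (div_le_one_of_le₀ h0 h0'.le)
    have e3 : 2 * (Real.pi : ℂ) * Complex.I * (damp ε ρ₀ *
        (Complex.I * Complex.exp (2 * Complex.I * ρ₀ * x) * q)) =
        ((-(2 * Real.pi * (1 - ε ^ 2 / ρ₀.im ^ 2) * Real.exp (-(2 * ρ₀.im * x))) : ℝ) : ℂ) * q := by
      rw [e1, e2]
      push_cast
      linear_combination (2 * (Real.pi : ℂ) * (1 - (ε : ℂ) ^ 2 / (ρ₀.im : ℂ) ^ 2) *
        Complex.exp (-(2 * ρ₀.im * x)) * q) * Complex.I_sq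
    rw [e3, Complex.re_ofReal_mul, neg_mul]
    have := Real.pi_pos
    have := mul_nonneg (by positivity :
      0 ≤ 2 * Real.pi * (1 - ε ^ 2 / ρ₀.im ^ 2) * Real.exp (-(2 * ρ₀.im * x))) hq
    linarith

/-- The damped pairing on the line `Im ρ = ε`. -/
def pairingLine (Q₁ Q₂ : ℝ → Mat m) (x : ℝ) (v : Fin m → ℂ) (ε : ℝ) (z : ℂ) : ℂ :=
  damp ε (z + ε * Complex.I) * pairing Q₁ Q₂ x v (z + ε * Complex.I)

/-- Both factors, damped `dH` and `dG`, are O(1/(1 + |ρ|)) with constants independent of ε. The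
product is an integrable majorant for the limit ε → 0. -/
theorem exists_norm_pairingLine_le (h₁ : SelfAdjointPotential Q₁) (h₂ : SelfAdjointPotential Q₂)
    (x : ℝ) (v : Fin m → ℂ) : ∃ B, ∀ ε : ℝ, 0 < ε → ε ≤ 1 → ∀ s : ℝ, s ≠ 0 →
      ‖pairingLine Q₁ Q₂ x v ε s‖ ≤ B * (1 + s ^ 2)⁻¹ := by
  obtain ⟨C1, hC10, hC1⟩ := exists_norm_damp_mul_dH_le h₁ h₂ x
  obtain ⟨C2, hC20, hC2⟩ := exists_norm_dG_le h₁ h₂ x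
  refine ⟨vn v ^ 2 * (C1 * C2), fun ε hε hε1 s hs => ?_⟩
  set ρ : ℂ := s + ε * Complex.I
  have him : ρ.im = ε := by simp [ρ]
  have hre : ρ.re = s := by simp [ρ]
  have hpos : 0 < ρ.im := by rw [him]; exact hε
  have b1 := hC1 ρ hpos (by rw [him]; exact hε1) (by rw [hre]; exact hs)
  have b2 := hC2 _ (neg_conj_mem (mem_upperSet_of_pos hpos))
  rw [norm_neg, RCLike.norm_conj] at b2
  rw [him] at b1
  have hn := norm_nonneg ρ
  have h3 : (1 + s ^ 2) ≤ (1 + ‖ρ‖) * (1 + ‖ρ‖) := by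
    have := Complex.abs_re_le_norm ρ
    rw [hre] at this
    have h4 : |s| ^ 2 ≤ ‖ρ‖ ^ 2 := pow_le_pow_left₀ (abs_nonneg s) this 2
    rw [sq_abs] at h4
    nlinarith
  rw [pairingLine, norm_mul]
  calc ‖damp ε ρ‖ * ‖pairing Q₁ Q₂ x v ρ‖
      ≤ ‖damp ε ρ‖ * (vn v ^ 2 * (‖dH Q₁ Q₂ x ρ‖ * ‖dG Q₁ Q₂ x (-(starRingEnd ℂ ρ))‖)) :=
        mul_le_mul_of_nonneg_left (norm_pairing_le x v ρ) (norm_nonneg _)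
    _ = vn v ^ 2 * ((‖damp ε ρ‖ * ‖dH Q₁ Q₂ x ρ‖) * ‖dG Q₁ Q₂ x (-(starRingEnd ℂ ρ))‖) := by ring
    _ ≤ vn v ^ 2 * ((C1 / (1 + ‖ρ‖)) * (C2 / (1 + ‖ρ‖))) := by gcongr
    _ = vn v ^ 2 * (C1 * C2) * ((1 + ‖ρ‖) * (1 + ‖ρ‖))⁻¹ := by
        field_simp
    _ ≤ _ := by gcongr

theorem exists_pairingLine_decay (h₁ : SelfAdjointPotential Q₁) (h₂ : SelfAdjointPotential Q₂)
    (x : ℝ) (v : Fin m → ℂ) {ε : ℝ} (hε : 0 < ε) : ∃ C R₀ : ℝ, ∀ z : ℂ, 0 ≤ z.im → R₀ ≤ ‖z‖ →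
      ‖pairingLine Q₁ Q₂ x v ε z‖ ≤ C / ‖z‖ ^ 2 := by
  obtain ⟨C1, R, hC10, hR, hC1⟩ := exists_dH_asymp h₁ h₂ x
  obtain ⟨C2, hC20, hC2⟩ := exists_norm_dG_le h₁ h₂ x
  refine ⟨2 * (vn v ^ 2 * (C1 * C2)), R, fun z hz hzR => ?_⟩
  set ρ : ℂ := z + ε * Complex.I
  have him : ρ.im = z.im + ε := by simp [ρ]
  have hre : ρ.re = z.re := by simp [ρ]
  have hpos : 0 < ρ.im := by rw [him]; linarith
  have hz0 : 0 < ‖z‖ := by linarith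
  have hzρ : ‖z‖ ≤ ‖ρ‖ := by
    rw [Complex.norm_def, Complex.norm_def, Complex.normSq_apply, Complex.normSq_apply, hre, him]
    refine Real.sqrt_le_sqrt ?_
    nlinarith
  have hρ0 : 0 < ‖ρ‖ := hz0.trans_le hzρ
  have hmem := mem_upperSet_of_pos hpos
  have b1 := hC1 ρ hmem (hzR.trans hzρ)
  have b2 := hC2 _ (neg_conj_mem hmem)
  rw [norm_neg, RCLike.norm_conj] at b2
  have b3 : ‖damp ε ρ‖ ≤ 2 := norm_damp_le_two (by
    have := Complex.abs_im_le_norm ρ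
    rw [abs_of_pos hpos, him] at this
    rw [abs_of_pos hε]; linarith)
  rw [pairingLine, norm_mul]
  calc ‖damp ε ρ‖ * ‖pairing Q₁ Q₂ x v ρ‖
      ≤ 2 * (vn v ^ 2 * (‖dH Q₁ Q₂ x ρ‖ * ‖dG Q₁ Q₂ x (-(starRingEnd ℂ ρ))‖)) :=
        mul_le_mul b3 (norm_pairing_le x v ρ) (norm_nonneg _) zero_le_two
    _ ≤ 2 * (vn v ^ 2 * ((C1 / ‖z‖) * (C2 / ‖z‖))) := by
        gcongr
        · exact b1.trans (by gcongr)
        · exact b2.trans (by gcongr; linarith)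
    _ = _ := by field_simp

theorem re_integral_pairingLine_nonpos (h₁ : SelfAdjointPotential Q₁)
    (h₂ : SelfAdjointPotential Q₂) (hW : CommonWeights Q₁ Q₂) (x : ℝ) (v : Fin m → ℂ) {ε : ℝ}
    (hε : 0 < ε) (hε1 : ε ≤ 1)
    (hgood : ∀ ρ : ℂ, ρ.im = ε → IsUnit (jD Q₁ ρ) ∧ IsUnit (jD Q₂ ρ)) :
    (∫ s : ℝ, pairingLine Q₁ Q₂ x v ε s).re ≤ 0 := by
  set S : Set ℂ := {ρ : ℂ | ε ≤ ρ.im ∧ ¬ (IsUnit (jD Q₁ ρ) ∧ IsUnit (jD Q₂ ρ))}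
  have hfin : S.Finite := by
    refine ((finite_singular h₁ hε).union (finite_singular h₂ hε)).subset fun ρ hρ => ?_
    by_cases h : IsUnit (jD Q₁ ρ)
    · exact Or.inr ⟨hρ.1, fun h' => hρ.2 ⟨h, h'⟩⟩
    · exact Or.inl ⟨hρ.1, h⟩
  -- The line Im ρ = ε is shifted to the real axis, and the poles with it.
  set P : Finset ℂ := hfin.toFinset.image (fun ρ => ρ - ε * Complex.I)
  have hP : ∀ z, z ∈ P ↔ z + ε * Complex.I ∈ S := by
    intro z
    simp only [P, Finset.mem_image, Finite.mem_toFinset]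
    constructor
    · rintro ⟨ρ, hρ, rfl⟩; simpa using hρ
    · exact fun h => ⟨_, h, by ring⟩
  have him : ∀ z : ℂ, (z + ε * Complex.I).im = z.im + ε := fun z => by simp
  have hPpos : ∀ p ∈ P, 0 < p.im := fun p hp => by
    have h1 := (hP p).1 hp
    have h2 := h1.1
    rw [him] at h2
    -- No pole lies on the line itself, by the choice of ε, so every shifted pole is strictly above
    -- the real axis.
    rcases (by linarith : 0 ≤ p.im).eq_or_lt with h | h
    · exact absurd (hgood _ (by rw [him, ← h, zero_add])) h1.2
    · exact h
  have hres : ∀ p ∈ P, ∃ c : ℂ, Tendsto (fun z => (z - p) * pairingLine Q₁ Q₂ x v ε z) (𝓝[≠] p)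
      (𝓝 c) ∧ (2 * Real.pi * Complex.I * c).re ≤ 0 := fun p hp => by
    have h1 := (hP p).1 hp
    obtain ⟨c, hc, hc'⟩ := exists_residue_pairing h₁ h₂ hW x v hε h1.1 h1.2
    refine ⟨c, ?_, hc'⟩
    have hshift : Tendsto (fun z : ℂ => z + ε * Complex.I) (𝓝[≠] p) (𝓝[≠] (p + ε * Complex.I)) := by
      rw [tendsto_nhdsWithin_iff]
      refine ⟨Tendsto.mono_left ((by fun_prop : Continuous fun z : ℂ =>
        z + ε * Complex.I).tendsto p) nhdsWithin_le_nhds, ?_⟩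
      filter_upwards [self_mem_nhdsWithin] with z hz
      simpa using hz
    refine (hc.comp hshift).congr fun z => ?_
    simp only [Function.comp_apply, pairingLine]
    ring
  choose! c hc hc' using hres
  have hdiff : ∀ z : ℂ, 0 ≤ z.im → z ∉ P → DifferentiableAt ℂ (pairingLine Q₁ Q₂ x v ε) z := by
    intro z hz hzP
    rw [hP] at hzP
    have hε' : 0 < (z + ε * Complex.I).im := by rw [him]; linarith
    have hu : IsUnit (jD Q₁ (z + ε * Complex.I)) ∧ IsUnit (jD Q₂ (z + ε * Complex.I)) := by
      by_contra h
      exact hzP ⟨by rw [him]; linarith, h⟩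
    have hd1 : DifferentiableAt ℂ (fun z : ℂ => z + ε * Complex.I) z := by fun_prop
    have hne := (mem_upperSet_of_pos hε').2
    have hd2 : DifferentiableAt ℂ (damp ε) (z + ε * Complex.I) := by
      unfold damp
      exact (differentiableAt_const _).add ((differentiableAt_const _).div (by fun_prop)
        (pow_ne_zero 2 hne))
    exact (hd2.mul (differentiableAt_pairing h₁ h₂ x v hε' hu.1 hu.2)).comp z hd1
  have hint : Integrable fun s : ℝ => pairingLine Q₁ Q₂ x v ε s := by
    obtain ⟨B, hB⟩ := exists_norm_pairingLine_le h₁ h₂ x v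
    refine Integrable.mono' (integrable_inv_one_add_sq.const_mul B)
      (Continuous.aestronglyMeasurable ?_) ?_
    · rw [continuous_iff_continuousAt]
      intro s
      have : ContinuousAt (pairingLine Q₁ Q₂ x v ε) (s : ℂ) :=
        (hdiff s (by simp) fun h => by simpa using hPpos _ h).continuousAt
      exact ContinuousAt.comp (f := fun s : ℝ => (s : ℂ)) this (by fun_prop)
    · filter_upwards [Measure.ae_ne volume (0 : ℝ)] with s hs using hB ε hε hε1 s hs
  rw [integral_real_eq_sum_residues P c hPpos hdiff hint hc
    (exists_pairingLine_decay h₁ h₂ x v hε), Finset.mul_sum, Complex.re_sum]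
  exact Finset.sum_nonpos hc'

theorem tendsto_pairingLine (h₁ : SelfAdjointPotential Q₁) (h₂ : SelfAdjointPotential Q₂)
    (x : ℝ) (v : Fin m → ℂ) {s : ℝ} (hs : s ≠ 0) :
    Tendsto (fun ε : ℝ => pairingLine Q₁ Q₂ x v ε s) (𝓝[>] 0) (𝓝 (pairing Q₁ Q₂ x v s)) := by
  have hs' : (s : ℂ) ≠ 0 := by exact_mod_cast hs
  have h1 : Tendsto (fun ε : ℝ => (s : ℂ) + ε * Complex.I) (𝓝[>] 0) (𝓝[upperSet] s) := by
    rw [tendsto_nhdsWithin_iff]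
    constructor
    · refine Tendsto.mono_left ?_ nhdsWithin_le_nhds
      exact (by fun_prop : Continuous fun ε : ℝ => (s : ℂ) + ε * Complex.I).tendsto' 0 _ (by simp)
    · filter_upwards [self_mem_nhdsWithin] with ε hε
      exact mem_upperSet_of_pos (by simpa using hε)
  have h2 : Tendsto (fun ε : ℝ => damp ε (s + ε * Complex.I)) (𝓝[>] 0) (𝓝 1) := by
    refine Tendsto.mono_left ?_ nhdsWithin_le_nhds
    have : ContinuousAt (fun ε : ℝ => damp ε (s + ε * Complex.I)) 0 := by
      unfold damp
      refine continuousAt_const.add (ContinuousAt.div (by fun_prop) (by fun_prop) ?_)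
      simpa using hs
    have h3 := this.tendsto
    simpa [damp] using h3
  have h3 := h2.mul ((continuousWithinAt_pairing h₁ h₂ x v hs).tendsto.comp h1)
  rwa [one_mul] at h3

theorem continuousOn_pairing_real (h₁ : SelfAdjointPotential Q₁) (h₂ : SelfAdjointPotential Q₂)
    (x : ℝ) (v : Fin m → ℂ) : ContinuousOn (fun s : ℝ => pairing Q₁ Q₂ x v s) {0}ᶜ := fun s hs =>
  (continuousWithinAt_pairing h₁ h₂ x v hs).comp (f := fun s : ℝ => (s : ℂ)) (by fun_prop)
    fun _ h => real_mem_upperSet h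

theorem aestronglyMeasurable_of_continuousOn {E : Type*} [TopologicalSpace E]
    [TopologicalSpace.PseudoMetrizableSpace E] [SecondCountableTopology E] {f : ℝ → E}
    (hf : ContinuousOn f {0}ᶜ) : AEStronglyMeasurable f volume := by
  have h := hf.aestronglyMeasurable (μ := volume) (measurableSet_singleton 0).compl
  have h0 : ∀ᵐ s : ℝ, s ∈ ({0}ᶜ : Set ℝ) := Measure.ae_ne volume (0 : ℝ)
  rwa [Measure.restrict_eq_self_of_ae_mem h0] at h

/-- Countability suffices for choosing pole-free lines; that the poles do not accumulate at the
origin is not needed. -/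
theorem countable_bad (hQ : SelfAdjointPotential Q) :
    {ρ : ℂ | 0 < ρ.im ∧ ¬ IsUnit (jD Q ρ)}.Countable := by
  have : {ρ : ℂ | 0 < ρ.im ∧ ¬ IsUnit (jD Q ρ)} ⊆
      ⋃ n : ℕ, {ρ : ℂ | 1 / ((n : ℝ) + 1) ≤ ρ.im ∧ ¬ IsUnit (jD Q ρ)} := fun ρ hρ => by
    obtain ⟨n, hn⟩ := exists_nat_one_div_lt hρ.1
    exact mem_iUnion.2 ⟨n, hn.le, hρ.2⟩
  exact (countable_iUnion fun n => (finite_singular hQ (by positivity)).countable).mono this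

theorem frequently_good (h₁ : SelfAdjointPotential Q₁) (h₂ : SelfAdjointPotential Q₂) :
    ∃ᶠ ε : ℝ in 𝓝[>] 0, 0 < ε ∧ ε ≤ 1 ∧
      ∀ ρ : ℂ, ρ.im = ε → IsUnit (jD Q₁ ρ) ∧ IsUnit (jD Q₂ ρ) := by
  have hc := ((countable_bad h₁).union (countable_bad h₂)).image Complex.im
  have hd := hc.dense_compl ℝ
  rw [(nhdsGT_basis (0 : ℝ)).frequently_iff]
  intro δ hδ
  obtain ⟨ε, hε, hmem⟩ := hd.exists_mem_open isOpen_Ioo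
    (nonempty_Ioo.2 (lt_min hδ (zero_lt_one' ℝ)))
  refine ⟨ε, ⟨hmem.1, hmem.2.trans_le (min_le_left _ _)⟩, hmem.1,
    (hmem.2.trans_le (min_le_right _ _)).le, fun ρ hρ => ?_⟩
  by_contra h
  refine hε ⟨ρ, ?_, hρ⟩
  have hp : 0 < ρ.im := by rw [hρ]; exact hmem.1
  by_cases h' : IsUnit (jD Q₁ ρ)
  · exact Or.inr ⟨hp, fun h'' => h ⟨h', h''⟩⟩
  · exact Or.inl ⟨hp, h'⟩

/-- Admissible levels ε accumulate at 0, though not all small ε need be admissible. A closed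
inequality that holds frequently passes to the limit. -/
theorem pairing_real (h₁ : SelfAdjointPotential Q₁) (h₂ : SelfAdjointPotential Q₂)
    (hW : CommonWeights Q₁ Q₂) (x : ℝ) (v : Fin m → ℂ) :
    Integrable (fun s : ℝ => pairing Q₁ Q₂ x v s) ∧ (∫ s : ℝ, pairing Q₁ Q₂ x v s).re ≤ 0 := by
  obtain ⟨B, hB⟩ := exists_norm_pairingLine_le h₁ h₂ x v
  have hsmall : ∀ᶠ ε : ℝ in 𝓝[>] 0, 0 < ε ∧ ε ≤ 1 := by
    filter_upwards [Ioc_mem_nhdsGT (zero_lt_one' ℝ)] with ε hε using hε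
  have hint : Integrable (fun s : ℝ => pairing Q₁ Q₂ x v s) := by
    refine Integrable.mono' (integrable_inv_one_add_sq.const_mul B)
      (aestronglyMeasurable_of_continuousOn (continuousOn_pairing_real h₁ h₂ x v)) ?_
    filter_upwards [Measure.ae_ne volume (0 : ℝ)] with s hs
    refine le_of_tendsto (tendsto_pairingLine h₁ h₂ x v hs).norm ?_
    filter_upwards [hsmall] with ε hε using hB ε hε.1 hε.2 s hs
  refine ⟨hint, ?_⟩
  have hlim : Tendsto (fun ε : ℝ => ∫ s : ℝ, pairingLine Q₁ Q₂ x v ε s) (𝓝[>] 0)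
      (𝓝 (∫ s : ℝ, pairing Q₁ Q₂ x v s)) := by
    refine tendsto_integral_filter_of_dominated_convergence (fun s => B * (1 + s ^ 2)⁻¹) ?_ ?_
      (integrable_inv_one_add_sq.const_mul B) ?_
    · filter_upwards [hsmall] with ε hε
      refine aestronglyMeasurable_of_continuousOn fun s hs => ContinuousAt.continuousWithinAt ?_
      have hp : 0 < ((s : ℂ) + ε * Complex.I).im := by simpa using hε.1
      have hr : ((s : ℂ) + ε * Complex.I).re ≠ 0 := by simpa using hs
      have h3 := (differentiableAt_pairing h₁ h₂ x v hp (isUnit_jD_of_re_ne_zero h₁ hp hr)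
        (isUnit_jD_of_re_ne_zero h₂ hp hr)).continuousAt
      have h4 : ContinuousAt (damp ε) ((s : ℂ) + ε * Complex.I) := by
        unfold damp
        exact continuousAt_const.add (continuousAt_const.div (by fun_prop)
          (pow_ne_zero 2 (mem_upperSet_of_pos hp).2))
      exact ContinuousAt.comp (f := fun s : ℝ => (s : ℂ) + ε * Complex.I) (h4.mul h3) (by fun_prop)
    · filter_upwards [hsmall] with ε hε
      filter_upwards [Measure.ae_ne volume (0 : ℝ)] with s hs using hB ε hε.1 hε.2 s hs
    · filter_upwards [Measure.ae_ne volume (0 : ℝ)] with s hs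
        using tendsto_pairingLine h₁ h₂ x v hs
  refine le_of_tendsto_of_frequently ((Complex.continuous_re.tendsto _).comp hlim) ?_
  exact (frequently_good h₁ h₂).mono fun ε hε =>
    re_integral_pairingLine_nonpos h₁ h₂ hW x v hε.1 hε.2.1 hε.2.2

end Pairing

end MatrixScattering
end

/-! ### Equality of the Weyl solutions and of the potentials -/

noncomputable section
set_option linter.unusedSectionVars false

namespace MatrixScattering

open Set
open scoped Matrix.Norms.L2Operator Matrix

section Uniqueness

variable {m : ℕ} {Q Q₁ Q₂ : ℝ → Mat m}

/-- Contractivity of the common scattering matrix gives |h*v - g(-s)*v| ≤ |g(s)*v|; the pairing is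
the cross term in the expanded square. -/
theorem vn_star_dH_sq_le (h₁ : SelfAdjointPotential Q₁) (h₂ : SelfAdjointPotential Q₂) (x : ℝ)
    (v : Fin m → ℂ) {s : ℝ} (hs : s ≠ 0)
    (hS : jC Q₁ s * (jD Q₁ s)⁻¹ = jC Q₂ s * (jD Q₂ s)⁻¹) :
    vn (star (dH Q₁ Q₂ x s) *ᵥ v) ^ 2 ≤ 2 * (pairing Q₁ Q₂ x v s).re +
      (vn (star (dG Q₁ Q₂ x s) *ᵥ v) ^ 2 - vn (star (dG Q₁ Q₂ x (-s : ℝ)) *ᵥ v) ^ 2) := by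
  set S := jC Q₁ s * (jD Q₁ s)⁻¹
  set e := Complex.exp (2 * Complex.I * s * x)
  have he : ‖star e‖ = 1 := by
    rw [norm_star, Complex.norm_exp]
    simp
  have h : dH Q₁ Q₂ x s = e • (dG Q₁ Q₂ x s * S) + dG Q₁ Q₂ x (-s : ℝ) := by
    rw [dH, jH_real h₁ x hs, jH_real h₂ x hs, ← hS, dG, dG, sub_mul, smul_sub, Complex.ofReal_neg]
    abel
  have hp : pairing Q₁ Q₂ x v s =
      star (star (dH Q₁ Q₂ x s) *ᵥ v) ⬝ᵥ (star (dG Q₁ Q₂ x (-s : ℝ)) *ᵥ v) := by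
    rw [← quad_star_mul, star_star, pairing, Complex.conj_ofReal, Complex.ofReal_neg]
  have hc : star (dH Q₁ Q₂ x s) *ᵥ v - star (dG Q₁ Q₂ x (-s : ℝ)) *ᵥ v =
      star e • (star S *ᵥ (star (dG Q₁ Q₂ x s) *ᵥ v)) := by
    rw [h, star_add, star_smul, star_mul, Matrix.add_mulVec, Matrix.smul_mulVec,
      Matrix.mulVec_mulVec, add_sub_cancel_right]
  have hle : vn (star (dH Q₁ Q₂ x s) *ᵥ v - star (dG Q₁ Q₂ x (-s : ℝ)) *ᵥ v) ≤
      vn (star (dG Q₁ Q₂ x s) *ᵥ v) := by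
    rw [hc, vn_smul, he, one_mul]
    refine (vn_mulVec_le _ _).trans ?_
    rw [norm_star]
    exact mul_le_of_le_one_left (vn_nonneg _) (norm_jC_mul_inv_le h₁ hs)
  rw [hp]
  set a := star (dH Q₁ Q₂ x s) *ᵥ v
  set b := star (dG Q₁ Q₂ x (-s : ℝ)) *ᵥ v
  have h1 : vn (a - b) ^ 2 = vn a ^ 2 + vn b ^ 2 - 2 * (star a ⬝ᵥ b).re := by
    have h2 : (star b ⬝ᵥ a).re = (star a ⬝ᵥ b).re := by
      have : star b ⬝ᵥ a = star (star a ⬝ᵥ b) := by rw [Matrix.star_dotProduct]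
      rw [this, Complex.star_def, Complex.conj_re]
    rw [← dot_re_self, ← dot_re_self, ← dot_re_self, star_sub, sub_dotProduct, dotProduct_sub,
      dotProduct_sub]
    simp only [Complex.sub_re, h2]
    ring
  have h2 := pow_le_pow_left₀ (vn_nonneg _) hle 2
  linarith

/-- Integrating the preceding inequality leaves only the pairing, whose integral has nonpositive
real part. Hence h*v vanishes almost everywhere, and everywhere off 0 by continuity. -/
theorem dH_eq_zero (h₁ : SelfAdjointPotential Q₁) (h₂ : SelfAdjointPotential Q₂)
    (hS : ∀ s : ℝ, s ≠ 0 → jC Q₁ s * (jD Q₁ s)⁻¹ = jC Q₂ s * (jD Q₂ s)⁻¹)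
    (hW : CommonWeights Q₁ Q₂) (x : ℝ) {s : ℝ} (hs : s ≠ 0) : dH Q₁ Q₂ x s = 0 := by
  have key : ∀ v, star (dH Q₁ Q₂ x s) *ᵥ v = 0 := by
    intro v
    have hcvn : Continuous (fun w : Fin m → ℂ => vn w ^ 2) := by
      unfold vn
      exact (continuous_norm.comp (PiLp.continuous_toLp 2 _)).pow 2
    have hcmul : Continuous fun M : Mat m => star M *ᵥ v :=
      Continuous.matrix_mulVec continuous_star continuous_const
    have hreal : MapsTo (fun s : ℝ => (s : ℂ)) {0}ᶜ upperSet := fun s h => real_mem_upperSet h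
    have hcH : ContinuousOn (fun s : ℝ => vn (star (dH Q₁ Q₂ x s) *ᵥ v) ^ 2) {0}ᶜ := by
      refine (hcvn.comp hcmul).comp_continuousOn (f := fun s : ℝ => dH Q₁ Q₂ x s) fun s hs => ?_
      have hp := real_mem_upperSet hs
      exact ((continuousWithinAt_jH h₁ x hp (isUnit_jD_real h₁ hs)).sub
        (continuousWithinAt_jH h₂ x hp (isUnit_jD_real h₂ hs))).comp (f := fun s : ℝ => (s : ℂ))
          (by fun_prop) hreal
    have hcG : ContinuousOn (fun s : ℝ => vn (star (dG Q₁ Q₂ x s) *ᵥ v) ^ 2) {0}ᶜ := by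
      refine (hcvn.comp hcmul).comp_continuousOn (f := fun s : ℝ => dG Q₁ Q₂ x s) ?_
      exact ((continuousOn_jostM h₁.toFirstMoment x).sub
        (continuousOn_jostM h₂.toFirstMoment x)).comp (f := fun s : ℝ => (s : ℂ)) (by fun_prop) hreal
    obtain ⟨hpi, hpre⟩ := pairing_real h₁ h₂ hW x v
    have hGi : Integrable fun s : ℝ => vn (star (dG Q₁ Q₂ x s) *ᵥ v) ^ 2 := by
      obtain ⟨C, hC0, hC⟩ := exists_norm_dG_le h₁ h₂ x
      refine Integrable.mono' (integrable_inv_one_add_sq.const_mul (C ^ 2 * vn v ^ 2))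
        (aestronglyMeasurable_of_continuousOn hcG) ?_
      filter_upwards [Measure.ae_ne volume (0 : ℝ)] with s hs
      have h3 := hC s (real_mem_upperSet hs)
      rw [Complex.norm_real, Real.norm_eq_abs] at h3
      have h4 := vn_mulVec_le (star (dG Q₁ Q₂ x s)) v
      rw [norm_star] at h4
      have h5 : 1 + s ^ 2 ≤ (1 + |s|) ^ 2 := by
        have := abs_nonneg s
        rw [← sq_abs s]; nlinarith
      rw [Real.norm_of_nonneg (by positivity)]
      calc vn (star (dG Q₁ Q₂ x s) *ᵥ v) ^ 2 ≤ (C / (1 + |s|) * vn v) ^ 2 := by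
            refine pow_le_pow_left₀ (vn_nonneg _) (h4.trans ?_) 2
            exact mul_le_mul_of_nonneg_right h3 (vn_nonneg _)
        _ = C ^ 2 * vn v ^ 2 * ((1 + |s|) ^ 2)⁻¹ := by field_simp
        _ ≤ _ := by gcongr
    have hri : Integrable fun s : ℝ => 2 * (pairing Q₁ Q₂ x v s).re +
        (vn (star (dG Q₁ Q₂ x s) *ᵥ v) ^ 2 - vn (star (dG Q₁ Q₂ x (-s : ℝ)) *ᵥ v) ^ 2) :=
      (hpi.re.const_mul 2).add (hGi.sub hGi.comp_neg)
    have hle : ∀ᵐ s : ℝ, vn (star (dH Q₁ Q₂ x s) *ᵥ v) ^ 2 ≤ 2 * (pairing Q₁ Q₂ x v s).re +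
        (vn (star (dG Q₁ Q₂ x s) *ᵥ v) ^ 2 - vn (star (dG Q₁ Q₂ x (-s : ℝ)) *ᵥ v) ^ 2) := by
      filter_upwards [Measure.ae_ne volume (0 : ℝ)] with s hs
        using vn_star_dH_sq_le h₁ h₂ x v hs (hS s hs)
    have hHi : Integrable fun s : ℝ => vn (star (dH Q₁ Q₂ x s) *ᵥ v) ^ 2 := by
      refine Integrable.mono' hri (aestronglyMeasurable_of_continuousOn hcH) ?_
      filter_upwards [hle] with s hs
      rwa [Real.norm_of_nonneg (by positivity)]
    have hI : ∫ s : ℝ, vn (star (dH Q₁ Q₂ x s) *ᵥ v) ^ 2 ≤ 0 := by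
      refine (integral_mono_ae hHi hri hle).trans ?_
      -- The substitution s ↦ -s makes the two `dG` terms cancel.
      have e1 := integral_neg_eq_self (fun s : ℝ => vn (star (dG Q₁ Q₂ x s) *ᵥ v) ^ 2) volume
      have e2 : ∫ s : ℝ, (pairing Q₁ Q₂ x v s).re = (∫ s : ℝ, pairing Q₁ Q₂ x v s).re :=
        integral_re hpi
      have i1 : Integrable fun s : ℝ => 2 * (pairing Q₁ Q₂ x v s).re := hpi.re.const_mul 2
      have i2 : Integrable fun s : ℝ => vn (star (dG Q₁ Q₂ x (-s : ℝ)) *ᵥ v) ^ 2 := hGi.comp_neg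
      have i3 : Integrable fun s : ℝ => vn (star (dG Q₁ Q₂ x s) *ᵥ v) ^ 2 -
        vn (star (dG Q₁ Q₂ x (-s : ℝ)) *ᵥ v) ^ 2 := hGi.sub i2
      rw [integral_add i1 i3, integral_const_mul, integral_sub hGi i2, e1, sub_self, add_zero]
      rw [e2]
      linarith
    have hz : (fun s : ℝ => vn (star (dH Q₁ Q₂ x s) *ᵥ v) ^ 2) =ᵐ[volume] 0 :=
      (integral_eq_zero_iff_of_nonneg (fun s => by positivity) hHi).1
        (le_antisymm hI (integral_nonneg fun s => by positivity))
    have hall := Measure.eqOn_open_of_ae_eq (ae_restrict_of_ae hz) isOpen_compl_singleton hcH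
      continuousOn_const
    exact eq_zero_of_vn (pow_eq_zero_iff two_ne_zero |>.1 (hall hs))
  have h0 : star (dH Q₁ Q₂ x s) = 0 := by
    ext i j
    have := congrFun (key (Pi.single j 1)) i
    simpa using this
  exact star_eq_zero.1 h0

/-- The right scattering matrix and the right weights determine the potential. -/
theorem ae_eq_of_scattering (h₁ : SelfAdjointPotential Q₁) (h₂ : SelfAdjointPotential Q₂)
    (hS : ∀ s : ℝ, s ≠ 0 → jC Q₁ s * (jD Q₁ s)⁻¹ = jC Q₂ s * (jD Q₂ s)⁻¹)
    (hW : CommonWeights Q₁ Q₂) : Q₁ =ᵐ[volume] Q₂ := by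
  have hΦ : ∀ s : ℝ, s ≠ 0 → ∀ x, jG Q₁ s x * (jD Q₁ s)⁻¹ = jG Q₂ s x * (jD Q₂ s)⁻¹ :=
    fun s hs x => by
      rw [jG_mul_inv, jG_mul_inv, sub_eq_zero.1 (dH_eq_zero h₁ h₂ hS hW x hs)]
  -- The Weyl solutions agree, so their first derivatives do, and the derivatives of these exist
  -- almost everywhere. Only s = n + 1 is used, so that countably many null sets are discarded.
  have hae : ∀ n : ℕ, ∀ᵐ x : ℝ, (Q₁ x - Q₂ x) *
      (jG Q₁ ((n + 1 : ℝ) : ℂ) x * (jD Q₁ ((n + 1 : ℝ) : ℂ))⁻¹) = 0 := by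
    intro n
    set s : ℝ := n + 1
    have hs : s ≠ 0 := by positivity
    have hp := real_mem_upperSet hs
    have s1 := (isSol_jG h₁.toFirstMoment hp).mul_const (jD Q₁ s)⁻¹
    have s2 := (isSol_jG h₂.toFirstMoment hp).mul_const (jD Q₂ s)⁻¹
    have e1 : ∀ x, jG' Q₁ s x * (jD Q₁ s)⁻¹ = jG' Q₂ s x * (jD Q₂ s)⁻¹ := fun x => by
      have d2 := s2.hasDerivAt x
      rw [← funext (hΦ s hs)] at d2
      exact (s1.hasDerivAt x).unique d2
    filter_upwards [s1.prim'.ae_hasDerivAt, s2.prim'.ae_hasDerivAt] with x d1 d2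
    rw [← funext e1] at d2
    have d3 := d1.unique d2
    rw [← hΦ s hs x] at d3
    rw [sub_mul, sub_eq_zero]
    exact sub_left_injective d3
  filter_upwards [ae_all_iff.2 hae] with x hx
  -- For s ≥ max(R, 2C) the reduced Weyl solution is within 1/2 of the identity, hence invertible.
  obtain ⟨C, R, hC0, hR, hC⟩ := exists_jH_asymp h₁
  obtain ⟨n, hn⟩ := exists_nat_gt (max R (2 * C))
  set s : ℝ := n + 1
  have hs : s ≠ 0 := by positivity
  have hspos : 0 < s := by positivity
  have h1 : R ≤ s := by have := (le_max_left _ _).trans_lt hn; simp only [s]; linarith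
  have h2 : 2 * C ≤ s := by have := (le_max_right _ _).trans_lt hn; simp only [s]; linarith
  have hnorm : ‖(s : ℂ)‖ = s := by rw [Complex.norm_real, Real.norm_of_nonneg hspos.le]
  have h3 := hC s (real_mem_upperSet hs) (by rwa [hnorm]) x
  rw [hnorm] at h3
  have hu : IsUnit (jH Q₁ x s) := isUnit_of_norm_sub_one_le (h3.trans (by
    rw [div_le_iff₀ hspos]; linarith))
  have h4 := hx n
  rw [jG_mul_inv] at h4
  exact sub_eq_zero.1 ((isUnit_exp_smul hu _).mul_left_eq_zero.1 h4)

end Uniqueness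

end MatrixScattering
end

/-! ### Identification with the scattering data of the statement -/

noncomputable section
set_option linter.unusedSectionVars false

namespace MatrixScattering

open Set
open scoped Matrix.Norms.L2Operator Matrix

section Bridge

variable {m : ℕ} {Q : ℝ → Mat m}

/-- The entries of a matrix as a continuous linear map. -/
def entryL (j k : Fin m) : Mat m →L[ℝ] ℂ :=
  LinearMap.toContinuousLinearMap (Matrix.entryLinearMap ℝ ℂ j k)

/-- The action on a fixed vector as a continuous linear map. -/
def mulVecL (v : Fin m → ℂ) : Mat m →L[ℝ] (Fin m → ℂ) :=
  LinearMap.toContinuousLinearMap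
    { toFun := fun M => M *ᵥ v
      map_add' := fun M N => Matrix.add_mulVec M N v
      map_smul' := fun c M => Matrix.smul_mulVec c M v }

theorem mulVecL_apply (v : Fin m → ℂ) (M : Mat m) : mulVecL v M = M *ᵥ v := rfl

/-- The matrix with a given `k`-th column and zeros elsewhere. -/
def colL (k : Fin m) : (Fin m → ℂ) →L[ℝ] Mat m :=
  LinearMap.toContinuousLinearMap
    { toFun := fun y => Matrix.of fun j i => if i = k then y j else 0
      map_add' := fun y z => by
        ext j i
        by_cases h : i = k <;> simp [h]
      map_smul' := fun c y => by
        ext j i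
        by_cases h : i = k <;> simp [h] }

theorem sum_colL (y : Fin m → Fin m → ℂ) : ∑ k, colL k (y k) = Matrix.of fun j k => y k j := by
  ext j i
  rw [Matrix.sum_apply]
  change ∑ k, (if i = k then y k j else 0) = y i j
  simp

theorem integrable_of_entries {F : ℝ → Mat m} (h : ∀ j k, Integrable fun x => F x j k) :
    Integrable F := by
  have : F = fun x => ∑ k, colL k (fun j => F x j k) := by
    ext1 x; rw [sum_colL]; rfl
  rw [this]
  refine integrable_finsetSum _ fun k _ => (colL k).integrable_comp ?_
  exact Integrable.of_eval fun j => h j k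

theorem IsPotential.selfAdjointPotential (h : IsPotential Q) : SelfAdjointPotential Q where
  int := integrable_of_entries fun j k => by
    refine (h.integrable j k).mono (h.measurable j k) (Eventually.of_forall fun x => ?_)
    rw [Real.norm_of_nonneg (by positivity)]
    nlinarith [abs_nonneg x, norm_nonneg (Q x j k)]
  moment := by
    have h1 : Integrable fun x : ℝ => x • Q x := integrable_of_entries fun j k => by
      refine (h.integrable j k).mono (continuous_id.aestronglyMeasurable.smul (h.measurable j k))
        (Eventually.of_forall fun x => ?_)
      rw [Real.norm_of_nonneg (by positivity)]
      change ‖x • Q x j k‖ ≤ _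
      rw [norm_smul, Real.norm_eq_abs]
      nlinarith [abs_nonneg x, norm_nonneg (Q x j k)]
    refine h1.norm.congr (Eventually.of_forall fun x => ?_)
    simp only [norm_smul, Real.norm_eq_abs]
  sa := h.selfAdjoint

theorem IsSol.isSolution {lam : ℂ} {F F' : ℝ → Mat m} (h : IsSol Q lam F F') (v : Fin m → ℂ) :
    IsSolution Q lam fun x => F x *ᵥ v := by
  refine ⟨fun x => F' x *ᵥ v, fun x => (mulVecL v).hasFDerivAt.comp_hasDerivAt x (h.hasDerivAt x),
    fun a b => ?_⟩
  have h1 := (h.prim'.map (mulVecL v)).eq a b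
  simp only [mulVecL_apply] at h1
  rw [h1]
  refine intervalIntegral.integral_congr fun x _ => ?_
  simp only [Matrix.sub_mulVec, Matrix.smul_mulVec, Matrix.mulVec_mulVec]

theorem IsSol.isMatrixSolution {lam : ℂ} {F F' : ℝ → Mat m} (h : IsSol Q lam F F') :
    IsMatrixSolution Q lam F := fun k => by
  have := h.isSolution (Pi.single k 1)
  simp only [Matrix.mulVec_single_one] at this
  exact this

theorem IsMatrixSolution.exists_isSol (hQ : Integrable Q) {lam : ℂ} {F : ℝ → Mat m}
    (h : IsMatrixSolution Q lam F) : ∃ F', IsSol Q lam F F' := by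
  choose y' hd hi using h
  have hF : ∀ x, HasDerivAt F (Matrix.of fun j k => y' k x j) x := fun x => by
    have h1 : F = fun x => ∑ k, colL k (fun j => F x j k) := by
      ext1 x; rw [sum_colL]; rfl
    rw [h1, ← sum_colL (fun k => y' k x)]
    exact HasDerivAt.fun_sum fun k _ => (colL k).hasFDerivAt.comp_hasDerivAt x (hd k x)
  have hFc : Continuous F := continuous_iff_continuousAt.2 fun x => (hF x).continuousAt
  -- `IsSolution` does not include integrability, and an integral without it would have the default
  -- value 0. It holds here because `Q` is integrable and `F` continuous.
  have hint : ∀ a b : ℝ, IntervalIntegrable (fun x => Q x * F x - lam • F x) volume a b := fun a b =>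
    ((hQ.intervalIntegrable).mul_continuousOn hFc.continuousOn).sub
      ((hFc.const_smul lam).intervalIntegrable a b)
  have hF' : IsPrimitive (fun x => (Matrix.of fun j k => y' k x j : Mat m))
      (fun x => Q x * F x - lam • F x) := by
    refine ⟨hint, fun a b => ?_⟩
    ext j k
    have h1 := (mulVecL (Pi.single k 1)).intervalIntegral_comp_comm (hint a b)
    have h2 := hi k a b
    have h3 : ∀ x, mulVecL (Pi.single k 1) (Q x * F x - lam • F x) =
        (Q x).mulVec (fun j => F x j k) - lam • fun j => F x j k := fun x => by
      rw [mulVecL_apply, Matrix.sub_mulVec, Matrix.smul_mulVec, ← Matrix.mulVec_mulVec,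
        Matrix.mulVec_single_one]
      rfl
    simp only [h3] at h1
    rw [h1, mulVecL_apply, Matrix.mulVec_single_one] at h2
    exact congrFun h2 j
  exact ⟨_, IsPrimitive.of_hasDerivAt hF hF'.continuous, hF'⟩

theorem matDeriv_eq {F : ℝ → Mat m} {D : Mat m} {x : ℝ} (h : HasDerivAt F D x) :
    matDeriv F x = D := by
  ext j k
  exact ((entryL j k).hasFDerivAt.comp_hasDerivAt x h).deriv

/-- The choice made by `Classical.epsilon` is determined: the Neumann series gives existence and
`eq_jF_of_tendsto` gives uniqueness. -/
theorem jostPlus_eq (hQ : SelfAdjointPotential Q) {ρ : ℂ} (hρ : ρ ∈ upperSet) :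
    jostPlus Q ρ = jF Q ρ := by
  have h : IsJostPlus Q ρ (jostPlus Q ρ) := by
    refine Classical.epsilon_spec (p := IsJostPlus Q ρ)
      ⟨jF Q ρ, (isSol_jF hQ.toFirstMoment hρ).isMatrixSolution, ?_⟩
    simp only [exp_smul_jF]
    exact tendsto_jostM hQ.toFirstMoment hρ
  obtain ⟨F', hF'⟩ := h.1.exists_isSol hQ.int
  exact eq_jF_of_tendsto hQ hρ hF' h.2

theorem jostMinus_eq (hQ : SelfAdjointPotential Q) {ρ : ℂ} (hρ : ρ ∈ upperSet) :
    jostMinus Q ρ = jG Q ρ := by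
  have h : IsJostMinus Q ρ (jostMinus Q ρ) := by
    refine Classical.epsilon_spec (p := IsJostMinus Q ρ)
      ⟨jG Q ρ, (isSol_jG hQ.toFirstMoment hρ).isMatrixSolution, ?_⟩
    have h1 := (tendsto_jostM hQ.comp_neg.toFirstMoment hρ).comp tendsto_neg_atBot_atTop
    refine h1.congr fun x => ?_
    simp only [Function.comp_apply, jG]
    rw [← exp_smul_jF]
    congr 2
    push_cast
    ring
  obtain ⟨F', hF'⟩ := h.1.exists_isSol hQ.int
  have h2 := eq_jF_of_tendsto hQ.comp_neg hρ hF'.comp_neg (by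
    refine (h.2.comp tendsto_neg_atTop_atBot).congr fun x => ?_
    simp only [Function.comp_apply]
    congr 2
    push_cast
    ring)
  funext x
  rw [jG, ← h2]
  simp only [neg_neg]

theorem coeffCD_eq (hQ : SelfAdjointPotential Q) {r : ℝ} (hr : r ≠ 0) :
    coeffCD Q r = (jC Q r, jD Q r) := by
  have hp := real_mem_upperSet hr
  have hn := neg_real_mem_upperSet hr
  have h := Classical.epsilon_spec (p := fun CD : Mat m × Mat m => ∀ x : ℝ,
    jostMinus Q (r : ℂ) x = jostPlus Q (r : ℂ) x * CD.1 + jostPlus Q (-(r : ℂ)) x * CD.2)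
    ⟨(jC Q r, jD Q r), fun x => by
      rw [jostMinus_eq hQ hp, jostPlus_eq hQ hp, jostPlus_eq hQ hn]
      exact (jG_eq hQ hr x).1⟩
  change ∀ x : ℝ, jostMinus Q (r : ℂ) x = jostPlus Q (r : ℂ) x * (coeffCD Q r).1 +
    jostPlus Q (-(r : ℂ)) x * (coeffCD Q r).2 at h
  rw [jostMinus_eq hQ hp, jostPlus_eq hQ hp, jostPlus_eq hQ hn] at h
  exact Prod.ext_iff.2 (jC_jD_unique hQ hr h)

theorem scatPlus_eq (hQ : SelfAdjointPotential Q) {r : ℝ} (hr : r ≠ 0) :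
    scatPlus Q r = jC Q r * (jD Q r)⁻¹ := by
  rw [scatPlus, coeffCD_eq hQ hr]

theorem jG_comp_neg (ρ : ℂ) (x : ℝ) : jG (fun t => Q (-t)) ρ x = jF Q ρ (-x) := by
  simp only [jG, neg_neg]

/-- The reflection x ↦ -x exchanges F_+ and F_-, and with them the pair (A, B) and the pair (D, C).
All statements on the left data reduce in this way to statements on D and C. -/
theorem coeffAB_eq (hQ : SelfAdjointPotential Q) {r : ℝ} (hr : r ≠ 0) :
    coeffAB Q r = (jD (fun t => Q (-t)) r, jC (fun t => Q (-t)) r) := by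
  have hp := real_mem_upperSet hr
  have hn := neg_real_mem_upperSet hr
  have key : ∀ A B : Mat m, (∀ x : ℝ, jF Q r x = jG Q (-r) x * A + jG Q r x * B) ↔
      ∀ x : ℝ, jG (fun t => Q (-t)) r x =
        jF (fun t => Q (-t)) r x * B + jF (fun t => Q (-t)) (-r) x * A := fun A B => by
    constructor
    · intro h x
      rw [jG_comp_neg, h, jG, jG, neg_neg, add_comm]
    · intro h x
      have := h (-x)
      rw [jG_comp_neg, neg_neg] at this
      rw [this, jG, jG, add_comm]
  have h := Classical.epsilon_spec (p := fun AB : Mat m × Mat m => ∀ x : ℝ,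
    jostPlus Q (r : ℂ) x = jostMinus Q (-(r : ℂ)) x * AB.1 + jostMinus Q (r : ℂ) x * AB.2)
    ⟨(jD (fun t => Q (-t)) r, jC (fun t => Q (-t)) r), by
      rw [jostPlus_eq hQ hp, jostMinus_eq hQ hp, jostMinus_eq hQ hn, key]
      exact fun x => (jG_eq hQ.comp_neg hr x).1⟩
  change ∀ x : ℝ, jostPlus Q (r : ℂ) x = jostMinus Q (-(r : ℂ)) x * (coeffAB Q r).1 +
    jostMinus Q (r : ℂ) x * (coeffAB Q r).2 at h
  rw [jostPlus_eq hQ hp, jostMinus_eq hQ hp, jostMinus_eq hQ hn, key] at h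
  have := jC_jD_unique hQ.comp_neg hr h
  exact Prod.ext_iff.2 ⟨this.2, this.1⟩

theorem scatMinus_eq (hQ : SelfAdjointPotential Q) {r : ℝ} (hr : r ≠ 0) :
    scatMinus Q r = jC (fun t => Q (-t)) r * (jD (fun t => Q (-t)) r)⁻¹ := by
  rw [scatMinus, coeffAB_eq hQ hr]

theorem hasDerivAt_jF (hQ : SelfAdjointPotential Q) {ρ : ℂ} (hρ : ρ ∈ upperSet) (x : ℝ) :
    HasDerivAt (jF Q ρ) (jF' Q ρ x) x := (isSol_jF hQ.toFirstMoment hρ).hasDerivAt x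

theorem hasDerivAt_jG (hQ : SelfAdjointPotential Q) {ρ : ℂ} (hρ : ρ ∈ upperSet) (x : ℝ) :
    HasDerivAt (jG Q ρ) (jG' Q ρ x) x := (isSol_jG hQ.toFirstMoment hρ).hasDerivAt x

theorem wronskian_jost (hQ : SelfAdjointPotential Q) {ρ : ℂ} (hρ : ρ ∈ upperSet) :
    wronskian (jostMinusBar Q ρ) (jostPlus Q ρ) 0 =
      star (jG' Q (-(starRingEnd ℂ ρ)) 0) * jF Q ρ 0 -
        star (jG Q (-(starRingEnd ℂ ρ)) 0) * jF' Q ρ 0 := by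
  have hc := neg_conj_mem hρ
  have e1 : jostMinusBar Q ρ = fun x => star (jG Q (-(starRingEnd ℂ ρ)) x) := by
    funext x
    rw [jostMinusBar, jostMinus_eq hQ hc, Matrix.star_eq_conjTranspose]
  have d1 : HasDerivAt (fun x => star (jG Q (-(starRingEnd ℂ ρ)) x))
      (star (jG' Q (-(starRingEnd ℂ ρ)) 0)) 0 := (hasDerivAt_jG hQ hc 0).star
  rw [wronskian, e1, jostPlus_eq hQ hρ, matDeriv_eq d1, matDeriv_eq (hasDerivAt_jF hQ hρ 0)]

theorem upperA_eq (hQ : SelfAdjointPotential Q) {ρ : ℂ} (hρ : ρ ∈ upperSet) :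
    upperA Q ρ = jD (fun t => Q (-t)) ρ := by
  rw [upperA, wronskian_jost hQ hρ, jD, wr, jFb, jFb', jG', jG_comp_neg, jG, jG', neg_zero]
  simp only [neg_neg, star_neg, neg_smul]
  rw [← smul_neg]
  congr 1
  noncomm_ring

theorem upperD_eq (hQ : SelfAdjointPotential Q) {ρ : ℂ} (hρ : ρ ∈ upperSet) :
    upperD Q ρ = jD Q ρ := by
  have hc := neg_conj_mem hρ
  have e : star (-(2 * Complex.I * -(starRingEnd ℂ ρ))⁻¹) = -(2 * Complex.I * ρ)⁻¹ := by
    simp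
  rw [upperD, upperA, wronskian_jost hQ hc, ← Matrix.star_eq_conjTranspose, star_smul, e, jD, wr,
    jFb, jFb']
  simp only [map_neg, Complex.conj_conj, neg_neg, star_sub, star_mul, star_star]
  rw [neg_smul, ← smul_neg, neg_sub]

end Bridge

end MatrixScattering
end

/-! ### Discrete data and conclusion -/

noncomputable section
set_option linter.unusedSectionVars false

namespace MatrixScattering

open Set
open scoped Matrix.Norms.L2Operator Matrix

section Discrete

variable {m : ℕ} {Q Q₁ Q₂ : ℝ → Mat m}

/-- `N` is the right weight matrix of `Q` at `ρ₀`. -/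
def IsRightWeight (Q : ℝ → Mat m) (ρ₀ : ℂ) (N : Mat m) : Prop :=
  ∃ R : Mat m, Tendsto (fun ρ => (ρ - ρ₀) • (jD Q ρ)⁻¹) (𝓝[≠] ρ₀) (𝓝 R) ∧
    ∀ x, jG Q ρ₀ x * R = Complex.I • (jF Q ρ₀ x * N)

theorem eventually_mem_upperSet {ρ₀ : ℂ} (h0 : 0 < ρ₀.im) : ∀ᶠ ρ in 𝓝[≠] ρ₀, ρ ∈ upperSet := by
  filter_upwards [nhdsWithin_le_nhds (isOpen_im_pos.mem_nhds h0)] with ρ hρ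
    using mem_upperSet_of_pos hρ

/-- This holds at every point of the upper half plane, singular or not: where D is invertible, the
residue and the weight are both 0. Hence the two potentials need not have the same singular points a
priori. -/
theorem isRightWeight_weightPlus (hQ : SelfAdjointPotential Q) {ρ₀ : ℂ} (h0 : 0 < ρ₀.im) :
    IsRightWeight Q ρ₀ (weightPlus Q ρ₀) := by
  obtain ⟨R, hR⟩ := exists_residue hQ h0
  obtain ⟨N, hN⟩ := exists_weight hQ h0 (jD_mul_residue hQ h0 hR)
  have hρ := mem_upperSet_of_pos h0
  have hres : resPlus Q ρ₀ = R := by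
    refine Tendsto.limUnder_eq (hR.congr' ?_)
    filter_upwards [eventually_mem_upperSet h0] with ρ hρ
    rw [upperD_eq hQ hρ]
  refine ⟨R, hR, ?_⟩
  have h := Classical.epsilon_spec (p := fun N : Mat m => ∀ x : ℝ,
    jostMinus Q ρ₀ x * resPlus Q ρ₀ = Complex.I • (jostPlus Q ρ₀ x * N)) ⟨N, fun x => by
      rw [hres, jostMinus_eq hQ hρ, jostPlus_eq hQ hρ, hN]⟩
  change ∀ x : ℝ, jostMinus Q ρ₀ x * resPlus Q ρ₀ =
    Complex.I • (jostPlus Q ρ₀ x * weightPlus Q ρ₀) at h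
  generalize weightPlus Q ρ₀ = W at h ⊢
  rwa [hres, jostMinus_eq hQ hρ, jostPlus_eq hQ hρ] at h

theorem isRightWeight_weightMinus (hQ : SelfAdjointPotential Q) {ρ₀ : ℂ} (h0 : 0 < ρ₀.im) :
    IsRightWeight (fun t => Q (-t)) ρ₀ (weightMinus Q ρ₀) := by
  obtain ⟨R, hR⟩ := exists_residue hQ.comp_neg h0
  obtain ⟨N, hN⟩ := exists_weight hQ.comp_neg h0 (jD_mul_residue hQ.comp_neg h0 hR)
  have hρ := mem_upperSet_of_pos h0
  have hres : resMinus Q ρ₀ = R := by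
    refine Tendsto.limUnder_eq (hR.congr' ?_)
    filter_upwards [eventually_mem_upperSet h0] with ρ hρ
    rw [upperA_eq hQ hρ]
  refine ⟨R, hR, ?_⟩
  have key : ∀ N : Mat m, (∀ x, jF Q ρ₀ x * R = Complex.I • (jG Q ρ₀ x * N)) ↔
      ∀ x, jG (fun t => Q (-t)) ρ₀ x * R = Complex.I • (jF (fun t => Q (-t)) ρ₀ x * N) := fun N => by
    constructor
    · intro h x
      rw [jG_comp_neg, h, jG, neg_neg]
    · intro h x
      have := h (-x)
      rwa [jG_comp_neg, neg_neg] at this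
  have h := Classical.epsilon_spec (p := fun N : Mat m => ∀ x : ℝ,
    jostPlus Q ρ₀ x * resMinus Q ρ₀ = Complex.I • (jostMinus Q ρ₀ x * N)) ⟨N, by
      rw [hres, jostMinus_eq hQ hρ, jostPlus_eq hQ hρ, key]
      exact hN⟩
  change ∀ x : ℝ, jostPlus Q ρ₀ x * resMinus Q ρ₀ =
    Complex.I • (jostMinus Q ρ₀ x * weightMinus Q ρ₀) at h
  generalize weightMinus Q ρ₀ = W at h ⊢
  rwa [hres, jostMinus_eq hQ hρ, jostPlus_eq hQ hρ, key] at h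

theorem exists_forall_norm_jostM_le (hQ : SelfAdjointPotential Q) {ρ : ℂ} (hρ : ρ ∈ upperSet) :
    ∃ C, 0 ≤ C ∧ ∀ x, ‖jostM Q ρ x‖ ≤ C := by
  have hi : Integrable fun t => 1 / ‖ρ‖ * ‖Q t‖ := hQ.int.norm.const_mul _
  refine ⟨‖(1 : Mat m)‖ * Real.exp (∫ t, 1 / ‖ρ‖ * ‖Q t‖), by positivity, fun x => ?_⟩
  refine (norm_jostM_le (kernelBound_inv hQ.toFirstMoment hρ x) le_rfl).trans ?_
  refine mul_le_mul_of_nonneg_left (Real.exp_le_exp.2 ?_) (norm_nonneg _)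
  exact setIntegral_le_integral hi (Eventually.of_forall fun t => by positivity)

theorem norm_jF_le {ρ : ℂ} {C : ℝ} (hC : ∀ x, ‖jostM Q ρ x‖ ≤ C) (x : ℝ) :
    ‖jF Q ρ x‖ ≤ Real.exp (-(ρ.im * x)) * C := by
  rw [jF, norm_smul, Complex.norm_exp]
  have : (Complex.I * ρ * x).re = -(ρ.im * x) := by simp
  rw [this]
  exact mul_le_mul_of_nonneg_left (hC x) (Real.exp_pos _).le

theorem integrable_sq_of_exp_bounds {E : Type*} [NormedAddCommGroup E] {y : ℝ → E}
    (hy : Continuous y) {c K : ℝ} (hc : 0 < c) (h1 : ∀ x, ‖y x‖ ≤ K * Real.exp (-(c * x)))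
    (h2 : ∀ x, ‖y x‖ ≤ K * Real.exp (c * x)) : Integrable fun x => ‖y x‖ ^ 2 := by
  have hm := (hy.norm.pow 2).aestronglyMeasurable (μ := volume)
  rw [← integrableOn_univ, ← Iic_union_Ioi (a := (0 : ℝ))]
  refine IntegrableOn.union ?_ ?_
  · refine Integrable.mono' ((integrableOn_exp_mul_Iic (by linarith : 0 < 2 * c) 0).const_mul (K ^ 2))
      hm.restrict (Eventually.of_forall fun x => ?_)
    rw [Real.norm_of_nonneg (by positivity)]
    refine (pow_le_pow_left₀ (norm_nonneg _) (h2 x) 2).trans (le_of_eq ?_)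
    rw [mul_pow, ← Real.exp_nat_mul]
    congr 2
    push_cast; ring
  · refine Integrable.mono' ((integrableOn_exp_mul_Ioi (by linarith : -(2 * c) < 0) 0).const_mul
      (K ^ 2)) hm.restrict (Eventually.of_forall fun x => ?_)
    rw [Real.norm_of_nonneg (by positivity)]
    refine (pow_le_pow_left₀ (norm_nonneg _) (h1 x) 2).trans (le_of_eq ?_)
    rw [mul_pow, ← Real.exp_nat_mul]
    congr 2
    push_cast; ring

/-- A kernel vector v of D makes F_- v a multiple of F_+, so that it decays exponentially at both
ends. -/
theorem isEigenvalue_of_singular (hQ : SelfAdjointPotential Q) {ρ₀ : ℂ} (h0 : 0 < ρ₀.im)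
    (hs : ¬ IsUnit (jD Q ρ₀)) : IsEigenvalue Q (ρ₀ ^ 2) := by
  have hρ := mem_upperSet_of_pos h0
  rw [Matrix.isUnit_iff_isUnit_det, isUnit_iff_ne_zero, not_not] at hs
  obtain ⟨v, hv, hDv⟩ := Matrix.exists_mulVec_eq_zero_iff.2 hs
  -- The matrix with all columns equal to v turns the vector equation D v = 0 into the matrix form
  -- required by `exists_weight`.
  set B : Mat m := Matrix.of fun j _ => v j
  have hB : jD Q ρ₀ * B = 0 := by
    ext j k
    exact congrFun hDv j
  obtain ⟨N, hN⟩ := exists_weight hQ h0 hB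
  obtain ⟨k, hk⟩ := Function.ne_iff.1 hv
  have hBk : B *ᵥ Pi.single k 1 = v := by
    rw [Matrix.mulVec_single_one]; rfl
  set w := N *ᵥ Pi.single k 1
  have hy : ∀ x, jG Q ρ₀ x *ᵥ v = Complex.I • (jF Q ρ₀ x *ᵥ w) := fun x => by
    rw [← hBk, Matrix.mulVec_mulVec, hN, Matrix.smul_mulVec, ← Matrix.mulVec_mulVec]
  refine ⟨fun x => jG Q ρ₀ x *ᵥ v, (isSol_jG hQ.toFirstMoment hρ).isSolution v, fun h => ?_,
    fun j => ?_⟩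
  · obtain ⟨X, -, hX⟩ := exists_forall_norm_jostM_sub_one_le hQ.comp_neg.toFirstMoment
    have hu : IsUnit (jG Q ρ₀ (-X)) := by
      rw [jG, neg_neg]
      exact isUnit_exp_smul (isUnit_of_norm_sub_one_le (hX ρ₀ hρ X le_rfl)) _
    have h1 : jG Q ρ₀ (-X) *ᵥ v = jG Q ρ₀ (-X) *ᵥ 0 := by
      rw [Matrix.mulVec_zero]; exact congrFun h (-X)
    exact hv (Matrix.mulVec_injective_iff_isUnit.2 hu h1)
  · obtain ⟨C1, hC10, hC1⟩ := exists_forall_norm_jostM_le hQ hρ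
    obtain ⟨C2, hC20, hC2⟩ := exists_forall_norm_jostM_le hQ.comp_neg hρ
    have hcont : Continuous fun x => jG Q ρ₀ x *ᵥ v :=
      (mulVecL v).continuous.comp (isSol_jG hQ.toFirstMoment hρ).prim.continuous
    have hle : ∀ x, ‖(jG Q ρ₀ x *ᵥ v) j‖ ≤ vn (jG Q ρ₀ x *ᵥ v) := fun x =>
      PiLp.norm_apply_le (WithLp.toLp 2 (jG Q ρ₀ x *ᵥ v)) j
    have hcj : Continuous fun x => (jG Q ρ₀ x *ᵥ v) j := (continuous_apply j).comp hcont
    rw [memLp_two_iff_integrable_sq_norm hcj.aestronglyMeasurable]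
    refine integrable_sq_of_exp_bounds (K := C1 * vn w + C2 * vn v) hcj h0 (fun x => ?_) fun x => ?_
    · refine (hle x).trans ?_
      rw [hy, vn_smul, Complex.norm_I, one_mul]
      refine (vn_mulVec_le _ _).trans ?_
      have h3 := mul_le_mul_of_nonneg_right (norm_jF_le hC1 x) (vn_nonneg w)
      have h4 : 0 ≤ C2 * vn v * Real.exp (-(ρ₀.im * x)) := by
        have := vn_nonneg v; positivity
      linarith
    · refine (hle x).trans ((vn_mulVec_le _ _).trans ?_)
      have h3 := mul_le_mul_of_nonneg_right (norm_jF_le hC2 (-x)) (vn_nonneg v)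
      rw [mul_neg, neg_neg] at h3
      have h4 : 0 ≤ C1 * vn w * Real.exp (ρ₀.im * x) := by
        have := vn_nonneg w; positivity
      change ‖jG Q ρ₀ x‖ * vn v ≤ _ at h3
      linarith

theorem IsEigenvalue.of_comp_neg {lam : ℂ} (h : IsEigenvalue (fun t => Q (-t)) lam) :
    IsEigenvalue Q lam := by
  obtain ⟨y, ⟨y', hd, hi⟩, hne, hL⟩ := h
  refine ⟨fun x => y (-x), ⟨fun x => -y' (-x), fun x => ?_, fun a b => ?_⟩, fun h => hne ?_, fun j => ?_⟩
  · simpa [Function.comp_def] using (hd (-x)).scomp x (hasDerivAt_neg x)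
  · have h1 := intervalIntegral.integral_comp_neg (a := a) (b := b)
      (fun x => (Q (-x)).mulVec (y x) - lam • y x)
    rw [← hi] at h1
    simp only [neg_neg] at h1
    rw [h1, neg_sub_neg]
  · funext x
    simpa using congrFun h (-x)
  · exact (hL j).comp_measurePreserving (Measure.measurePreserving_neg volume)

theorem sq_injOn_im_pos {z w : ℂ} (hz : 0 < z.im) (hw : 0 < w.im) (h : z ^ 2 = w ^ 2) : z = w := by
  rcases sq_eq_sq_iff_eq_or_eq_neg.1 h with h | h
  · exact h
  · rw [h, Complex.neg_im] at hz
    linarith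

/-- A point singular for one potential is an eigenvalue of it, hence is listed in both collections
with the same weight. Squaring is injective on the upper half plane, so ρ₀ is recovered from ρ₀².
The converse, that eigenvalues are singular points, is not needed. -/
theorem commonWeights_of_discrete {W₁ W₂ : ℂ → Mat m} {E₁ E₂ : ℂ → Prop}
    (hW₁ : ∀ ρ : ℂ, 0 < ρ.im → IsRightWeight Q₁ ρ (W₁ ρ))
    (hW₂ : ∀ ρ : ℂ, 0 < ρ.im → IsRightWeight Q₂ ρ (W₂ ρ))
    (hE₁ : ∀ ρ : ℂ, 0 < ρ.im → ¬ IsUnit (jD Q₁ ρ) → E₁ (ρ ^ 2))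
    (hE₂ : ∀ ρ : ℂ, 0 < ρ.im → ¬ IsUnit (jD Q₂ ρ) → E₂ (ρ ^ 2))
    (h : {p : ℂ × Mat m | ∃ ρ : ℂ, 0 < ρ.im ∧ E₁ (ρ ^ 2) ∧ p = (ρ ^ 2, W₁ ρ)} =
      {p : ℂ × Mat m | ∃ ρ : ℂ, 0 < ρ.im ∧ E₂ (ρ ^ 2) ∧ p = (ρ ^ 2, W₂ ρ)}) :
    CommonWeights Q₁ Q₂ := by
  intro ρ₀ h0 hs
  have hW : W₁ ρ₀ = W₂ ρ₀ := by
    by_cases hu : IsUnit (jD Q₁ ρ₀)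
    · obtain ⟨ρ, hρ, -, he⟩ := h.symm.subset
        ⟨ρ₀, h0, hE₂ ρ₀ h0 fun hu' => hs ⟨hu, hu'⟩, rfl⟩
      obtain ⟨e1, e2⟩ := Prod.mk.inj he
      rw [e2, sq_injOn_im_pos h0 hρ e1]
    · obtain ⟨ρ, hρ, -, he⟩ := h.subset ⟨ρ₀, h0, hE₁ ρ₀ h0 hu, rfl⟩
      obtain ⟨e1, e2⟩ := Prod.mk.inj he
      rw [e2, sq_injOn_im_pos h0 hρ e1]
  obtain ⟨R₁, hR₁, hN₁⟩ := hW₁ ρ₀ h0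
  obtain ⟨R₂, hR₂, hN₂⟩ := hW₂ ρ₀ h0
  rw [← hW] at hN₂
  exact ⟨R₁, R₂, W₁ ρ₀, hR₁, hR₂, hN₁, hN₂⟩

theorem ae_eq_of_rightData_eq (h₁ : SelfAdjointPotential Q₁) (h₂ : SelfAdjointPotential Q₂)
    (h : rightData Q₁ = rightData Q₂) : Q₁ =ᵐ[volume] Q₂ := by
  refine ae_eq_of_scattering h₁ h₂ (fun s hs => ?_)
    (commonWeights_of_discrete (fun _ => isRightWeight_weightPlus h₁)
      (fun _ => isRightWeight_weightPlus h₂) (fun _ => isEigenvalue_of_singular h₁)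
      (fun _ => isEigenvalue_of_singular h₂) (congrArg ScatteringData.discrete h))
  have := congrFun (congrArg ScatteringData.scat h) ⟨s, hs⟩
  change scatPlus Q₁ s = scatPlus Q₂ s at this
  rwa [scatPlus_eq h₁ hs, scatPlus_eq h₂ hs] at this

/-- The left data of Q serve as right data of Q(-x), and the equality obtained is reflected back. -/
theorem ae_eq_of_leftData_eq (h₁ : SelfAdjointPotential Q₁) (h₂ : SelfAdjointPotential Q₂)
    (h : leftData Q₁ = leftData Q₂) : Q₁ =ᵐ[volume] Q₂ := by
  have h3 := ae_eq_of_scattering h₁.comp_neg h₂.comp_neg (fun s hs => ?_)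
    (commonWeights_of_discrete (fun _ => isRightWeight_weightMinus h₁)
      (fun _ => isRightWeight_weightMinus h₂)
      (fun _ h0 hs => (isEigenvalue_of_singular h₁.comp_neg h0 hs).of_comp_neg)
      (fun _ h0 hs => (isEigenvalue_of_singular h₂.comp_neg h0 hs).of_comp_neg)
      (congrArg ScatteringData.discrete h))
  · have h4 : ∀ᵐ x, Q₁ x = Q₂ x := by simpa only [neg_neg] using ae_comp_neg h3
    exact h4
  · have := congrFun (congrArg ScatteringData.scat h) ⟨s, hs⟩
    change scatMinus Q₁ s = scatMinus Q₂ s at this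
    rwa [scatMinus_eq h₁ hs, scatMinus_eq h₂ hs] at this

end Discrete

end MatrixScattering
end

theorem mainTheorem4 (m : ℕ) (Q₁ Q₂ : ℝ → MatrixScattering.Mat m)
    (h₁ : MatrixScattering.IsPotential Q₁) (h₂ : MatrixScattering.IsPotential Q₂) :
    (MatrixScattering.rightData Q₁ = MatrixScattering.rightData Q₂ → Q₁ =ᵐ[volume] Q₂) ∧
    (MatrixScattering.leftData Q₁ = MatrixScattering.leftData Q₂ → Q₁ =ᵐ[volume] Q₂) :=
  ⟨MatrixScattering.ae_eq_of_rightData_eq h₁.selfAdjointPotential h₂.selfAdjointPotential,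
    MatrixScattering.ae_eq_of_leftData_eq h₁.selfAdjointPotential h₂.selfAdjointPotential⟩
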